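/- **Theorem.** Let $(M,g)$ be a smooth, connected, Hausdorff pseudo-Riemannian manifold (any signature) of dimension $n\ge 5$, with Levi-Civita connection $\nabla$, Ricci tensor $R_{ij}$, curvature scalar $R$ and Weyl tensor $C_{jklm}$. Suppose that $M$ is conformally recurrent, i.e. $\nabla_i C_{jklm}=\alpha_i C_{jklm}$ for a smooth covector field $\alpha$ (the recurrence vector) that is not identically zero; that $C^2=C_{jklm}C^{jklm}$ vanishes at no point; and that the tensor field $$h_{ij}=\frac{1}{C^2}\,C_i{}^{klm}C_{jklm}$$ is not of the form $f\,g_{ij}$ with a scalar function $f$. Then there are an integer $n_h$ with $0<n_h<n$ and a smooth function $G:M\to\mathbb R$ such that at every point of $M$ the following hold. 1. (Grycak's relation) $R_{ij}-\frac{R}{n}g_{ij}=G\left(h_{ij}-\frac1n g_{ij}\right)$. 2. $n_h$ is the dimension of the eigenspace of $h^i{}_j$ for the eigenvalue $\frac{n-3}{2(n-2)}$, and $$P^i{}_j=\frac{2(n-2)(n-n_h)}{(n-1)(n-4)}\,h^i{}_j+\frac{n_h(n-3)-2(n-2)}{(n-1)(n-4)}\,\delta^i{}_j$$ is a projector ($P^2=P$)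 of rank $n_h$ whose image is that eigenspace. The images of $P$ are tangent to submanifolds of dimension $n_h$: through every point of $M$ passes an $n_h$-dimensional submanifold whose tangent space at each of its points is the image of $P$ there. 3. The eigenvalues of the Ricci operator $R^i{}_j$ are exactly the (at most two distinct) numbers $$\mu=\frac Rn+G\,\frac{(n-1)(n-4)}{2n(n-2)},\qquad \mu'=\frac Rn-G\,\frac{(n-1)(n-4)\,n_h}{2n(n-2)(n-n_h)},$$ with multiplicities $n_h$ and $n-n_h$, that is, the characteristic polynomial of $R^i{}_j$ is $(X-\mu)^{n_h}(X-\mu')^{n-n_h}$. 4. $R^i{}_j=\mu P^i{}_j+\mu'(\delta^i{}_j-P^i{}_j)$ and $R=n_h\mu+(n-n_h)\mu'$. 5. $P^i{}_j\alpha^j=\alpha^i$ and $R^i{}_j\alpha^j=\mu\,\alpha^i$. -/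

import Mathlib

open scoped Manifold ContDiff

noncomputable section

namespace ConfRec

/-- The model space `ℝⁿ` of an `n`-dimensional manifold. -/
abbrev E (n : ℕ) : Type := EuclideanSpace ℝ (Fin n)

/-! ### Tensor calculus in one coordinate system

`g : E n → Matrix (Fin n) (Fin n) ℝ` are the components `g_{ij}` of a metric as functions of the
coordinates; `(g x)⁻¹` has the components `g^{ij}`. -/

section Coordinates

variable {n : ℕ}

/-- The partial derivative `∂_i f` at `x`. -/
def pd (i : Fin n) (f : E n → ℝ) (x : E n) : ℝ :=
  fderiv ℝ f x (EuclideanSpace.single i 1)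

/-- The Christoffel symbols `Γ^m_{ij}` of the Levi-Civita connection. -/
def christoffel (g : E n → Matrix (Fin n) (Fin n) ℝ) (m i j : Fin n) (x : E n) : ℝ :=
  (1 / 2) * ∑ l, (g x)⁻¹ m l *
    (pd i (fun y => g y j l) x + pd j (fun y => g y i l) x - pd l (fun y => g y i j) x)

/-- The Riemann tensor `R_{ijk}{}^m`, with the sign for which
`[∇_i, ∇_j] a_k = R_{ijk}{}^m a_m`. -/
def riemann (g : E n → Matrix (Fin n) (Fin n) ℝ) (i j k m : Fin n) (x : E n) : ℝ :=
  -(pd i (christoffel g m j k) x - pd j (christoffel g m i k) x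
    + ∑ l, (christoffel g m i l x * christoffel g l j k x
        - christoffel g m j l x * christoffel g l i k x))

/-- The Ricci tensor `R_{kl} = - R_{mkl}{}^m`. -/
def ricci (g : E n → Matrix (Fin n) (Fin n) ℝ) (x : E n) : Matrix (Fin n) (Fin n) ℝ :=
  fun k l => -∑ m, riemann g m k l m x

/-- The Ricci tensor with the first index raised, `R^i{}_j = g^{ik} R_{kj}`. -/
def ricciOp (g : E n → Matrix (Fin n) (Fin n) ℝ) (x : E n) : Matrix (Fin n) (Fin n) ℝ :=
  (g x)⁻¹ * ricci g x

/-- The curvature scalar `R = g^{ij} R_{ij}`. -/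
def scal (g : E n → Matrix (Fin n) (Fin n) ℝ) (x : E n) : ℝ :=
  ∑ i, ∑ j, (g x)⁻¹ i j * ricci g x i j

/-- The Weyl tensor `C_{jkl}{}^m`. -/
def weylMixed (g : E n → Matrix (Fin n) (Fin n) ℝ) (j k l m : Fin n) (x : E n) : ℝ :=
  riemann g j k l m x
    + (1 / ((n : ℝ) - 2)) *
      ((1 : Matrix (Fin n) (Fin n) ℝ) j m * ricci g x k l
        - (1 : Matrix (Fin n) (Fin n) ℝ) k m * ricci g x j l
        + ricciOp g x m j * g x k l - ricciOp g x m k * g x j l)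
    - scal g x / (((n : ℝ) - 1) * ((n : ℝ) - 2)) *
      ((1 : Matrix (Fin n) (Fin n) ℝ) j m * g x k l
        - (1 : Matrix (Fin n) (Fin n) ℝ) k m * g x j l)

/-- The Weyl tensor `C_{jklm} = C_{jkl}{}^p g_{pm}`. -/
def weyl (g : E n → Matrix (Fin n) (Fin n) ℝ) (j k l m : Fin n) (x : E n) : ℝ :=
  ∑ p, weylMixed g j k l p x * g x p m

/-- The covariant derivative `∇_i C_{jklm}` of the Weyl tensor. -/
def covDerivWeyl (g : E n → Matrix (Fin n) (Fin n) ℝ) (i j k l m : Fin n) (x : E n) : ℝ :=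
  pd i (weyl g j k l m) x
    - ∑ p, (christoffel g p i j x * weyl g p k l m x + christoffel g p i k x * weyl g j p l m x
        + christoffel g p i l x * weyl g j k p m x + christoffel g p i m x * weyl g j k l p x)

/-- The Weyl tensor with three indices raised, `C_i{}^{klm}`. -/
def weylRaised (g : E n → Matrix (Fin n) (Fin n) ℝ) (i k l m : Fin n) (x : E n) : ℝ :=
  ∑ a, ∑ b, ∑ c, (g x)⁻¹ k a * (g x)⁻¹ l b * (g x)⁻¹ m c * weyl g i a b c x

/-- The symmetric tensor `C_i{}^{klm} C_{jklm}`. -/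
def weylContr (g : E n → Matrix (Fin n) (Fin n) ℝ) (x : E n) : Matrix (Fin n) (Fin n) ℝ :=
  fun i j => ∑ k, ∑ l, ∑ m, weylRaised g i k l m x * weyl g j k l m x

/-- The square `C² = C_{jklm} C^{jklm}` of the Weyl tensor. -/
def weylSq (g : E n → Matrix (Fin n) (Fin n) ℝ) (x : E n) : ℝ :=
  ∑ i, ∑ j, (g x)⁻¹ i j * weylContr g x i j

/-- The tensor `h_{ij} = C_i{}^{klm} C_{jklm} / C²`. -/
def hTensor (g : E n → Matrix (Fin n) (Fin n) ℝ) (x : E n) : Matrix (Fin n) (Fin n) ℝ :=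
  (1 / weylSq g x) • weylContr g x

/-- The tensor `h` with the first index raised, `h^i{}_j = g^{ik} h_{kj}`. -/
def hOp (g : E n → Matrix (Fin n) (Fin n) ℝ) (x : E n) : Matrix (Fin n) (Fin n) ℝ :=
  (g x)⁻¹ * hTensor g x

/-- The operator
`P^i{}_j = 2(n-2)(n-n_h)/((n-1)(n-4)) h^i{}_j + (n_h(n-3)-2(n-2))/((n-1)(n-4)) δ^i{}_j`. -/
def proj (nh : ℕ) (g : E n → Matrix (Fin n) (Fin n) ℝ) (x : E n) : Matrix (Fin n) (Fin n) ℝ :=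
  (2 * ((n : ℝ) - 2) * ((n : ℝ) - nh) / (((n : ℝ) - 1) * ((n : ℝ) - 4))) • hOp g x
    + (((nh : ℝ) * ((n : ℝ) - 3) - 2 * ((n : ℝ) - 2)) / (((n : ℝ) - 1) * ((n : ℝ) - 4))) •
      (1 : Matrix (Fin n) (Fin n) ℝ)

/-- The image of the projector-valued function `P` is, through the point `x` of the open set `U`,
tangent to a `d`-dimensional (immersed) submanifold: there is a smooth parametrization `u` of a
piece of submanifold of `U` through `x`, whose tangent space at each of its points is the image of
`P` there. Used with `P` of rank `d`, so that `u` is an immersion. -/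
def HasIntegralSubmanifold (d : ℕ) (P : E n → Matrix (Fin n) (Fin n) ℝ) (U : Set (E n))
    (x : E n) : Prop :=
  ∃ (ε : ℝ) (u : E d → E n), 0 < ε ∧ ContDiffOn ℝ ∞ u (Metric.ball 0 ε) ∧ u 0 = x ∧
    Set.InjOn u (Metric.ball 0 ε) ∧
    ∀ y ∈ Metric.ball (0 : E d) ε, u y ∈ U ∧
      (fderiv ℝ u y).range = (Matrix.toEuclideanLin (P (u y))).range

end Coordinates

/-! ### Pseudo-Riemannian manifolds -/

section Manifold

variable {n : ℕ} {M : Type*} [TopologicalSpace M] [ChartedSpace (E n) M]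

variable (n M) in
/-- A smooth pseudo-Riemannian metric (of any signature) on the `n`-dimensional manifold `M`. -/
structure PseudoRiemannianMetric [IsManifold 𝓘(ℝ, E n) ∞ M] where
  /-- The bilinear form on each tangent space. -/
  val : ∀ p : M, TangentSpace 𝓘(ℝ, E n) p →L[ℝ] TangentSpace 𝓘(ℝ, E n) p →L[ℝ] ℝ
  symm : ∀ (p : M) (v w : TangentSpace 𝓘(ℝ, E n) p), val p v w = val p w v
  nondegenerate : ∀ (p : M) (v : TangentSpace 𝓘(ℝ, E n) p), (∀ w, val p v w = 0) → v = 0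
  contMDiff : ContMDiff 𝓘(ℝ, E n) (𝓘(ℝ, E n).prod 𝓘(ℝ, E n →L[ℝ] E n →L[ℝ] ℝ)) ∞
    (fun p : M => Bundle.TotalSpace.mk' (E n →L[ℝ] E n →L[ℝ] ℝ)
      (E := fun p : M => TangentSpace 𝓘(ℝ, E n) p →L[ℝ] TangentSpace 𝓘(ℝ, E n) p →L[ℝ] ℝ)
      p (val p))

variable (n M) in
/-- A smooth covector field (1-form) on `M`. -/
structure CovectorField [IsManifold 𝓘(ℝ, E n) ∞ M] where
  /-- The linear form on each tangent space. -/
  val : ∀ p : M, TangentSpace 𝓘(ℝ, E n) p →L[ℝ] ℝ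
  contMDiff : ContMDiff 𝓘(ℝ, E n) (𝓘(ℝ, E n).prod 𝓘(ℝ, E n →L[ℝ] ℝ)) ∞
    (fun p : M => Bundle.TotalSpace.mk' (E n →L[ℝ] ℝ)
      (E := fun p : M => TangentSpace 𝓘(ℝ, E n) p →L[ℝ] ℝ) p (val p))

/-- The `i`-th coordinate vector `∂/∂x^i` of the chart `φ`, at the point with coordinates `x`. -/
def coordVec (φ : OpenPartialHomeomorph M (E n)) (x : E n) (i : Fin n) :
    TangentSpace 𝓘(ℝ, E n) (φ.symm x) :=
  mfderiv 𝓘(ℝ, E n) 𝓘(ℝ, E n) φ.symm x (EuclideanSpace.single i (1 : ℝ) : E n)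

variable [IsManifold 𝓘(ℝ, E n) ∞ M]

/-- The components `g_{ij}` of the metric in the chart `φ`, as functions of the coordinates. -/
def PseudoRiemannianMetric.coord (g : PseudoRiemannianMetric n M)
    (φ : OpenPartialHomeomorph M (E n)) (x : E n) : Matrix (Fin n) (Fin n) ℝ :=
  fun i j => g.val (φ.symm x) (coordVec φ x i) (coordVec φ x j)

/-- The components `α_i` of a covector field in the chart `φ`, as functions of the coordinates. -/
def CovectorField.coord (α : CovectorField n M)
    (φ : OpenPartialHomeomorph M (E n)) (x : E n) : Fin n → ℝ :=
  fun i => α.val (φ.symm x) (coordVec φ x i)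

/-- The components `α^i = g^{ij} α_j` in the chart `φ`. -/
def CovectorField.coordUp (α : CovectorField n M) (g : PseudoRiemannianMetric n M)
    (φ : OpenPartialHomeomorph M (E n)) (x : E n) : Fin n → ℝ :=
  (g.coord φ x)⁻¹.mulVec (α.coord φ x)

/-- `(M, g)` is conformally recurrent with recurrence vector `α`: the covector field `α` is not
the zero field, and `∇_i C_{jklm} = α_i C_{jklm}` in all smooth local coordinates. -/
def IsConformallyRecurrent (g : PseudoRiemannianMetric n M) (α : CovectorField n M) : Prop :=
  (∃ p, α.val p ≠ 0) ∧
  ∀ φ ∈ IsManifold.maximalAtlas 𝓘(ℝ, E n) ∞ M, ∀ x ∈ φ.target, ∀ i j k l m : Fin n,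
    covDerivWeyl (g.coord φ) i j k l m x = α.coord φ x i * weyl (g.coord φ) j k l m x

/-- `C² ≠ 0` at every point of the manifold. -/
def WeylSqNeZero (g : PseudoRiemannianMetric n M) : Prop :=
  ∀ φ ∈ IsManifold.maximalAtlas 𝓘(ℝ, E n) ∞ M, ∀ x ∈ φ.target, weylSq (g.coord φ) x ≠ 0

/-- The tensor field `h` is a (scalar function) multiple of the metric. -/
def HProportional (g : PseudoRiemannianMetric n M) : Prop :=
  ∃ f : M → ℝ, ∀ φ ∈ IsManifold.maximalAtlas 𝓘(ℝ, E n) ∞ M, ∀ x ∈ φ.target,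
    hTensor (g.coord φ) x = f (φ.symm x) • g.coord φ x

end Manifold

/-- `μ = R/n + G (n-1)(n-4)/(2n(n-2))`. -/
def mu (n : ℕ) (R G : ℝ) : ℝ :=
  R / n + G * ((((n : ℝ) - 1) * ((n : ℝ) - 4)) / (2 * n * ((n : ℝ) - 2)))

/-- `μ' = R/n - G (n-1)(n-4) n_h/(2n(n-2)(n-n_h))`. -/
def mu' (n nh : ℕ) (R G : ℝ) : ℝ :=
  R / n - G * ((((n : ℝ) - 1) * ((n : ℝ) - 4) * nh) / (2 * n * ((n : ℝ) - 2) * ((n : ℝ) - nh)))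

end ConfRec

end

/-! Write the Weyl tensor as C = -R + kn(S), where R_jk are the curvature operators (with the sign
opposite to `riemann`), S is the Schouten operator and kn(T)_jk = e_j ∧ T e_k + T e_j ∧ e_k.
Contracting ∇C = αC with C gives d(C²) = 2C²α. Hence α is half the logarithmic differential of C²,
so it is closed, and the normalised square h of C is parallel (`nab_hOp`). The second Bianchi
identity contracted with C makes α an eigenvector: hα = λα with λ = (n-3)/(2(n-2))
(`vecMul_contr_eq`). Since n ≥ 5, λ differs from 1/n, the mean of the eigenvalues of h.

Recurrence also reads ∇_i R = α_i R + kn(D_i) with D_i = ∇_i S - α_i S. An operator A with ∇A = βA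
and β closed commutes with R, hence with ∇_i R, hence with every kn(D_i) (`kn_dOp_commute`). For A =
h, a trace of this commutation shows that (nD_i + tr D_i)h₀ is a multiple of the identity, h₀ being
the traceless part of h. This is exactly what makes K = (nS + tr S)h₀ - tr(Sh₀) recurrent with
covector α (`nab_kOp`), so K commutes with every kn(D_i) as well.

There is a point with α ≠ 0 at which h satisfies (h-λ)(h-λ') = 0 for some number λ' and K is a
multiple of h₀ (`exists_spectral`). If some D_i is nonzero at a point with α ≠ 0, both facts follow
from the commutation of h and K with kn(D_i) (`spectral_of_kn_commute`). If every D_i vanishes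
wherever α does not, then S is recurrent there and the Bianchi identity becomes α_[i R_jk] = 0.
Every R_jk is then a wedge with α, the Ricci operator satisfies Ric² = (tr Ric / 2) Ric, and
computing the square of C exhibits h as an affine function of Ric (`spectral_of_cyclic`).

These facts spread over M. The operator (h-λ)(h-λ') is parallel and the part of K orthogonal to h₀
is recurrent, so each solves a linear first-order system and its zero set is open as well as closed
(`forall_coord_eq_zero`). The number λ' is fixed by tr h = 1 and the multiplicity n_h of λ. As
neither eigenvalue equals 1/n, h₀ is invertible, and K = s h₀ can be solved for S: the Ricci
operator is a combination of h₀ and the identity, which is Grycak's relation (`ricciOp_eq`). The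
spectral statements follow by inserting h = λP + λ'(1-P). Finally P is affine in h, hence parallel,
and the image of a projector that is parallel for a torsion-free connection is integrable
(`exists_integral_of_parallel`). -/

noncomputable section
namespace ConfRec

/-! ### Partial derivatives of functions on an open set. -/

section Calculus

variable {n : ℕ} {U : Set (E n)} {x : E n} {f f₁ f₂ : E n → ℝ}

/-- Smooth real functions on `U`. -/
abbrev Sm (U : Set (E n)) (f : E n → ℝ) : Prop := ContDiffOn ℝ ∞ f U

theorem Sm.diffAt (hU : IsOpen U) (hf : Sm U f) (hx : x ∈ U) : DifferentiableAt ℝ f x :=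
  (hf.contDiffAt (hU.mem_nhds hx)).differentiableAt (by simp)

theorem Sm.pd (hU : IsOpen U) (i : Fin n) (hf : Sm U f) : Sm U (pd i f) := by
  have h : ContDiffOn ℝ ∞ (fderiv ℝ f) U := hf.fderiv_of_isOpen hU (by simp)
  exact h.clm_apply contDiffOn_const

theorem Sm.sum {ι : Type*} {s : Finset ι} {F : ι → E n → ℝ} (h : ∀ k ∈ s, Sm U (F k)) :
    Sm U (fun y => ∑ k ∈ s, F k y) := ContDiffOn.sum h

theorem pd_congr_of_eqOn (hU : IsOpen U) (h : Set.EqOn f₁ f₂ U) (hx : x ∈ U) (i : Fin n) :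
    pd i f₁ x = pd i f₂ x := by
  unfold pd
  rw [Filter.EventuallyEq.fderiv_eq (h.eventuallyEq_of_mem (hU.mem_nhds hx))]

theorem pd_add (i : Fin n) (h₁ : DifferentiableAt ℝ f₁ x) (h₂ : DifferentiableAt ℝ f₂ x) :
    pd i (fun y => f₁ y + f₂ y) x = pd i f₁ x + pd i f₂ x := by
  simp [pd, fderiv_fun_add h₁ h₂]

theorem pd_sub (i : Fin n) (h₁ : DifferentiableAt ℝ f₁ x) (h₂ : DifferentiableAt ℝ f₂ x) :
    pd i (fun y => f₁ y - f₂ y) x = pd i f₁ x - pd i f₂ x := by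
  simp [pd, fderiv_fun_sub h₁ h₂]

theorem pd_neg (i : Fin n) : pd i (fun y => - f y) x = - pd i f x := by
  simp [pd, fderiv_fun_neg]

theorem pd_mul (i : Fin n) (h₁ : DifferentiableAt ℝ f₁ x) (h₂ : DifferentiableAt ℝ f₂ x) :
    pd i (fun y => f₁ y * f₂ y) x = pd i f₁ x * f₂ x + f₁ x * pd i f₂ x := by
  simp [pd, fderiv_fun_mul h₁ h₂]; ring

theorem pd_const (i : Fin n) (c : ℝ) : pd i (fun _ => c) x = 0 := by
  simp [pd]

theorem pd_const_mul (i : Fin n) (c : ℝ) (h₁ : DifferentiableAt ℝ f x) :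
    pd i (fun y => c * f y) x = c * pd i f x := by
  simp [pd, fderiv_const_mul h₁]

theorem pd_sum {ι : Type*} {s : Finset ι} {F : ι → E n → ℝ} (i : Fin n)
    (h : ∀ k ∈ s, DifferentiableAt ℝ (F k) x) :
    pd i (fun y => ∑ k ∈ s, F k y) x = ∑ k ∈ s, pd i (F k) x := by
  simp [pd, fderiv_fun_sum h]

theorem pd_comm (hU : IsOpen U) (hf : Sm U f) (hx : x ∈ U) (i j : Fin n) :
    pd i (pd j f) x = pd j (pd i f) x := by
  have h2 : IsSymmSndFDerivAt ℝ f x :=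
    (hf.contDiffAt (hU.mem_nhds hx)).isSymmSndFDerivAt (by
      rw [minSmoothness_of_isRCLikeNormedField]; exact WithTop.coe_le_coe.2 le_top)
  have hd : DifferentiableAt ℝ (fderiv ℝ f) x :=
    ((hf.fderiv_of_isOpen hU (m := ∞) (by simp)).contDiffAt (hU.mem_nhds hx)).differentiableAt
      (by simp)
  have key : ∀ a b : Fin n, pd a (pd b f) x =
      fderiv ℝ (fderiv ℝ f) x (EuclideanSpace.single a 1) (EuclideanSpace.single b 1) := by
    intro a b
    unfold pd
    rw [fderiv_clm_apply hd (differentiableAt_const _)]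
    simp
  rw [key, key]
  exact h2 _ _

theorem fderiv_apply_eq_sum (f : E n → ℝ) (x v : E n) :
    fderiv ℝ f x v = ∑ i, v i * pd i f x := by
  conv_lhs => rw [← (EuclideanSpace.basisFun (Fin n) ℝ).sum_repr v]
  simp [pd]

end Calculus

/-! ### Entrywise calculus of matrix-valued functions. -/

section MatrixCalculus

variable {n : ℕ} {U : Set (E n)} {x : E n} {a b c : Type*}

/-- The entrywise partial derivative of a matrix-valued function. -/
def mpd (i : Fin n) (A : E n → Matrix a b ℝ) (x : E n) : Matrix a b ℝ :=
  Matrix.of fun k l => pd i (fun y => A y k l) x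

/-- Matrix-valued functions with smooth entries on `U`. -/
def MSm (U : Set (E n)) (A : E n → Matrix a b ℝ) : Prop := ∀ k l, Sm U (fun y => A y k l)

theorem mpd_apply (i : Fin n) (A : E n → Matrix a b ℝ) (x : E n) (k : a) (l : b) :
    mpd i A x k l = pd i (fun y => A y k l) x := rfl

theorem MSm.diffAt {A : E n → Matrix a b ℝ} (hU : IsOpen U) (hA : MSm U A) (hx : x ∈ U) (k : a)
    (l : b) : DifferentiableAt ℝ (fun y => A y k l) x := (hA k l).diffAt hU hx

theorem MSm.mpd {A : E n → Matrix a b ℝ} (hU : IsOpen U) (hA : MSm U A) (i : Fin n) :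
    MSm U (mpd i A) := fun k l => (hA k l).pd hU i

theorem MSm.add {A B : E n → Matrix a b ℝ} (hA : MSm U A) (hB : MSm U B) :
    MSm U (fun y => A y + B y) := fun k l => (hA k l).add (hB k l)

theorem MSm.sub {A B : E n → Matrix a b ℝ} (hA : MSm U A) (hB : MSm U B) :
    MSm U (fun y => A y - B y) := fun k l => (hA k l).sub (hB k l)

theorem MSm.neg {A : E n → Matrix a b ℝ} (hA : MSm U A) :
    MSm U (fun y => - A y) := fun k l => (hA k l).neg

theorem MSm.const (A : Matrix a b ℝ) : MSm U (fun _ => A) := fun _ _ => contDiffOn_const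

theorem MSm.transpose {A : E n → Matrix a b ℝ} (hA : MSm U A) :
    MSm U (fun y => (A y).transpose) := fun k l => hA l k

theorem MSm.smul {A : E n → Matrix a b ℝ} {f : E n → ℝ} (hf : Sm U f) (hA : MSm U A) :
    MSm U (fun y => f y • A y) := fun k l => hf.mul (hA k l)

theorem MSm.mul [Fintype b] {A : E n → Matrix a b ℝ} {B : E n → Matrix b c ℝ} (hA : MSm U A)
    (hB : MSm U B) : MSm U (fun y => A y * B y) := by
  intro k l
  simp only [Matrix.mul_apply]
  exact Sm.sum fun p _ => (hA k p).mul (hB p l)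

theorem MSm.sum {ι : Type*} {s : Finset ι} {A : ι → E n → Matrix a b ℝ}
    (hA : ∀ p ∈ s, MSm U (A p)) : MSm U (fun y => ∑ p ∈ s, A p y) := by
  intro k l
  simp only [Matrix.sum_apply]
  exact Sm.sum fun p hp => hA p hp k l

theorem MSm.trace [Fintype a] {A : E n → Matrix a a ℝ} (hA : MSm U A) :
    Sm U (fun y => (A y).trace) := by
  simp only [Matrix.trace, Matrix.diag]
  exact Sm.sum fun p _ => hA p p

theorem MSm.det [Fintype a] [DecidableEq a] {A : E n → Matrix a a ℝ} (hA : MSm U A) :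
    Sm U (fun y => (A y).det) := by
  simp only [Matrix.det_apply]
  refine Sm.sum fun σ _ => ?_
  simp only [Units.smul_def, zsmul_eq_mul]
  exact contDiffOn_const.mul (contDiffOn_prod fun i _ => hA _ _)

/-- By Cramer's rule the entries are quotients by the determinant of determinants of matrices with
one row replaced by a constant row. -/
theorem MSm.inv [Fintype a] [DecidableEq a] {A : E n → Matrix a a ℝ} (hA : MSm U A)
    (hd : ∀ y ∈ U, IsUnit (A y).det) : MSm U (fun y => (A y)⁻¹) := by
  intro k l
  simp only [Matrix.inv_def, Matrix.smul_apply, smul_eq_mul, Ring.inverse_eq_inv']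
  refine ContDiffOn.mul (hA.det.inv fun y hy => (hd y hy).ne_zero) ?_
  simp only [Matrix.adjugate_apply]
  refine MSm.det (A := fun y => (A y).updateRow l (Pi.single k 1)) fun p q => ?_
  by_cases h : p = l
  · subst h; simp only [Matrix.updateRow_self]; exact contDiffOn_const
  · simp only [Matrix.updateRow_ne h]; exact hA p q

theorem mpd_congr {A B : E n → Matrix a b ℝ} (hU : IsOpen U) (h : Set.EqOn A B U) (hx : x ∈ U)
    (i : Fin n) : mpd i A x = mpd i B x := by
  ext k l
  exact pd_congr_of_eqOn hU (fun y hy => by simp [h hy]) hx i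

variable (hU : IsOpen U) (hx : x ∈ U) (i : Fin n)

theorem mpd_const (A : Matrix a b ℝ) : mpd i (fun _ => A) x = 0 := by
  ext; simp [mpd, pd_const]

theorem mpd_transpose (A : E n → Matrix a b ℝ) :
    mpd i (fun y => (A y).transpose) x = (mpd i A x).transpose := rfl

include hU hx

theorem mpd_add {A B : E n → Matrix a b ℝ} (hA : MSm U A) (hB : MSm U B) :
    mpd i (fun y => A y + B y) x = mpd i A x + mpd i B x := by
  ext k l; exact pd_add i (hA.diffAt hU hx k l) (hB.diffAt hU hx k l)

theorem mpd_sub {A B : E n → Matrix a b ℝ} (hA : MSm U A) (hB : MSm U B) :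
    mpd i (fun y => A y - B y) x = mpd i A x - mpd i B x := by
  ext k l; exact pd_sub i (hA.diffAt hU hx k l) (hB.diffAt hU hx k l)

theorem mpd_smul {A : E n → Matrix a b ℝ} {f : E n → ℝ} (hf : Sm U f) (hA : MSm U A) :
    mpd i (fun y => f y • A y) x = pd i f x • A x + f x • mpd i A x := by
  ext k l; exact pd_mul i (hf.diffAt hU hx) (hA.diffAt hU hx k l)

theorem mpd_mul [Fintype b] {A : E n → Matrix a b ℝ} {B : E n → Matrix b c ℝ} (hA : MSm U A)
    (hB : MSm U B) : mpd i (fun y => A y * B y) x = mpd i A x * B x + A x * mpd i B x := by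
  ext k l
  simp only [mpd, Matrix.of_apply, Matrix.add_apply, Matrix.mul_apply]
  rw [← Finset.sum_add_distrib]
  refine (pd_sum i fun p _ => (hA.diffAt hU hx k p).fun_mul (hB.diffAt hU hx p l)).trans ?_
  exact Finset.sum_congr rfl fun p _ => pd_mul i (hA.diffAt hU hx k p) (hB.diffAt hU hx p l)

theorem mpd_sum {ι : Type*} {s : Finset ι} {A : ι → E n → Matrix a b ℝ}
    (hA : ∀ p ∈ s, MSm U (A p)) : mpd i (fun y => ∑ p ∈ s, A p y) x = ∑ p ∈ s, mpd i (A p) x := by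
  ext k l
  simp only [mpd, Matrix.of_apply, Matrix.sum_apply]
  exact pd_sum i fun p hp => (hA p hp).diffAt hU hx k l

theorem pd_trace [Fintype a] {A : E n → Matrix a a ℝ} (hA : MSm U A) :
    pd i (fun y => (A y).trace) x = (mpd i A x).trace := by
  simp only [Matrix.trace, Matrix.diag, mpd, Matrix.of_apply]
  exact pd_sum i fun p _ => hA.diffAt hU hx p p

theorem mpd_comm {A : E n → Matrix a b ℝ} (hA : MSm U A) (j : Fin n) :
    mpd i (mpd j A) x = mpd j (mpd i A) x := by
  ext k l; exact pd_comm hU (hA k l) hx i j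

/-- Differentiate A A⁻¹ = 1, which holds on a whole neighbourhood of the point. -/
theorem mpd_inv [Fintype a] [DecidableEq a] {A : E n → Matrix a a ℝ} (hA : MSm U A)
    (hd : ∀ y ∈ U, IsUnit (A y).det) :
    mpd i (fun y => (A y)⁻¹) x = - ((A x)⁻¹ * mpd i A x * (A x)⁻¹) := by
  have h1 : mpd i (fun y => A y * (A y)⁻¹) x = 0 := by
    rw [mpd_congr hU (B := fun _ => 1) (fun y hy => Matrix.mul_nonsing_inv _ (hd y hy)) hx,
      mpd_const]
  rw [mpd_mul hU hx i hA (hA.inv hd)] at h1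
  have h2 : (A x)⁻¹ * (mpd i A x * (A x)⁻¹ + A x * mpd i (fun y => (A y)⁻¹) x) = 0 := by
    rw [h1, mul_zero]
  rw [mul_add, ← mul_assoc, ← mul_assoc, Matrix.nonsing_inv_mul _ (hd x hx), one_mul] at h2
  rw [eq_neg_iff_add_eq_zero, add_comm]; exact h2

end MatrixCalculus

end ConfRec
end

noncomputable section
namespace ConfRec

/-! ### Levi-Civita connection and curvature in one chart, as matrices. -/

section LocalGeometry

variable {n : ℕ}

/-- The matrix `g` of functions is a smooth pseudo-Riemannian metric on the open set `U`. -/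
structure LocalMetric (U : Set (E n)) (g : E n → Matrix (Fin n) (Fin n) ℝ) : Prop where
  isOpen : IsOpen U
  smooth : MSm U g
  symm : ∀ x ∈ U, (g x).transpose = g x
  unit : ∀ x ∈ U, IsUnit (g x).det

/-- The connection matrices `(Γ_i)^m_k`. -/
def gam (g : E n → Matrix (Fin n) (Fin n) ℝ) (i : Fin n) (x : E n) : Matrix (Fin n) (Fin n) ℝ :=
  Matrix.of fun m k => christoffel g m i k x

/-- The curvature matrices `∂_i Γ_j - ∂_j Γ_i + [Γ_i, Γ_j]`. -/
def curv (g : E n → Matrix (Fin n) (Fin n) ℝ) (i j : Fin n) (x : E n) :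
    Matrix (Fin n) (Fin n) ℝ :=
  mpd i (gam g j) x - mpd j (gam g i) x + (gam g i x * gam g j x - gam g j x * gam g i x)

variable {U : Set (E n)} {g : E n → Matrix (Fin n) (Fin n) ℝ} {x : E n}

/-- Passage to operators: the upper index becomes the row and the last covariant index the column,
so that curvature identities become identities in a noncommutative ring. -/
theorem riemann_eq (i j k m : Fin n) : riemann g i j k m x = - curv g i j x m k := by
  simp only [riemann, curv, Matrix.add_apply, Matrix.sub_apply, Matrix.mul_apply, mpd_apply,
    gam, Matrix.of_apply, Finset.sum_sub_distrib]

theorem ricci_eq (k l : Fin n) : ricci g x k l = ∑ m, curv g m k x m l := by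
  simp [ricci, riemann_eq]

theorem curv_antisymm (i j : Fin n) : curv g j i x = - curv g i j x := by
  unfold curv; abel

namespace LocalMetric

variable (h : LocalMetric U g)
include h

theorem symm_apply (hx : x ∈ U) (i j : Fin n) : g x i j = g x j i := by
  conv_lhs => rw [← h.symm x hx]
  rfl

theorem mul_inv (hx : x ∈ U) : g x * (g x)⁻¹ = 1 := Matrix.mul_nonsing_inv _ (h.unit x hx)

theorem inv_mul (hx : x ∈ U) : (g x)⁻¹ * g x = 1 := Matrix.nonsing_inv_mul _ (h.unit x hx)

theorem cancel (hx : x ∈ U) {A B : Matrix (Fin n) (Fin n) ℝ} (hAB : g x * A = g x * B) :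
    A = B := by
  rw [← one_mul A, ← one_mul B, ← h.inv_mul hx, mul_assoc, hAB, mul_assoc]

theorem smooth_inv : MSm U (fun y => (g y)⁻¹) := h.smooth.inv h.unit

theorem smooth_gam (i : Fin n) : MSm U (gam g i) := by
  intro m k
  simp only [gam, christoffel, Matrix.of_apply]
  refine contDiffOn_const.mul (Sm.sum fun l _ => (h.smooth_inv m l).mul ?_)
  exact (((h.smooth k l).pd h.isOpen i).add ((h.smooth i l).pd h.isOpen k)).sub
    ((h.smooth i k).pd h.isOpen l)

theorem smooth_curv (i j : Fin n) : MSm U (curv g i j) :=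
  (((h.smooth_gam j).mpd h.isOpen i).sub ((h.smooth_gam i).mpd h.isOpen j)).add
    (((h.smooth_gam i).mul (h.smooth_gam j)).sub ((h.smooth_gam j).mul (h.smooth_gam i)))

theorem pd_symm (hx : x ∈ U) (i j k : Fin n) :
    pd i (fun y => g y j k) x = pd i (fun y => g y k j) x :=
  pd_congr_of_eqOn h.isOpen (fun _ hy => h.symm_apply hy j k) hx i

theorem gam_symm (hx : x ∈ U) (m i k : Fin n) : gam g i x m k = gam g k x m i := by
  simp only [gam, christoffel, Matrix.of_apply]
  congr 1
  refine Finset.sum_congr rfl fun l _ => ?_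
  rw [h.pd_symm hx l i k]
  ring

theorem mul_gam_apply (hx : x ∈ U) (i a k : Fin n) : (g x * gam g i x) a k =
    (1 / 2) * (pd i (fun y => g y k a) x + pd k (fun y => g y i a) x
      - pd a (fun y => g y i k) x) := by
  set v : Fin n → ℝ := fun l => pd i (fun y => g y k l) x + pd k (fun y => g y i l) x
      - pd l (fun y => g y i k) x with hv
  have h1 : (fun m => gam g i x m k) = (1 / 2 : ℝ) • ((g x)⁻¹.mulVec v) := by
    ext m
    simp [gam, christoffel, Matrix.mulVec, dotProduct, hv]
  have h2 : (g x).mulVec (fun m => gam g i x m k) = (1 / 2 : ℝ) • v := by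
    rw [h1, Matrix.mulVec_smul, Matrix.mulVec_mulVec, h.mul_inv hx, Matrix.one_mulVec]
  have h3 := congrFun h2 a
  simpa [Matrix.mulVec, dotProduct, Matrix.mul_apply, hv] using h3

/-- The metric is parallel. -/
theorem mpd_metric (hx : x ∈ U) (i : Fin n) :
    mpd i g x = (gam g i x).transpose * g x + g x * gam g i x := by
  have e : (gam g i x).transpose * g x = (g x * gam g i x).transpose := by
    rw [Matrix.transpose_mul, h.symm x hx]
  rw [e]
  ext a k
  rw [Matrix.add_apply, Matrix.transpose_apply, h.mul_gam_apply hx, h.mul_gam_apply hx, mpd_apply,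
    h.pd_symm hx i k a, h.pd_symm hx a i k, h.pd_symm hx k i a]
  ring

theorem mpd_metric_inv (hx : x ∈ U) (i : Fin n) :
    mpd i (fun y => (g y)⁻¹) x
      = - (gam g i x * (g x)⁻¹) - (g x)⁻¹ * (gam g i x).transpose := by
  rw [mpd_inv h.isOpen hx i h.smooth h.unit, h.mpd_metric hx]
  rw [mul_add, add_mul, ← mul_assoc _ (g x), h.inv_mul hx, one_mul]
  rw [mul_assoc, mul_assoc, h.mul_inv hx, mul_one]
  abel

/-- A symmetric connection for which the metric is parallel has the Christoffel symbols as its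
coefficients. -/
theorem gam_unique (hx : x ∈ U) (Γ : Fin n → Matrix (Fin n) (Fin n) ℝ)
    (hs : ∀ m i k, Γ i m k = Γ k m i)
    (hm : ∀ i, mpd i g x = (Γ i).transpose * g x + g x * Γ i) (i : Fin n) : gam g i x = Γ i := by
  apply h.cancel hx
  have key : ∀ i a k, pd i (fun y => g y a k) x = (g x * Γ i) k a + (g x * Γ i) a k := by
    intro i a k
    have e : (Γ i).transpose * g x = (g x * Γ i).transpose := by
      rw [Matrix.transpose_mul, h.symm x hx]
    have := hm i
    rw [e] at this
    exact congrFun (congrFun this a) k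
  have sw : ∀ i a k, (g x * Γ i) a k = (g x * Γ k) a i := by
    intro i a k
    simp only [Matrix.mul_apply, hs _ i k]
  ext a k
  -- This is the Koszul formula: the three derivatives of the metric are expressed through g Γ, and
  -- symmetry in the lower indices leaves a single term.
  rw [h.mul_gam_apply hx, key, key, key, sw a i k, sw a k i, sw k i a]
  rw [sw k a i]
  ring

/-- The curvature matrices are skew with respect to the metric. -/
theorem curv_skew (hx : x ∈ U) (i j : Fin n) :
    (curv g i j x).transpose * g x = - (g x * curv g i j x) := by
  have hs := h.smooth_gam
  -- Second derivatives of g, computed from the parallelism of g; their symmetry in i and j is the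
  -- skewness of the curvature.
  have key : ∀ i j, mpd j (mpd i g) x =
      (mpd j (gam g i) x).transpose * g x + g x * mpd j (gam g i) x
      + ((gam g i x).transpose * ((gam g j x).transpose * g x + g x * gam g j x)
      + ((gam g j x).transpose * g x + g x * gam g j x) * gam g i x) := by
    intro i j
    rw [mpd_congr h.isOpen (fun y hy => h.mpd_metric hy i) hx,
      mpd_add h.isOpen hx _ ((hs i).transpose.mul h.smooth) (h.smooth.mul (hs i)),
      mpd_mul h.isOpen hx _ (hs i).transpose h.smooth, mpd_mul h.isOpen hx _ h.smooth (hs i),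
      mpd_transpose, h.mpd_metric hx]
    abel
  have h1 := mpd_comm h.isOpen hx i h.smooth j
  rw [key, key] at h1
  have h2 : (curv g i j x).transpose * g x + g x * curv g i j x = 0 := by
    simp only [curv, Matrix.transpose_add, Matrix.transpose_sub, Matrix.transpose_mul]
    rw [← sub_eq_zero] at h1
    rw [← h1]
    noncomm_ring
  exact eq_neg_of_add_eq_zero_left h2

/-- Torsion-freeness: by the symmetry of Γ in its lower indices, the derivative terms and the
quadratic terms of the cyclic sum cancel in pairs. -/
theorem curv_bianchi_one (hx : x ∈ U) (i j k m : Fin n) :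
    curv g i j x m k + curv g j k x m i + curv g k i x m j = 0 := by
  have hp : ∀ i j k, pd i (fun y => gam g j y m k) x = pd i (fun y => gam g k y m j) x :=
    fun i j k => pd_congr_of_eqOn h.isOpen (fun y hy => h.gam_symm hy m j k) hx i
  have hq : ∀ i j k, (gam g i x * gam g j x) m k = (gam g i x * gam g k x) m j := by
    intro i j k
    simp only [Matrix.mul_apply, h.gam_symm hx _ j k]
  simp only [curv, Matrix.add_apply, Matrix.sub_apply, mpd_apply]
  rw [hp i j k, hp j k i, hp k i j, hq i j k, hq j k i, hq k i j]
  ring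

/-- The second Bianchi identity. -/
theorem curv_bianchi_two (hx : x ∈ U) (i j k : Fin n) :
    (mpd i (curv g j k) x + (gam g i x * curv g j k x - curv g j k x * gam g i x))
    + (mpd j (curv g k i) x + (gam g j x * curv g k i x - curv g k i x * gam g j x))
    + (mpd k (curv g i j) x + (gam g k x * curv g i j x - curv g i j x * gam g k x)) = 0 := by
  have hs := h.smooth_gam
  have key : ∀ i j k, mpd i (curv g j k) x =
      mpd i (mpd j (gam g k)) x - mpd i (mpd k (gam g j)) x
      + (mpd i (gam g j) x * gam g k x + gam g j x * mpd i (gam g k) x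
        - (mpd i (gam g k) x * gam g j x + gam g k x * mpd i (gam g j) x)) := by
    intro i j k
    have e : curv g j k = fun y => (mpd j (gam g k) y - mpd k (gam g j) y)
        + (gam g j y * gam g k y - gam g k y * gam g j y) := rfl
    rw [e, mpd_add h.isOpen hx, mpd_sub h.isOpen hx, mpd_sub h.isOpen hx, mpd_mul h.isOpen hx,
      mpd_mul h.isOpen hx]
    any_goals first | exact hs _ | exact (hs _).mul (hs _) | exact (hs _).mpd h.isOpen _
    · exact ((hs _).mpd h.isOpen _).sub ((hs _).mpd h.isOpen _)
    · exact ((hs _).mul (hs _)).sub ((hs _).mul (hs _))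
  -- The second derivatives of Γ cancel because partial derivatives commute; what remains cancels as
  -- in the Jacobi identity for commutators.
  have c : ∀ i j k, mpd i (mpd j (gam g k)) x = mpd j (mpd i (gam g k)) x :=
    fun i j k => mpd_comm h.isOpen hx i (hs k) j
  rw [key, key, key, c i j k, c j k i, c k i j]
  simp only [curv]
  noncomm_ring

/-- An operator field with `∇_i A = β_i A`, where `β` is closed, commutes with the curvature. -/
theorem curv_commute (hx : x ∈ U) {A : E n → Matrix (Fin n) (Fin n) ℝ} (hA : MSm U A)
    {β : Fin n → E n → ℝ} (hβ : ∀ i, Sm U (β i)) (hcl : ∀ i j, pd i (β j) x = pd j (β i) x)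
    (hrec : ∀ y ∈ U, ∀ i, mpd i A y + (gam g i y * A y - A y * gam g i y) = β i y • A y)
    (i j : Fin n) : curv g i j x * A x = A x * curv g i j x := by
  have hs := h.smooth_gam
  have e : ∀ y ∈ U, ∀ i, mpd i A y = β i y • A y + (A y * gam g i y - gam g i y * A y) := by
    intro y hy i
    rw [← hrec y hy i]; abel
  have key : ∀ i j, mpd i (mpd j A) x = pd i (β j) x • A x + β j x • mpd i A x
      + (mpd i A x * gam g j x + A x * mpd i (gam g j) x
        - (mpd i (gam g j) x * A x + gam g j x * mpd i A x)) := by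
    intro i j
    rw [mpd_congr h.isOpen (fun y hy => e y hy j) hx, mpd_add h.isOpen hx, mpd_sub h.isOpen hx,
      mpd_mul h.isOpen hx, mpd_mul h.isOpen hx, mpd_smul h.isOpen hx]
    any_goals first | exact hs _ | exact hA | exact hβ _ | exact (hs _).mul hA
                    | exact hA.mul (hs _)
    · exact MSm.smul (hβ _) hA
    · exact (hA.mul (hs _)).sub ((hs _).mul hA)
  -- In the difference of the two mixed derivatives of A, the terms with derivatives of β cancel by
  -- closedness and those quadratic in β by commutativity; the commutator of A with the curvature is
  -- left.
  have h1 := mpd_comm h.isOpen hx i hA j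
  rw [key, key, hcl i j, e x hx i, e x hx j, ← sub_eq_zero] at h1
  rw [← sub_eq_zero, ← neg_eq_zero, ← h1]
  simp only [curv, smul_add, smul_sub, add_mul, mul_add, sub_mul, mul_sub, smul_mul_assoc,
    mul_smul_comm, smul_smul, mul_comm (β i x) (β j x)]
  noncomm_ring

end LocalMetric

end LocalGeometry

end ConfRec
end

noncomputable section
namespace ConfRec

/-! ### Algebraic curvature tensors at a point and their traces. -/

section Algebra

variable {n : ℕ}

local notation "Mat" => Matrix (Fin n) (Fin n) ℝ

/-- A nondegenerate symmetric bilinear form, given by its matrix. -/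
structure NDSymm (g : Matrix (Fin n) (Fin n) ℝ) : Prop where
  symm : g.transpose = g
  unit : IsUnit g.det

/-- A family of matrices `R_{ij}` with the symmetries of a curvature tensor. -/
structure CurvLike (g : Matrix (Fin n) (Fin n) ℝ)
    (R : Fin n → Fin n → Matrix (Fin n) (Fin n) ℝ) : Prop where
  anti : ∀ i j, R j i = - R i j
  skew : ∀ i j, (R i j).transpose * g = - (g * R i j)
  cyc : ∀ i j k m, R i j m k + R j k m i + R k i m j = 0

/-- The matrix with the entries `A^m_j B_{kl}` in row `m` and column `l`. -/
def tens (A B : Matrix (Fin n) (Fin n) ℝ) (j k : Fin n) : Matrix (Fin n) (Fin n) ℝ :=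
  Matrix.of fun m l => A m j * B k l

/-- The matrices `e_j ∧ T e_k + T e_j ∧ e_k`, where `X ∧ Y` is `v ↦ X ⟨Y, v⟩ - Y ⟨X, v⟩`. -/
def kn (g T : Matrix (Fin n) (Fin n) ℝ) (j k : Fin n) : Matrix (Fin n) (Fin n) ℝ :=
  tens 1 (g * T) j k - tens 1 (g * T) k j + (tens T g j k - tens T g k j)

/-- The Ricci contraction. -/
def ric (R : Fin n → Fin n → Matrix (Fin n) (Fin n) ℝ) : Matrix (Fin n) (Fin n) ℝ :=
  Matrix.of fun k l => ∑ m, R m k m l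

/-- Both form indices raised. -/
def rz (g : Matrix (Fin n) (Fin n) ℝ) (R : Fin n → Fin n → Matrix (Fin n) (Fin n) ℝ)
    (j k : Fin n) : Matrix (Fin n) (Fin n) ℝ :=
  ∑ p, ∑ q, (g⁻¹ j p * g⁻¹ k q) • R p q

/-- The contraction `X_{jk} Y^{jk}`. -/
def contr (g : Matrix (Fin n) (Fin n) ℝ) (X Y : Fin n → Fin n → Matrix (Fin n) (Fin n) ℝ) :
    Matrix (Fin n) (Fin n) ℝ :=
  ∑ j, ∑ k, X j k * rz g Y j k

variable {g : Matrix (Fin n) (Fin n) ℝ} {R : Fin n → Fin n → Matrix (Fin n) (Fin n) ℝ}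
  {A B T D : Matrix (Fin n) (Fin n) ℝ}

theorem mul_tens (M : Mat) (j k : Fin n) : M * tens A B j k = tens (M * A) B j k := by
  ext m l; simp [tens, Matrix.mul_apply, Finset.sum_mul, mul_assoc]

theorem tens_mul (M : Mat) (j k : Fin n) : tens A B j k * M = tens A (B * M) j k := by
  ext m l; simp [tens, Matrix.mul_apply, Finset.mul_sum, mul_assoc]

theorem sum_tens_left (k l : Fin n) : ∑ j, tens A B j k j l = A.trace * B k l := by
  simp [tens, Matrix.trace, Finset.sum_mul]

theorem sum_tens_right (k l : Fin n) : ∑ j, tens A B k j j l = (A.transpose * B) k l := by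
  simp [tens, Matrix.mul_apply]

theorem trace_tens_mul (M : Mat) (j k : Fin n) : (tens A B j k * M).trace = (B * M * A) k j := by
  rw [tens_mul]
  simp [tens, Matrix.trace, Matrix.mul_apply (M := B * M), mul_comm]

/-- The four terms of `kn` contract to n, -1 and -1 times gT and to tr(T) times g. -/
theorem ric_kn (hT : T.transpose * g = g * T) :
    ric (kn g T) = g * (((n : ℝ) - 2) • T + T.trace • 1) := by
  ext k l
  simp only [ric, kn, Matrix.of_apply, Matrix.add_apply, Matrix.sub_apply, Finset.sum_add_distrib,
    Finset.sum_sub_distrib, sum_tens_left, sum_tens_right, Matrix.transpose_one, one_mul, hT,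
    mul_add, mul_smul_comm, Matrix.smul_apply, mul_one]
  simp
  ring

namespace NDSymm

variable (h : NDSymm g)
include h

theorem mul_inv : g * g⁻¹ = 1 := Matrix.mul_nonsing_inv _ h.unit

theorem inv_mul : g⁻¹ * g = 1 := Matrix.nonsing_inv_mul _ h.unit

theorem cancel (hAB : g * A = g * B) : A = B := by
  rw [← one_mul A, ← one_mul B, ← h.inv_mul, mul_assoc, hAB, mul_assoc]

theorem symm_apply (i j : Fin n) : g i j = g j i := by
  conv_lhs => rw [← h.symm]
  rfl

theorem inv_symm : (g⁻¹).transpose = g⁻¹ := by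
  rw [Matrix.transpose_nonsing_inv, h.symm]

theorem inv_apply (i j : Fin n) : g⁻¹ i j = g⁻¹ j i := by
  conv_lhs => rw [← h.inv_symm]
  rfl

theorem conj_inv (hT : T.transpose * g = g * T) : g * T * g⁻¹ = T.transpose := by
  rw [← hT, mul_assoc, h.mul_inv, mul_one]

theorem mul_inv_selfAdj (hT : T.transpose * g = g * T) : T * g⁻¹ = g⁻¹ * T.transpose := by
  rw [← h.conj_inv hT, ← mul_assoc, ← mul_assoc, h.inv_mul, one_mul]

theorem kn_curvLike (hT : T.transpose * g = g * T) : CurvLike g (kn g T) := by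
  have hs : ∀ i j, (g * T) i j = (g * T) j i := fun i j => by
    conv_lhs => rw [← hT]
    rw [← Matrix.transpose_apply (g * T), Matrix.transpose_mul, h.symm]
  refine ⟨fun i j => by unfold kn; abel, fun i j => ?_, fun i j k m => ?_⟩
  · have e1 : ∀ i j, (tens 1 (g * T) i j).transpose * g = tens (g * T) g j i := by
      intro i j
      ext m l
      simp only [Matrix.mul_apply, Matrix.transpose_apply, tens, Matrix.of_apply, Matrix.one_apply]
      simp [← Matrix.mul_apply, hs j m]
    have e2 : ∀ i j, (tens T g i j).transpose * g = tens g (g * T) j i := by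
      intro i j
      ext m l
      simp only [Matrix.mul_apply, Matrix.transpose_apply, tens, Matrix.of_apply]
      simp only [h.symm_apply m j, mul_comm (T _ i), mul_assoc, ← Finset.mul_sum]
      congr 1
      rw [← Matrix.mul_apply, hs i l, Matrix.mul_apply]
      exact Finset.sum_congr rfl fun p _ => by rw [h.symm_apply l p, mul_comm]
    simp only [kn, Matrix.transpose_add, Matrix.transpose_sub, add_mul, sub_mul, mul_add, mul_sub,
      e1, e2, mul_tens, mul_one]
    abel
  · simp only [kn, Matrix.add_apply, Matrix.sub_apply, tens, Matrix.of_apply]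
    rw [hs j k, hs k i, hs i j, h.symm_apply j k, h.symm_apply k i, h.symm_apply i j]
    ring

end NDSymm

namespace CurvLike

theorem neg_add {R' : Fin n → Fin n → Mat} (h : CurvLike g R) (h' : CurvLike g R') :
    CurvLike g (fun i j => - R i j + R' i j) := by
  refine ⟨fun i j => ?_, fun i j => ?_, fun i j k m => ?_⟩
  · rw [h.anti, h'.anti]; abel
  · rw [Matrix.transpose_add, Matrix.transpose_neg, add_mul, neg_mul, h.skew, h'.skew, mul_add,
      mul_neg]; abel
  · simp only [Matrix.add_apply, Matrix.neg_apply]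
    linear_combination - h.cyc i j k m + h'.cyc i j k m

variable (h : CurvLike g R) (hg : NDSymm g)
include h

theorem low_skew (hg : NDSymm g) (m l j k : Fin n) : (g * R j k) m l = - (g * R j k) l m := by
  have := congrFun (congrFun (h.skew j k) l) m
  rw [Matrix.neg_apply] at this
  rw [← this, ← Matrix.transpose_apply (_ * g), Matrix.transpose_mul, Matrix.transpose_transpose,
    hg.symm]

theorem low_anti (m l j k : Fin n) : (g * R k j) m l = - (g * R j k) m l := by
  rw [h.anti j k, mul_neg, Matrix.neg_apply]

theorem low_cyc (m i j k : Fin n) :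
    (g * R i j) m k + (g * R j k) m i + (g * R k i) m j = 0 := by
  simp only [Matrix.mul_apply, ← Finset.sum_add_distrib, ← mul_add, h.cyc, mul_zero,
    Finset.sum_const_zero]

include hg

/-- Pair symmetry. -/
theorem pair (m l j k : Fin n) : (g * R j k) m l = (g * R m l) j k := by
  have c := h.low_cyc
  have s := h.low_skew hg
  have a := h.low_anti
  -- The classical octahedron argument: four cyclic identities, combined by means of the two skew
  -- symmetries.
  linarith [c m j k l, c l m k j, c j k m l, c k j l m, s m l j k, s m k l j, s m j k l,
    s l k j m, s j k m l, s l m k j, s l j m k, s j m l k, s j l k m, s k l m j, s k m j l,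
    s k j l m, a m l j k, a m k j l, a m j l k, a l k m j, a l j k m, a l m j k, a k l m j,
    a k m l j, a k j m l, a j k l m, a j l m k, a j m k l]

/-- The Ricci contraction is a trace with g⁻¹ of the lowered curvature; pair symmetry exchanges its
two free indices. -/
theorem ric_symm : (ric R).transpose = ric R := by
  have e : ∀ k l, ric R k l = ∑ m, ∑ q, g⁻¹ m q * (g * R m k) q l := by
    intro k l
    simp only [ric, Matrix.of_apply]
    refine Finset.sum_congr rfl fun m _ => ?_
    rw [← Matrix.mul_apply, ← mul_assoc, hg.inv_mul, one_mul]
  ext k l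
  rw [Matrix.transpose_apply, e, e, Finset.sum_comm]
  refine Finset.sum_congr rfl fun m _ => Finset.sum_congr rfl fun q _ => ?_
  rw [h.pair hg m k q l, hg.inv_apply]

/-- If a self-adjoint operator commutes with the curvature, so does it with the Ricci tensor. -/
theorem ric_mul_symm (hA : A.transpose * g = g * A) (hc : ∀ j k, R j k * A = A * R j k) :
    (ric R * A).transpose = ric R * A := by
  have e1 : ∀ k l, (ric R * A) k l = ∑ j, (R j k * A) j l := by
    intro k l
    simp only [Matrix.mul_apply, ric, Matrix.of_apply, Finset.sum_mul]
    exact Finset.sum_comm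
  have e2 : ∀ k l, (ric R * A) k l = ∑ j, ∑ q, (A * g⁻¹) j q * (g * R j k) q l := by
    intro k l
    rw [e1]
    refine Finset.sum_congr rfl fun j _ => ?_
    rw [hc, ← Matrix.mul_apply, mul_assoc, ← mul_assoc g⁻¹, hg.inv_mul, one_mul]
  have e3 : ∀ j q, (A * g⁻¹) j q = (A * g⁻¹) q j := by
    intro j q
    conv_lhs => rw [hg.mul_inv_selfAdj hA]
    rw [← Matrix.transpose_apply (A * g⁻¹), Matrix.transpose_mul, hg.inv_symm]
  ext k l
  rw [Matrix.transpose_apply, e2, e2, Finset.sum_comm]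
  refine Finset.sum_congr rfl fun m _ => Finset.sum_congr rfl fun q _ => ?_
  rw [h.pair hg m k q l, e3]

/-- The other trace of the curvature. -/
theorem sum_mul_inv (k m : Fin n) : ∑ j, (R j k * g⁻¹) m j = - (ric R * g⁻¹) k m := by
  have e : ∀ j, (R j k * g⁻¹).transpose = - (R j k * g⁻¹) := by
    intro j
    have h1 : (R j k).transpose = - (g * R j k * g⁻¹) := by
      rw [← neg_mul, ← h.skew, mul_assoc, hg.mul_inv, mul_one]
    rw [Matrix.transpose_mul, hg.inv_symm, h1, mul_neg, mul_assoc, ← mul_assoc g⁻¹, hg.inv_mul,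
      one_mul]
  have e2 : ∀ j, (R j k * g⁻¹) m j = - (R j k * g⁻¹) j m := by
    intro j
    rw [← Matrix.transpose_apply (R j k * g⁻¹), e, Matrix.neg_apply]
  simp only [e2, Finset.sum_neg_distrib, neg_inj]
  simp only [Matrix.mul_apply, ric, Matrix.of_apply, Finset.sum_mul]
  exact Finset.sum_comm

/-- Take adjoints: A is self-adjoint and each curvature operator is skew, so both sides only change
their sign and order. -/
theorem mul_selfAdj {κ : ℝ} (hA : A.transpose * g = g * A) {j k : Fin n}
    (hc : A * R j k = κ • R j k) : R j k * A = κ • R j k := by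
  apply hg.cancel
  have e : g * R j k = - ((R j k).transpose * g) := by rw [h.skew, neg_neg]
  rw [← mul_assoc, e, neg_mul, mul_assoc, ← hA, ← mul_assoc, ← Matrix.transpose_mul, hc,
    Matrix.transpose_smul, smul_mul_assoc, h.skew, mul_smul_comm, smul_neg, neg_neg]

end CurvLike

/-- Trace of the commutation relation of `A` with `e_j ∧ D e_k + D e_j ∧ e_k`. -/
theorem kn_commute_trace (hg : NDSymm g) (hD : D.transpose * g = g * D)
    (hA : A.transpose * g = g * A) (hc : ∀ j k, kn g D j k * A = A * kn g D j k) :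
    ((n : ℝ) - 1) • (D * A) + A * D + D.trace • A - A.trace • D - (A * D).trace • 1 = 0 := by
  apply hg.cancel
  rw [mul_zero]
  ext k l
  have h1 : ∑ j, (kn g D j k * A) j l = ∑ j, (A * kn g D j k) j l := by simp only [hc]
  have e1 : g * A * D = A.transpose * (g * D) := by rw [← hA, mul_assoc]
  have e2 : g * D * A = (A * D).transpose * g := by
    rw [Matrix.transpose_mul, mul_assoc D.transpose, hA, ← mul_assoc D.transpose, hD]
  simp only [kn, mul_add, mul_sub, add_mul, sub_mul, mul_tens, tens_mul, Matrix.add_apply,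
    Matrix.sub_apply, Finset.sum_add_distrib, Finset.sum_sub_distrib, sum_tens_left,
    sum_tens_right, Matrix.transpose_one, one_mul, mul_one, ← e1, ← e2] at h1
  rw [← mul_assoc, hD] at h1
  simp only [mul_add, mul_sub, mul_smul_comm, Matrix.add_apply, Matrix.sub_apply,
    Matrix.smul_apply, mul_one, ← mul_assoc, smul_eq_mul, Matrix.zero_apply]
  simp only [Matrix.trace_one, Fintype.card_fin] at h1
  linear_combination h1

/-- Take the skew part of the traced relation. Transposing g times it exchanges DA and AD and fixes
every other term, so the difference is (n-2)(DA - AD), which must vanish. -/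
theorem kn_commute (hn : 3 ≤ n) (hg : NDSymm g) (hD : D.transpose * g = g * D)
    (hA : A.transpose * g = g * A) (hc : ∀ j k, kn g D j k * A = A * kn g D j k) :
    D * A = A * D := by
  have h1 := kn_commute_trace hg hD hA hc
  have h2 : g * (((n : ℝ) - 1) • (D * A) + A * D + D.trace • A - A.trace • D
      - (A * D).trace • 1) = 0 := by rw [h1, mul_zero]
  have h3 := congrArg Matrix.transpose h2
  have eA : (g * A).transpose = g * A := by rw [Matrix.transpose_mul, hg.symm, hA]
  have eD : (g * D).transpose = g * D := by rw [Matrix.transpose_mul, hg.symm, hD]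
  have eDA : (g * (D * A)).transpose = g * (A * D) := by
    rw [← mul_assoc, Matrix.transpose_mul, eD, ← mul_assoc, hA, mul_assoc]
  have eAD : (g * (A * D)).transpose = g * (D * A) := by
    rw [← eDA, Matrix.transpose_transpose]
  simp only [mul_add, mul_sub, mul_smul_comm, mul_one] at h2 h3
  simp only [Matrix.transpose_add, Matrix.transpose_sub, Matrix.transpose_smul, eA, eD, eDA, eAD,
    hg.symm, Matrix.transpose_zero] at h3
  apply hg.cancel
  have h4 : ((n : ℝ) - 2) • (g * (D * A) - g * (A * D)) = 0 := by
    rw [← sub_eq_zero.2 (h2.trans h3.symm)]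
    module
  have h5 : ((n : ℝ) - 2) ≠ 0 := by
    have : (3 : ℝ) ≤ n := by exact_mod_cast hn
    linarith
  exact sub_eq_zero.1 ((smul_eq_zero.1 h4).resolve_left h5)

end Algebra
end ConfRec
end

noncomputable section
namespace ConfRec

/-! ### Contracted squares of curvature tensors and the eigenvector α of h. -/

section Contraction

variable {n : ℕ}

local notation "Mat" => Matrix (Fin n) (Fin n) ℝ

variable {g : Matrix (Fin n) (Fin n) ℝ} {R X Y : Fin n → Fin n → Matrix (Fin n) (Fin n) ℝ}
  {A B T D : Matrix (Fin n) (Fin n) ℝ}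

theorem rz_apply (j k p q : Fin n) :
    rz g R j k p q = ∑ j', ∑ k', g⁻¹ j j' * g⁻¹ k k' * R j' k' p q := by
  simp [rz, Matrix.sum_apply]

theorem rz_add (j k : Fin n) :
    rz g (fun a b => X a b + Y a b) j k = rz g X j k + rz g Y j k := by
  simp [rz, smul_add, Finset.sum_add_distrib]

theorem rz_sub (j k : Fin n) :
    rz g (fun a b => X a b - Y a b) j k = rz g X j k - rz g Y j k := by
  simp [rz, smul_sub, Finset.sum_sub_distrib]

theorem rz_neg (j k : Fin n) : rz g (fun a b => - X a b) j k = - rz g X j k := by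
  simp [rz]

theorem rz_flip (j k : Fin n) : rz g (fun a b => X b a) j k = rz g X k j := by
  unfold rz
  rw [Finset.sum_comm]
  exact Finset.sum_congr rfl fun a _ => Finset.sum_congr rfl fun b _ => by rw [mul_comm]

theorem rz_tens (hg : NDSymm g) (j k : Fin n) :
    rz g (tens A B) j k = tens (A * g⁻¹) (g⁻¹ * B) j k := by
  ext p q
  rw [rz_apply]
  simp only [tens, Matrix.of_apply, Matrix.mul_apply, Finset.sum_mul_sum]
  refine Finset.sum_congr rfl fun a _ => Finset.sum_congr rfl fun b _ => ?_
  rw [hg.inv_apply j a]; ring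

theorem contr_neg_add_neg_add {Z V : Fin n → Fin n → Mat} :
    contr g (fun a b => - X a b + Y a b) (fun a b => - Z a b + V a b)
      = contr g X Z - contr g X V - contr g Y Z + contr g Y V := by
  unfold contr
  simp only [rz_add (X := fun a b => - Z a b), rz_neg, add_mul, mul_add, neg_mul, mul_neg,
    Finset.sum_add_distrib, Finset.sum_neg_distrib]
  abel

namespace CurvLike

theorem rz_anti (h : CurvLike g R) (j k : Fin n) : rz g R k j = - rz g R j k := by
  rw [← rz_flip, ← rz_neg]
  congr 1
  funext a b
  exact h.anti a b

theorem rz_skew (h : CurvLike g R) (j k : Fin n) :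
    (rz g R j k).transpose * g = - (g * rz g R j k) := by
  simp only [rz, Matrix.transpose_sum, Matrix.transpose_smul, Matrix.sum_mul, Matrix.mul_sum,
    smul_mul_assoc, mul_smul_comm, h.skew, smul_neg, Finset.sum_neg_distrib]

variable (h : CurvLike g R) (hg : NDSymm g)
include h hg

theorem sum_mul_inv' (k m : Fin n) : ∑ j, (R k j * g⁻¹) m j = (ric R * g⁻¹) k m := by
  rw [← neg_neg ((ric R * g⁻¹) k m), ← h.sum_mul_inv hg, ← Finset.sum_neg_distrib]
  refine Finset.sum_congr rfl fun j _ => ?_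
  rw [h.anti k j, neg_mul, Matrix.neg_apply, neg_neg]

/-- A curvature tensor without Ricci part has no nonzero contraction of a form index with an
operator index. This form and `sum_rz_left` discard most terms of `vecMul_contr_eq`. -/
theorem sum_rz_right (h0 : ric R = 0) (j p : Fin n) : ∑ k, rz g R j k p k = 0 := by
  simp only [rz_apply]
  rw [Finset.sum_comm]
  refine Finset.sum_eq_zero fun a _ => ?_
  rw [Finset.sum_comm]
  have : ∀ b, ∑ k, g⁻¹ j a * g⁻¹ k b * R a b p k = g⁻¹ j a * (R a b * g⁻¹) p b := by
    intro b
    rw [Matrix.mul_apply, Finset.mul_sum]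
    exact Finset.sum_congr rfl fun k _ => by ring
  simp only [this, ← Finset.mul_sum, h.sum_mul_inv' hg, h0]
  simp

theorem sum_rz_left (h0 : ric R = 0) (j l : Fin n) : ∑ k, (g * rz g R j k) k l = 0 := by
  have e : ∀ k, (g * rz g R j k) k l = - ∑ q, rz g R j k q k * g q l := by
    intro k
    rw [← neg_neg (g * rz g R j k), ← h.rz_skew, Matrix.neg_apply, Matrix.mul_apply]
    rfl
  simp only [e, Finset.sum_neg_distrib, neg_eq_zero]
  rw [Finset.sum_comm]
  simp only [← Finset.sum_mul, h.sum_rz_right hg h0, zero_mul, Finset.sum_const_zero]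

/-- Contraction over a pair of form indices, versus contraction over an operator index. -/
theorem contr_apply (j i : Fin n) :
    contr g R R j i = ∑ k, (R i k * rz g R j k).trace := by
  -- Pair symmetry turns the free operator indices of both factors into form indices; both sides
  -- then expand into the same sum over (g R_{j'm})_{kl} (R_{im'} g⁻¹)_{lk}.
  have hA : ∀ k l m, rz g R k l m i = ∑ m', g⁻¹ m m' * (R i m' * g⁻¹) l k := by
    intro k l m
    have e : ∀ k' l', R k' l' m i = ∑ m', g⁻¹ m m' * (g * R i m') l' k' := by
      intro k' l'
      have : R k' l' m i = (g⁻¹ * (g * R k' l')) m i := by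
        rw [← mul_assoc, hg.inv_mul, one_mul]
      rw [this, Matrix.mul_apply]
      refine Finset.sum_congr rfl fun m' _ => ?_
      rw [h.pair hg, h.low_skew hg, h.low_anti, neg_neg]
    have e2 : ∀ m', (R i m' * g⁻¹) l k = ∑ k', ∑ l', g⁻¹ k k' * g⁻¹ l l' * (g * R i m') l' k' := by
      intro m'
      have : R i m' * g⁻¹ = g⁻¹ * (g * R i m') * g⁻¹ := by
        rw [← mul_assoc g⁻¹, hg.inv_mul, one_mul]
      rw [this, Matrix.mul_apply]
      refine Finset.sum_congr rfl fun k' _ => ?_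
      rw [Matrix.mul_apply, Finset.sum_mul]
      exact Finset.sum_congr rfl fun l' _ => by rw [hg.inv_apply k' k]; ring
    simp only [rz_apply, e, e2, Finset.mul_sum]
    rw [Finset.sum_comm_cycle]
    refine Finset.sum_congr rfl fun m' _ => ?_
    exact Finset.sum_congr rfl fun k' _ => Finset.sum_congr rfl fun l' _ => by ring
  have hB : ∀ k l m, R k l j m = ∑ j', g⁻¹ j j' * (g * R j' m) k l := by
    intro k l m
    have : R k l j m = (g⁻¹ * (g * R k l)) j m := by rw [← mul_assoc, hg.inv_mul, one_mul]
    rw [this, Matrix.mul_apply]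
    exact Finset.sum_congr rfl fun m' _ => by rw [h.pair hg]
  have hF : ∀ k, (R i k * rz g R j k).trace
      = ∑ j', ∑ k', g⁻¹ j j' * g⁻¹ k k' * (R j' k' * R i k).trace := by
    intro k
    simp only [rz, Matrix.mul_sum, mul_smul_comm, Matrix.trace_sum, Matrix.trace_smul, smul_eq_mul]
    exact Finset.sum_congr rfl fun j' _ => Finset.sum_congr rfl fun k' _ => by
      rw [Matrix.trace_mul_comm]
  have hT : ∀ j' m m', (R j' m * R i m').trace
      = ∑ k, ∑ l, (g * R j' m) k l * (R i m' * g⁻¹) l k := by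
    intro j' m m'
    have : (R j' m * R i m').trace = ((g * R j' m) * (R i m' * g⁻¹)).trace := by
      rw [← mul_assoc, Matrix.trace_mul_comm _ g⁻¹, ← mul_assoc, ← mul_assoc, hg.inv_mul, one_mul]
    rw [this]
    simp only [Matrix.trace, Matrix.diag, Matrix.mul_apply (M := g * R j' m)]
  have hL : contr g R R j i = ∑ k, ∑ l, ∑ m, ∑ j', ∑ m',
      g⁻¹ j j' * g⁻¹ m m' * ((g * R j' m) k l * (R i m' * g⁻¹) l k) := by
    simp only [contr, Matrix.sum_apply, Matrix.mul_apply (N := rz g R _ _)]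
    refine Finset.sum_congr rfl fun k _ => Finset.sum_congr rfl fun l _ =>
      Finset.sum_congr rfl fun m _ => ?_
    rw [hA, hB, Finset.sum_mul_sum]
    exact Finset.sum_congr rfl fun j' _ => Finset.sum_congr rfl fun m' _ => by ring
  rw [hL]
  simp only [hF, hT, Finset.mul_sum]
  have hr : ∀ k l, (∑ m, ∑ j', ∑ m', g⁻¹ j j' * g⁻¹ m m'
      * ((g * R j' m) k l * (R i m' * g⁻¹) l k)) = ∑ m', ∑ j', ∑ m, g⁻¹ j j' * g⁻¹ m' m
      * ((g * R j' m) k l * (R i m' * g⁻¹) l k) := by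
    intro k l
    rw [Finset.sum_comm_cycle]
    refine Finset.sum_congr rfl fun m' _ => ?_
    rw [Finset.sum_comm]
    exact Finset.sum_congr rfl fun j' _ => Finset.sum_congr rfl fun m _ => by
      rw [hg.inv_apply m m']
  simp only [hr]
  rw [Finset.sum_comm_cycle]
  refine Finset.sum_congr rfl fun m' _ => ?_
  rw [Finset.sum_comm_cycle]
  refine Finset.sum_congr rfl fun j' _ => ?_
  rw [Finset.sum_comm_cycle]

end CurvLike

/-- The Cotton tensor in terms of the divergence of the Weyl tensor. -/
theorem cotton_eq (hn : 5 ≤ n) (hg : NDSymm g) {C : Fin n → Fin n → Mat} (hC : CurvLike g C)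
    (h0 : ric C = 0) {T : Fin n → Mat} (hT : ∀ i, (T i).transpose * g = g * T i) {α : Fin n → ℝ}
    (hB : ∀ i j k, (- (α i • C j k) + kn g (T i) j k) + (- (α j • C k i) + kn g (T j) k i)
      + (- (α k • C i j) + kn g (T k) i j) = 0) (j k l : Fin n) :
    (g * T j) k l - (g * T k) j l = - (1 / ((n : ℝ) - 3)) * ∑ p, α p * C j k p l := by
  have hn' : (5 : ℝ) ≤ n := by exact_mod_cast hn
  have hr : ∀ k l, ∑ i, C i k i l = 0 := fun k l => congrFun (congrFun h0 k) l
  have hr' : ∀ k l, ∑ i, C k i i l = 0 := by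
    intro k l
    simp only [fun i => hC.anti i k, Matrix.neg_apply, Finset.sum_neg_distrib, hr, neg_zero]
  have hk : ∀ (i k l : Fin n), ∑ m, kn g (T i) m k m l
      = ((n : ℝ) - 2) * (g * T i) k l + (T i).trace * g k l := by
    intro i k l
    have := congrFun (congrFun (ric_kn (hT i)) k) l
    simpa [ric, mul_add] using this
  have hk' : ∀ (i k l : Fin n), ∑ m, kn g (T i) k m m l
      = - (((n : ℝ) - 2) * (g * T i) k l + (T i).trace * g k l) := by
    intro i k l
    rw [← hk]
    simp only [fun m => (hg.kn_curvLike (hT i)).anti m k, Matrix.neg_apply,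
      Finset.sum_neg_distrib]
  -- With T = ∇S, this is the divergence of the Schouten operator. The next identity contracts the
  -- derivative index of the Bianchi identity with the upper operator index.
  set d : Fin n → ℝ := fun j => ∑ i, T i i j with hd
  have key : ∀ j k l, - (∑ p, α p * C j k p l)
      - ((n : ℝ) - 3) * ((g * T j) k l - (g * T k) j l)
      + (d j - (T j).trace) * g k l - (d k - (T k).trace) * g j l = 0 := by
    intro j k l
    have h1 : ∑ i, ((- (α i • C j k) + kn g (T i) j k) + (- (α j • C k i) + kn g (T j) k i)
      + (- (α k • C i j) + kn g (T k) i j)) i l = 0 :=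
      Finset.sum_eq_zero fun i _ => by rw [hB]; rfl
    have h2 : ∑ i, kn g (T i) j k i l
        = (g * T j) k l - (g * T k) j l + (d j * g k l - d k * g j l) := by
      simp only [kn, tens, Matrix.add_apply, Matrix.sub_apply, Matrix.of_apply,
        Finset.sum_add_distrib, Finset.sum_sub_distrib, ← Finset.sum_mul, hd]
      simp [Matrix.one_apply]
    simp only [Matrix.add_apply, Matrix.neg_apply, Matrix.smul_apply, smul_eq_mul,
      Finset.sum_add_distrib, Finset.sum_neg_distrib, ← Finset.mul_sum, hr, hr', hk, hk', h2] at h1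
    linear_combination h1
  -- A second contraction, with g⁻¹, kills the Weyl term and leaves (2n-4)(d - tr T) = 0: the
  -- divergence of S is the differential of its trace.
  have htr : ∀ j, d j - (T j).trace = 0 := by
    intro j
    have h1 : ∑ k, ∑ l, (- (∑ p, α p * C j k p l)
      - ((n : ℝ) - 3) * ((g * T j) k l - (g * T k) j l)
      + (d j - (T j).trace) * g k l - (d k - (T k).trace) * g j l) * g⁻¹ l k = 0 := by
      simp [key]
    have a1 : ∑ k, ∑ l, (∑ p, α p * C j k p l) * g⁻¹ l k = 0 := by
      have : ∀ k, ∑ l, (∑ p, α p * C j k p l) * g⁻¹ l k = ∑ p, α p * (C j k * g⁻¹) p k := by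
        intro k
        simp only [Finset.sum_mul, Matrix.mul_apply, Finset.mul_sum, mul_assoc]
        exact Finset.sum_comm
      simp only [this]
      rw [Finset.sum_comm]
      simp only [← Finset.mul_sum, hC.sum_mul_inv' hg, h0]
      simp
    have a2 : ∑ k, ∑ l, (g * T j) k l * g⁻¹ l k = (T j).trace := by
      simp only [← Matrix.mul_apply, hg.conj_inv (hT j)]
      rfl
    have a3 : ∑ k, ∑ l, (g * T k) j l * g⁻¹ l k = d j := by
      simp only [← Matrix.mul_apply, hg.conj_inv (hT _)]
      rfl
    have a4 : ∑ k, ∑ l, g k l * g⁻¹ l k = n := by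
      simp [← Matrix.mul_apply, hg.mul_inv]
    have a5 : ∑ k, ∑ l, (d k - (T k).trace) * g j l * g⁻¹ l k = d j - (T j).trace := by
      simp only [mul_assoc, ← Finset.mul_sum, ← Matrix.mul_apply, hg.mul_inv]
      simp [Matrix.one_apply]
    have h2 : (- ∑ k, ∑ l, (∑ p, α p * C j k p l) * g⁻¹ l k)
        - ((n : ℝ) - 3) * ((∑ k, ∑ l, (g * T j) k l * g⁻¹ l k)
          - ∑ k, ∑ l, (g * T k) j l * g⁻¹ l k)
        + (d j - (T j).trace) * (∑ k, ∑ l, g k l * g⁻¹ l k)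
        - ∑ k, ∑ l, (d k - (T k).trace) * g j l * g⁻¹ l k = 0 := by
      rw [← h1]
      obtain ⟨q, hq⟩ : ∃ q : Fin n → Fin n → ℝ, ∀ k l, ∑ p, α p * C j k p l = q k l :=
        ⟨_, fun _ _ => rfl⟩
      simp only [hq, Finset.mul_sum, ← Finset.sum_neg_distrib, ← Finset.sum_sub_distrib,
        ← Finset.sum_add_distrib]
      exact Finset.sum_congr rfl fun k _ => Finset.sum_congr rfl fun l _ => by ring
    rw [a1, a2, a3, a4, a5] at h2
    have h3 : (2 * (n : ℝ) - 4) * (d j - (T j).trace) = 0 := by linear_combination h2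
    exact (mul_eq_zero.1 h3).resolve_left (by linarith)
  have h1 := key j k l
  rw [htr, htr] at h1
  have : (n : ℝ) - 3 ≠ 0 := by linarith
  field_simp
  linear_combination -h1

/-- The recurrence covector is an eigenvector of the contracted square of the Weyl tensor. -/
theorem vecMul_contr_eq (hn : 5 ≤ n) (hg : NDSymm g) {C : Fin n → Fin n → Mat}
    (hC : CurvLike g C) (h0 : ric C = 0) {T : Fin n → Mat}
    (hT : ∀ i, (T i).transpose * g = g * T i) {α : Fin n → ℝ}
    (hB : ∀ i j k, (- (α i • C j k) + kn g (T i) j k) + (- (α j • C k i) + kn g (T j) k i)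
      + (- (α k • C i j) + kn g (T k) i j) = 0) :
    Matrix.vecMul α (contr g C C)
      = (((n : ℝ) - 3) / (2 * ((n : ℝ) - 2)) * (contr g C C).trace) • α := by
  have hn' : (5 : ℝ) ≤ n := by exact_mod_cast hn
  ext i
  -- The Bianchi identity is multiplied by C^{jk} and traced over the operator indices; only the
  -- index i stays free.
  have hs : ∑ j, ∑ k, (((- (α i • C j k) + kn g (T i) j k) + (- (α j • C k i) + kn g (T j) k i)
      + (- (α k • C i j) + kn g (T k) i j)) * rz g C j k).trace = 0 := by simp [hB]
  have hv : Matrix.vecMul α (contr g C C) i = ∑ j, α j * contr g C C j i := rfl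
  have s1 : ∑ j, ∑ k, (C j k * rz g C j k).trace = (contr g C C).trace := by
    simp only [contr, Matrix.trace_sum]
  have s2 : ∑ j, ∑ k, α j * (C k i * rz g C j k).trace = - Matrix.vecMul α (contr g C C) i := by
    rw [hv, ← Finset.sum_neg_distrib]
    refine Finset.sum_congr rfl fun j _ => ?_
    rw [hC.contr_apply hg, ← Finset.mul_sum, ← mul_neg, ← Finset.sum_neg_distrib]
    congr 1
    exact Finset.sum_congr rfl fun k _ => by rw [hC.anti i k, neg_mul, Matrix.trace_neg]
  have s3 : ∑ j, ∑ k, α k * (C i j * rz g C j k).trace = - Matrix.vecMul α (contr g C C) i := by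
    rw [Finset.sum_comm, hv, ← Finset.sum_neg_distrib]
    refine Finset.sum_congr rfl fun j _ => ?_
    rw [hC.contr_apply hg, ← Finset.mul_sum, ← mul_neg, ← Finset.sum_neg_distrib]
    congr 1
    exact Finset.sum_congr rfl fun k _ => by rw [hC.rz_anti j k, mul_neg, Matrix.trace_neg]
  have z1 : ∀ (M : Mat) (l j : Fin n), ∑ k, (M * rz g C j k) l k = 0 := by
    intro M l j
    simp only [Matrix.mul_apply]
    rw [Finset.sum_comm]
    simp only [← Finset.mul_sum, hC.sum_rz_right hg h0, mul_zero, Finset.sum_const_zero]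
  have z2 : ∀ (M : Mat) (l j : Fin n), ∑ k, (g * rz g C j k * M) k l = 0 := by
    intro M l j
    simp only [Matrix.mul_apply (N := M)]
    rw [Finset.sum_comm]
    simp only [← Finset.sum_mul, hC.sum_rz_left hg h0, zero_mul, Finset.sum_const_zero]
  have tr : ∀ (T M : Mat) (j k : Fin n), (kn g T j k * M).trace
      = (g * T * M) k j - (g * T * M) j k + ((g * M * T) k j - (g * M * T) j k) := by
    intro T M j k
    simp only [kn, add_mul, sub_mul, Matrix.trace_add, Matrix.trace_sub, trace_tens_mul, mul_one]
  have sk : ∀ (T M : Mat) (j k : Fin n), T.transpose * g = g * T → M.transpose * g = - (g * M) →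
      (g * M * T) j k = - (g * T * M) k j := by
    intro T M j k hT hM
    rw [← Matrix.transpose_apply (g * M * T), Matrix.transpose_mul, Matrix.transpose_mul, hg.symm,
      hM, mul_neg, ← mul_assoc, hT, Matrix.neg_apply]
  -- When T carries the free index, every term contains a trace of C.
  have s4 : ∑ j, ∑ k, (kn g (T i) j k * rz g C j k).trace = 0 := by
    simp only [tr, Finset.sum_add_distrib, Finset.sum_sub_distrib, z1, z2, Finset.sum_const_zero]
    have e1 : ∑ j, ∑ k, (g * T i * rz g C j k) k j = 0 := by
      rw [Finset.sum_comm]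
      refine Finset.sum_eq_zero fun k _ => ?_
      simp only [hC.rz_anti k, mul_neg, Matrix.neg_apply, Finset.sum_neg_distrib, z1, neg_zero]
    have e2 : ∑ j, ∑ k, (g * rz g C j k * T i) j k = 0 := by
      rw [Finset.sum_comm]
      refine Finset.sum_eq_zero fun k _ => ?_
      simp only [hC.rz_anti k, mul_neg, neg_mul, Matrix.neg_apply, Finset.sum_neg_distrib, z2,
        neg_zero]
    rw [e1, e2]; simp
  have s5 : ∑ j, ∑ k, (kn g (T j) k i * rz g C j k).trace
      = - (2 * ∑ j, ∑ k, (g * T j * rz g C j k) k i) := by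
    have : ∀ j k, (kn g (T j) k i * rz g C j k).trace = (g * T j * rz g C j k) i k
        - (g * rz g C j k * T j) k i - 2 * (g * T j * rz g C j k) k i := by
      intro j k
      rw [tr, sk (T j) (rz g C j k) i k (hT j) (hC.rz_skew j k)]
      ring
    simp only [this, Finset.sum_sub_distrib, z1, z2, ← Finset.mul_sum, Finset.sum_const_zero]
    ring
  have s6 : ∑ j, ∑ k, (kn g (T k) i j * rz g C j k).trace
      = ∑ j, ∑ k, (kn g (T j) k i * rz g C j k).trace := by
    rw [Finset.sum_comm]
    refine Finset.sum_congr rfl fun j _ => Finset.sum_congr rfl fun k _ => ?_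
    rw [hC.rz_anti j k, (hg.kn_curvLike (hT j)).anti k i, neg_mul_neg]
  -- Skewness of C^{jk} replaces T by its antisymmetrisation, the Cotton tensor, which `cotton_eq`
  -- expresses through αC.
  have s7 : 2 * ∑ j, ∑ k, (g * T j * rz g C j k) k i
      = - (1 / ((n : ℝ) - 3)) * Matrix.vecMul α (contr g C C) i := by
    have e1 : ∑ j, ∑ k, (g * T j * rz g C j k) k i
        = - ∑ j, ∑ k, (g * T k * rz g C j k) j i := by
      rw [Finset.sum_comm, ← Finset.sum_neg_distrib]
      refine Finset.sum_congr rfl fun j _ => ?_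
      rw [← Finset.sum_neg_distrib]
      refine Finset.sum_congr rfl fun k _ => ?_
      rw [hC.rz_anti j k, mul_neg, Matrix.neg_apply]
    have e2 : ∀ j k, (g * T j * rz g C j k) k i - (g * T k * rz g C j k) j i
        = - (1 / ((n : ℝ) - 3)) * ∑ q, α q * (C j k * rz g C j k) q i := by
      intro j k
      simp only [Matrix.mul_apply (N := rz g C j k), ← Finset.sum_sub_distrib, ← sub_mul,
        cotton_eq hn hg hC h0 hT hB, Finset.mul_sum, Finset.sum_mul]
      rw [Finset.sum_comm]
      exact Finset.sum_congr rfl fun j _ => Finset.sum_congr rfl fun k _ => by ring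
    rw [two_mul]
    nth_rw 2 [e1]
    rw [← sub_eq_add_neg]
    simp only [← Finset.sum_sub_distrib, e2, ← Finset.mul_sum]
    congr 1
    rw [hv]
    simp only [contr, Matrix.sum_apply, Finset.mul_sum]
    rw [Finset.sum_comm_cycle]
  -- With v = α · contr, the sum reads 2(1 + 1/(n-3)) v = tr(contr) α. This is the origin of the
  -- eigenvalue (n-3)/(2(n-2)).
  simp only [add_mul, neg_mul, smul_mul_assoc, Matrix.trace_add, Matrix.trace_neg,
    Matrix.trace_smul, smul_eq_mul, Finset.sum_add_distrib, Finset.sum_neg_distrib, s2, s3, s4,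
    s6, s5, s7] at hs
  simp only [← Finset.mul_sum, s1] at hs
  rw [Pi.smul_apply, smul_eq_mul]
  have h3 : (n : ℝ) - 3 ≠ 0 := by linarith
  have h2 : (n : ℝ) - 2 ≠ 0 := by linarith
  field_simp at hs ⊢
  linear_combination hs

end Contraction
end ConfRec
end

noncomputable section
namespace ConfRec

/-! ### Operators commuting with e_j ∧ De_k + De_j ∧ e_k. -/

section Spectral

variable {n : ℕ}

local notation "Mat" => Matrix (Fin n) (Fin n) ℝ

variable {g : Matrix (Fin n) (Fin n) ℝ} {R X Y : Fin n → Fin n → Matrix (Fin n) (Fin n) ℝ}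
  {A B T D : Matrix (Fin n) (Fin n) ℝ} {a : Fin n → ℝ}

theorem selfAdj_dotProduct (hA : A.transpose * g = g * A) (u v : Fin n → ℝ) :
    g.mulVec u ⬝ᵥ A.mulVec v = g.mulVec (A.mulVec u) ⬝ᵥ v := by
  rw [Matrix.dotProduct_mulVec, ← Matrix.mulVec_transpose, Matrix.mulVec_mulVec, hA,
    Matrix.mulVec_mulVec]

theorem vecMulVec_mulVec' (u w v : Fin n → ℝ) :
    (Matrix.vecMulVec u w).mulVec v = (w ⬝ᵥ v) • u := by
  ext i
  simp only [Matrix.mulVec, Matrix.vecMulVec_apply, dotProduct, Pi.smul_apply, smul_eq_mul,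
    Finset.sum_mul]
  exact Finset.sum_congr rfl fun k _ => by ring

/-- If a self-adjoint operator commutes with `Y ∧ a` and `a` is an eigenvector, then `Y` is an
eigenvector with the same eigenvalue. -/
theorem wedge_commute (hg : NDSymm g) (hA : A.transpose * g = g * A) {κ : ℝ} (ha : a ≠ 0)
    (hAa : A.mulVec a = κ • a) {Y : Fin n → ℝ}
    (hc : (Matrix.vecMulVec Y (g.mulVec a) - Matrix.vecMulVec a (g.mulVec Y)) * A
      = A * (Matrix.vecMulVec Y (g.mulVec a) - Matrix.vecMulVec a (g.mulVec Y))) :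
    A.mulVec Y = κ • Y := by
  rw [← sub_eq_zero]
  set Z := A.mulVec Y - κ • Y with hZ
  -- The commutation relation applied to v. Pairing the result with v once more gives 2⟨a,v⟩⟨Z,v⟩ =
  -- 0.
  have key : ∀ v, (g.mulVec a ⬝ᵥ v) • Z + (g.mulVec Z ⬝ᵥ v) • a = 0 := by
    intro v
    have h1 := congrArg (fun M : Mat => M.mulVec v) hc
    simp only [← Matrix.mulVec_mulVec, Matrix.sub_mulVec, vecMulVec_mulVec', Matrix.mulVec_sub,
      Matrix.mulVec_smul, selfAdj_dotProduct hA, hAa, smul_dotProduct] at h1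
    rw [hZ, Matrix.mulVec_sub, sub_dotProduct, Matrix.mulVec_smul, smul_dotProduct]
    rw [← sub_eq_zero] at h1
    rw [← neg_eq_zero, ← h1]
    module
  have hga : g.mulVec a ≠ 0 := by
    intro h0
    apply ha
    rw [← Matrix.one_mulVec a, ← hg.inv_mul, ← Matrix.mulVec_mulVec, h0, Matrix.mulVec_zero]
  -- The vector a may be null, so v is supplied by nondegeneracy and need not be a itself.
  obtain ⟨v, hv⟩ : ∃ v, g.mulVec a ⬝ᵥ v ≠ 0 := by
    by_contra! h
    exact hga (dotProduct_eq_zero _ h)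
  have h1 := key v
  have h2 := congrArg (fun u => g.mulVec u ⬝ᵥ v) h1
  simp only [Matrix.mulVec_add, Matrix.mulVec_smul, add_dotProduct, smul_dotProduct,
    Matrix.mulVec_zero, zero_dotProduct, smul_eq_mul] at h2
  have h3 : g.mulVec Z ⬝ᵥ v = 0 := by
    have : (g.mulVec a ⬝ᵥ v) * (2 * (g.mulVec Z ⬝ᵥ v)) = 0 := by linear_combination h2
    rcases mul_eq_zero.1 this with h | h
    · exact absurd h hv
    · linarith
  rw [h3, zero_smul, add_zero] at h1
  exact (smul_eq_zero.1 h1).resolve_left hv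

/-- Contracting with an eigenvector a of D merges the two wedges into (D + d)e_j ∧ a, the form to
which `wedge_commute` applies. -/
theorem sum_kn (hD : D.transpose * g = g * D) (hg : NDSymm g) {d : ℝ}
    (hDa : D.mulVec a = d • a) (j : Fin n) :
    ∑ k, a k • kn g D j k = Matrix.vecMulVec ((D + d • 1).col j) (g.mulVec a)
      - Matrix.vecMulVec a (g.mulVec ((D + d • 1).col j)) := by
  have hs : ∀ i j, (g * D) i j = (g * D) j i := fun i j => by
    conv_lhs => rw [← hD]
    rw [← Matrix.transpose_apply (g * D), Matrix.transpose_mul, hg.symm]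
  have e1 : ∀ l, ∑ k, a k * (g * D) k l = d * g.mulVec a l := by
    intro l
    have : ∑ k, a k * (g * D) k l = (g * D).mulVec a l := by
      simp [Matrix.mulVec, dotProduct, hs l, mul_comm]
    rw [this, ← Matrix.mulVec_mulVec, hDa, Matrix.mulVec_smul]
    rfl
  have e2 : ∀ l, ∑ k, a k * g k l = g.mulVec a l := by
    intro l
    simp [Matrix.mulVec, dotProduct, hg.symm_apply l, mul_comm]
  have e3 : ∀ m, ∑ k, a k * D m k = d * a m := by
    intro m
    have := congrFun hDa m
    simp only [Matrix.mulVec, dotProduct, Pi.smul_apply, smul_eq_mul] at this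
    rw [← this]
    exact Finset.sum_congr rfl fun k _ => mul_comm _ _
  have e4 : ∀ m, ∑ k, a k * (1 : Mat) m k = a m := by
    intro m; simp [Matrix.one_apply]
  have e5 : ∀ l, g.mulVec ((D + d • 1).col j) l = (g * D) j l + d * g j l := by
    intro l
    have : g.mulVec ((D + d • 1).col j) l = (g * (D + d • 1)) l j := rfl
    rw [this, mul_add, Matrix.add_apply, hs l j, mul_smul_comm, mul_one, Matrix.smul_apply,
      hg.symm_apply l j, smul_eq_mul]
  ext m l
  simp only [Matrix.sum_apply, Matrix.smul_apply, kn, tens, Matrix.add_apply, Matrix.sub_apply,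
    Matrix.of_apply, Matrix.vecMulVec_apply, e5, smul_eq_mul, Matrix.col_apply]
  have : ∀ k, a k * ((1 : Mat) m j * (g * D) k l - (1 : Mat) m k * (g * D) j l
      + (D m j * g k l - D m k * g j l)) = (1 : Mat) m j * (a k * (g * D) k l)
      - (a k * (1 : Mat) m k) * (g * D) j l + (D m j * (a k * g k l) - (a k * D m k) * g j l) := by
    intro k; ring
  simp only [this, Finset.sum_add_distrib, Finset.sum_sub_distrib, ← Finset.mul_sum,
    ← Finset.sum_mul, e1, e2, e3, e4]
  ring

theorem mul_eq_of_col {κ : ℝ} (h : ∀ j, A.mulVec (B.col j) = κ • B.col j) : A * B = κ • B := by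
  ext i j
  exact congrFun (h j) i

/-- In characteristic zero the trace of an idempotent determines its rank. -/
theorem idem_trace_zero (hA : A * A = A) (h0 : A.trace = 0) : A = 0 := by
  have h1 : IsIdempotentElem (Matrix.toLin' A) := by
    unfold IsIdempotentElem
    rw [Module.End.mul_eq_comp, ← Matrix.toLin'_mul, hA]
  have h2 := LinearMap.IsIdempotentElem.eq_zero_of_trace_eq_zero h1
    (by rw [Matrix.trace_toLin'_eq, h0])
  simpa using h2

/-- The spectral consequences of the existence of an operator `D ≠ 0` such that `h` commutes with
all `X ∧ D Y + D X ∧ Y`. -/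
theorem spectral_of_kn_commute (hn : 5 ≤ n) (hg : NDSymm g) {H K : Mat} {l : ℝ}
    (hl : (n : ℝ) * l ≠ 1)
    (hH : H.transpose * g = g * H) (hK : K.transpose * g = g * K) (hD : D.transpose * g = g * D)
    (ha : a ≠ 0) (hHa : H.mulVec a = l • a) (hHt : H.trace = 1) (hKt : K.trace = 0)
    (hH0 : H - (1 / (n : ℝ)) • 1 ≠ 0) (hcH : ∀ j k, kn g D j k * H = H * kn g D j k)
    (hcK : ∀ j k, kn g D j k * K = K * kn g D j k) (hD0 : D ≠ 0) :
    (∃ l' : ℝ, (H - l • 1) * (H - l' • 1) = 0) ∧ ∃ s : ℝ, K = s • (H - (1 / (n : ℝ)) • 1) := by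
  have hn' : (5 : ℝ) ≤ n := by exact_mod_cast hn
  have hn0 : (n : ℝ) ≠ 0 := by linarith
  have cH : D * H = H * D := kn_commute (by omega) hg hD hH hcH
  have cK : D * K = K * D := kn_commute (by omega) hg hD hK hcK
  have E1 := kn_commute_trace hg hD hH hcH
  have E2 := kn_commute_trace hg hD hK hcK
  rw [hHt, ← cH, one_smul] at E1
  rw [hKt, ← cK, zero_smul] at E2
  set t := (D * H).trace with ht
  set τ := D.trace with hτ
  have E1' : (n : ℝ) • (D * H) + τ • H - D - t • 1 = 0 := by rw [← E1]; module
  have E2' : (n : ℝ) • (D * K) + τ • K = (D * K).trace • 1 := by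
    rw [← sub_eq_zero, ← E2]; module
  have hnl : (n : ℝ) * l - 1 ≠ 0 := sub_ne_zero.2 hl
  -- Applying E1' to a gives (nl - 1) Da = (t - lτ) a, so a is an eigenvector of D as well.
  set d := (t - l * τ) / ((n : ℝ) * l - 1) with hd
  have hDa : D.mulVec a = d • a := by
    have h1 := congrArg (fun M : Mat => M.mulVec a) E1'
    simp only [Matrix.sub_mulVec, Matrix.add_mulVec, Matrix.smul_mulVec, ← Matrix.mulVec_mulVec,
      hHa, Matrix.mulVec_smul, Matrix.one_mulVec, Matrix.zero_mulVec] at h1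
    have h2 : ((n : ℝ) * l - 1) • D.mulVec a = (t - l * τ) • a := by
      rw [← sub_eq_zero, ← h1]; module
    rw [hd, div_eq_inv_mul, mul_smul, ← h2, smul_smul, inv_mul_cancel₀ hnl, one_smul]
  -- H commutes with (D + d)e_j ∧ a for every j, so each column of D + d is an eigenvector of H for
  -- the eigenvalue of a.
  have E3 : H * (D + d • 1) = l • (D + d • 1) := by
    apply mul_eq_of_col
    intro j
    apply wedge_commute hg hH ha hHa
    rw [← sum_kn hD hg hDa j]
    simp only [Finset.sum_mul, Finset.mul_sum, smul_mul_assoc, mul_smul_comm, hcH]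
  have E3' : H * D = l • D + (l * d) • 1 - d • H := by
    have : H * D = H * (D + d • 1) - d • H := by
      rw [mul_add, mul_smul_comm, mul_one]; abel
    rw [this, E3]; module
  -- Multiply E1' by H - l and use (H - l)D = -d(H - l) to eliminate D. The quadratic annihilator
  -- appears unless its leading coefficient vanishes.
  have E4 : (H - l • 1) * ((τ - n * d) • H + (d - t) • 1) = 0 := by
    have h1 : (H - l • 1) * ((n : ℝ) • (D * H) + τ • H - D - t • 1) = 0 := by rw [E1', mul_zero]
    have h2 : (H - l • 1) * D = - (d • (H - l • 1)) := by
      rw [sub_mul, E3', smul_mul_assoc, one_mul]; module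
    have h3 : (H - l • 1) * (D * H) = - (d • ((H - l • 1) * H)) := by
      rw [← mul_assoc, h2, neg_mul, smul_mul_assoc]
    rw [mul_sub, mul_sub, mul_add, mul_smul_comm, h3, h2, mul_smul_comm, mul_smul_comm,
      mul_one] at h1
    rw [mul_add, mul_smul_comm, mul_smul_comm, mul_one, ← h1]
    module
  have hHl : H - l • 1 ≠ 0 := by
    intro h0
    have h1 := congrArg Matrix.trace h0
    simp only [Matrix.trace_sub, hHt, Matrix.trace_smul, Matrix.trace_one, Fintype.card_fin,
      smul_eq_mul, Matrix.trace_zero] at h1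
    apply hl; linarith
  constructor
  -- In the degenerate case E1' gives n(D + d)H = D + d, while E3 gives nl(D + d) for the left side.
  -- So D = -d, and taking traces yields d = 0 and D = 0.
  · by_cases h : τ - n * d = 0
    · exfalso
      rw [h, zero_smul, zero_add, mul_smul_comm, mul_one] at E4
      have h1 : d - t = 0 := (smul_eq_zero.1 E4).resolve_right hHl
      have h2 : (n : ℝ) • (D + d • 1) * H = D + d • 1 := by
        rw [← sub_eq_zero, ← E1']
        have e1 : t = d := by linarith
        have e2 : τ = n * d := by linarith
        rw [e1, e2, smul_mul_assoc, add_mul, smul_mul_assoc, one_mul]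
        module
      have h3 : (D + d • 1) * H = l • (D + d • 1) := by
        rw [← E3, add_mul, mul_add, cH, smul_mul_assoc, mul_smul_comm, one_mul, mul_one]
      rw [smul_mul_assoc, h3, smul_smul] at h2
      have h4 : ((n : ℝ) * l - 1) • (D + d • 1) = 0 := by
        rw [sub_smul, h2, one_smul, sub_self]
      have h5 := (smul_eq_zero.1 h4).resolve_left hnl
      have h6 := congrArg Matrix.trace h5
      simp only [Matrix.trace_add, Matrix.trace_smul, Matrix.trace_one, Fintype.card_fin,
        smul_eq_mul, Matrix.trace_zero, ← hτ] at h6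
      have h7 : d = 0 := by
        have : (2 * (n : ℝ)) * d = 0 := by linarith
        exact (mul_eq_zero.1 this).resolve_left (by linarith)
      rw [h7, zero_smul, add_zero] at h5
      exact hD0 h5
    · refine ⟨(t - d) / (τ - n * d), ?_⟩
      have e : (τ - n * d) • (H - ((t - d) / (τ - n * d)) • (1 : Mat))
          = (τ - n * d) • H + (d - t) • 1 := by
        rw [smul_sub, smul_smul, mul_div_cancel₀ _ h]; module
      rw [← e, mul_smul_comm] at E4
      exact (smul_eq_zero.1 E4).resolve_left h
  · set H0 := H - (1 / (n : ℝ)) • (1 : Mat) with hH0d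
    set t1 := t - τ / n with ht1
    have N1 : ((n : ℝ) • D + τ • 1) * H0 = t1 • 1 := by
      rw [← sub_eq_zero, ← E1', hH0d, mul_sub, add_mul, mul_smul_comm, mul_one, smul_mul_assoc,
        smul_mul_assoc, one_mul, smul_add, smul_smul, smul_smul, one_div_mul_cancel hn0, ht1]
      module
    have N1' : H0 * ((n : ℝ) • D + τ • 1) = t1 • 1 := by
      rw [← N1, hH0d]
      simp only [sub_mul, mul_sub, add_mul, mul_add, smul_mul_assoc, mul_smul_comm, one_mul,
        mul_one, cH]
      module
    have N2 : ((n : ℝ) • D + τ • 1) * K = (D * K).trace • 1 := by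
      rw [← E2', add_mul, smul_mul_assoc, smul_mul_assoc, one_mul]
    -- If t1 ≠ 0, then nD + τ is a multiple of the inverse of H0 and N2 determines K. If t1 = 0,
    -- then H0² = cH0, so H0/c is an idempotent of trace zero and H0 vanishes.
    by_cases h1 : t1 = 0
    · exfalso
      set c := l - 1 / n with hc
      have hc0 : c ≠ 0 := by
        intro h; apply hl; rw [hc] at h; field_simp at h; linarith
      have hH0a : H0.mulVec a = c • a := by
        rw [hH0d, Matrix.sub_mulVec, hHa, Matrix.smul_mulVec, Matrix.one_mulVec]; module
      have h2 : τ = - (n * d) := by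
        have h3 := congrArg (fun M : Mat => M.mulVec a) N1
        simp only [h1, zero_smul, Matrix.zero_mulVec, ← Matrix.mulVec_mulVec, hH0a,
          Matrix.mulVec_smul, Matrix.add_mulVec, Matrix.smul_mulVec, hDa,
          Matrix.one_mulVec] at h3
        have h4 : (c * (n * d + τ)) • a = 0 := by rw [← h3]; module
        have h5 := (mul_eq_zero.1 ((smul_eq_zero.1 h4).resolve_right ha)).resolve_left hc0
        linarith
      have h3 : D * H0 = d • H0 := by
        have : (n : ℝ) • (D * H0 - d • H0) = 0 := by
          have h4 := N1
          rw [h1, zero_smul, h2, add_mul, smul_mul_assoc, smul_mul_assoc, one_mul] at h4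
          rw [← h4]; module
        exact sub_eq_zero.1 ((smul_eq_zero.1 this).resolve_left hn0)
      have h4 : c • D = d • (2 • H0 - c • 1) := by
        have e1 : H * D = H0 * D + (1 / (n : ℝ)) • D := by
          rw [hH0d, sub_mul, smul_mul_assoc, one_mul]; abel
        have e2 : H0 * D = D * H0 := by
          rw [hH0d]; simp only [sub_mul, mul_sub, smul_mul_assoc, mul_smul_comm, one_mul,
            mul_one, cH]
        rw [e2, h3] at e1
        have e3 : H = H0 + (1 / (n : ℝ)) • 1 := by rw [hH0d]; abel
        rw [E3'] at e1
        rw [e3] at e1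
        rw [← sub_eq_zero] at e1 ⊢
        rw [← e1, hc]
        module
      have h5 : d ≠ 0 := by
        intro h; rw [h, zero_smul] at h4
        exact hD0 ((smul_eq_zero.1 h4).resolve_left hc0)
      have h6 : H0 * H0 = c • H0 := by
        have h7 := congrArg (fun M => M * H0) h4
        simp only [smul_mul_assoc, h3, sub_mul, one_mul, two_smul, add_mul] at h7
        have h8 : (2 * d) • (H0 * H0 - c • H0) = 0 := by
          rw [← sub_eq_zero] at h7
          rw [← neg_eq_zero, ← h7]; module
        exact sub_eq_zero.1 ((smul_eq_zero.1 h8).resolve_left (by simpa using h5))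
      have h7 : c⁻¹ • H0 = 0 := by
        apply idem_trace_zero
        · rw [smul_mul_assoc, mul_smul_comm, h6, smul_smul c⁻¹ c, inv_mul_cancel₀ hc0, one_smul]
        · rw [Matrix.trace_smul, hH0d, Matrix.trace_sub, hHt, Matrix.trace_smul, Matrix.trace_one,
            Fintype.card_fin, smul_eq_mul, smul_eq_mul, one_div_mul_cancel hn0, sub_self, mul_zero]
      exact hH0 ((smul_eq_zero.1 h7).resolve_left (inv_ne_zero hc0))
    · refine ⟨(D * K).trace / t1, ?_⟩
      have h2 : t1 • K = (D * K).trace • H0 := by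
        have : t1 • K = H0 * (((n : ℝ) • D + τ • 1) * K) := by
          rw [← mul_assoc, N1', smul_mul_assoc, one_mul]
        rw [this, N2, mul_smul_comm, mul_one]
      rw [div_eq_inv_mul, mul_smul, ← h2, smul_smul, inv_mul_cancel₀ h1, one_smul]

/-! ### Curvature tensors with vanishing cyclic sum α_[i R_jk]. -/

section CyclicRecurrence

variable (hg : NDSymm g) (hR : CurvLike g R) {α : Fin n → ℝ} (hα : α ≠ 0)
  (hcyc : ∀ i j k, α i • R j k + α j • R k i + α k • R i j = 0)
  {Ro : Matrix (Fin n) (Fin n) ℝ} (hRo : Ro.transpose * g = g * Ro) (hric : ric R = g * Ro)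

include hR hcyc in
-- Contracting the cyclic identity with w exhibits R, as a two-form in j and k, as a wedge product
-- with factor α.
theorem cyc_contract {w : Fin n → ℝ} (hw : ∑ i, w i * α i = 1) (j k : Fin n) :
    R j k = α j • (∑ i, w i • R i k) - α k • ∑ i, w i • R i j := by
  have h1 : ∑ i, w i • (α i • R j k + α j • R k i + α k • R i j) = 0 := by simp [hcyc]
  simp only [smul_add, Finset.sum_add_distrib, smul_smul] at h1
  rw [← Finset.sum_smul, hw, one_smul] at h1
  rw [← sub_eq_zero, ← h1, Finset.smul_sum, Finset.smul_sum]
  have e1 : ∀ i, (w i * α j) • R k i = - (α j • w i • R i k) := by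
    intro i; rw [hR.anti i k, smul_neg, smul_smul, mul_comm]
  have e2 : ∀ i, (w i * α k) • R i j = α k • w i • R i j := by
    intro i; rw [smul_smul, mul_comm]
  simp only [e1, e2, Finset.sum_neg_distrib]
  abel

include hα in
theorem exists_dual : ∃ w : Fin n → ℝ, ∑ i, w i * α i = 1 := by
  obtain ⟨i, hi⟩ := Function.ne_iff.1 hα
  refine ⟨Pi.single i (α i)⁻¹, ?_⟩
  rw [Finset.sum_eq_single i]
  · simp [inv_mul_cancel₀ hi]
  · intro j _ hj; simp [Pi.single_eq_of_ne hj]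
  · simp

include hg hR hα hcyc in
-- By pair symmetry the operator R_jk is itself a wedge of some Y with the vector a dual to α. Since
-- A commutes with it, `wedge_commute` makes Y an eigenvector for the eigenvalue of a.
theorem mul_curv_of_commute (hA : A.transpose * g = g * A) {κ : ℝ}
    (hc : ∀ j k, R j k * A = A * R j k) (hAa : A.mulVec (g⁻¹.mulVec α) = κ • g⁻¹.mulVec α)
    (j k : Fin n) : A * R j k = κ • R j k := by
  obtain ⟨w, hw⟩ := exists_dual hα
  set a := g⁻¹.mulVec α with ha
  have hga : g.mulVec a = α := by rw [ha, Matrix.mulVec_mulVec, hg.mul_inv, Matrix.one_mulVec]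
  have ha0 : a ≠ 0 := by
    intro h; apply hα; rw [← hga, h, Matrix.mulVec_zero]
  set u : Fin n → ℝ := fun l => ∑ i, w i * (g * R j k) i l with hu
  set Y := g⁻¹.mulVec u with hY
  have hgY : g.mulVec Y = u := by rw [hY, Matrix.mulVec_mulVec, hg.mul_inv, Matrix.one_mulVec]
  have e1 : ∀ l, (g * ∑ i, w i • R i l) j k = u l := by
    intro l
    simp only [Finset.mul_sum, mul_smul_comm, Matrix.sum_apply, Matrix.smul_apply, smul_eq_mul, hu]
    exact Finset.sum_congr rfl fun i _ => by rw [hR.pair hg]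
  have e2 : R j k = - (Matrix.vecMulVec Y (g.mulVec a) - Matrix.vecMulVec a (g.mulVec Y)) := by
    apply hg.cancel
    rw [mul_neg, mul_sub, Matrix.mul_vecMulVec, Matrix.mul_vecMulVec, hga, hgY]
    ext m l
    rw [hR.pair hg, cyc_contract hR hcyc hw m l, mul_sub, Matrix.sub_apply, mul_smul_comm,
      mul_smul_comm, Matrix.smul_apply, Matrix.smul_apply, e1, e1, Matrix.neg_apply,
      Matrix.sub_apply, Matrix.vecMulVec_apply, Matrix.vecMulVec_apply, smul_eq_mul, smul_eq_mul]
    ring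
  have e3 : A.mulVec Y = κ • Y := by
    apply wedge_commute hg hA ha0 hAa
    have := hc j k
    rw [e2, neg_mul, mul_neg, neg_inj] at this
    exact this
  rw [e2, mul_neg, mul_sub, Matrix.mul_vecMulVec, Matrix.mul_vecMulVec, hAa, e3,
    Matrix.smul_vecMulVec, Matrix.smul_vecMulVec, smul_neg, smul_sub]

include hR hcyc in
theorem vecMul_curv (j k l : Fin n) :
    ∑ p, α p * R j k p l = α j * ric R k l - α k * ric R j l := by
  have h1 : ∑ i, (α i • R j k + α j • R k i + α k • R i j) i l = 0 :=
    Finset.sum_eq_zero fun i _ => by rw [hcyc]; rfl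
  have h2 : ∑ i, R k i i l = - ric R k l := by
    simp only [fun i => hR.anti i k, Matrix.neg_apply, Finset.sum_neg_distrib]
    rfl
  have h3 : ∑ i, R i j i l = ric R j l := rfl
  simp only [Matrix.add_apply, Matrix.smul_apply, smul_eq_mul, Finset.sum_add_distrib,
    ← Finset.mul_sum, h2, h3] at h1
  linear_combination h1

include hg hR hcyc hRo hric in
-- Trace the contracted cyclic identity `vecMul_curv`: with v = α·Ro it becomes v = tr(Ro)α - v,
-- hence the factor 1/2.
theorem vecMul_ricci : Matrix.vecMul α Ro = (Ro.trace / 2) • α := by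
  have hRi : ric R * g⁻¹ = Ro.transpose := by rw [hric, hg.conj_inv hRo]
  ext j
  have h1 : ∑ k, ∑ l, (∑ p, α p * R j k p l) * g⁻¹ l k = Matrix.vecMul α Ro j := by
    have : ∀ k, ∑ l, (∑ p, α p * R j k p l) * g⁻¹ l k = ∑ p, α p * (R j k * g⁻¹) p k := by
      intro k
      simp only [Finset.sum_mul, Matrix.mul_apply, Finset.mul_sum, mul_assoc]
      exact Finset.sum_comm
    simp only [this]
    rw [Finset.sum_comm]
    simp only [← Finset.mul_sum, hR.sum_mul_inv' hg, hRi]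
    rfl
  have h2 : ∑ k, ∑ l, (α j * ric R k l - α k * ric R j l) * g⁻¹ l k
      = α j * Ro.trace - Matrix.vecMul α Ro j := by
    simp only [sub_mul, mul_assoc, Finset.sum_sub_distrib, ← Finset.mul_sum, ← Matrix.mul_apply,
      hRi]
    rfl
  simp only [vecMul_curv hR hcyc] at h1
  rw [h2] at h1
  rw [Pi.smul_apply, smul_eq_mul]
  linarith

end CyclicRecurrence

end Spectral
end ConfRec
end

noncomputable section
namespace ConfRec

/-! ### The square of the Weyl tensor when α_[i R_jk] = 0. -/

section SquaredCurvature

variable {n : ℕ}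

local notation "Mat" => Matrix (Fin n) (Fin n) ℝ

variable {g : Matrix (Fin n) (Fin n) ℝ} {R X Y : Fin n → Fin n → Matrix (Fin n) (Fin n) ℝ}
  {A B T D : Matrix (Fin n) (Fin n) ℝ} {a : Fin n → ℝ}

theorem contr_flip (hX : CurvLike g X) : contr g X (fun j k => Y k j) = - contr g X Y := by
  unfold contr
  rw [Finset.sum_comm, ← Finset.sum_neg_distrib]
  refine Finset.sum_congr rfl fun j _ => ?_
  rw [← Finset.sum_neg_distrib]
  refine Finset.sum_congr rfl fun k _ => ?_
  rw [rz_flip, hX.anti j k, neg_mul]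

/-- Skewness of X in its form indices makes the four terms of `kn` agree in pairs, hence the factor
2. -/
theorem contr_kn (hg : NDSymm g) (hX : CurvLike g X) (T : Mat) :
    contr g X (kn g T) = (2 : ℝ) • (- (g⁻¹ * ric X * T)
      + Matrix.of fun m l => ∑ j, (X j l * T * g⁻¹) m j) := by
  have e1 : contr g X (tens 1 (g * T)) = - (g⁻¹ * ric X * T) := by
    unfold contr
    simp only [rz_tens hg, one_mul, ← mul_assoc, hg.inv_mul, mul_tens]
    ext m l
    have e : g⁻¹ * ric X = (ric X * g⁻¹).transpose := by
      rw [Matrix.transpose_mul, hg.inv_symm, hX.ric_symm hg]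
    rw [e]
    simp only [Matrix.sum_apply, tens, Matrix.of_apply, Matrix.neg_apply]
    rw [Finset.sum_comm]
    simp only [← Finset.sum_mul, hX.sum_mul_inv hg, neg_mul, Finset.sum_neg_distrib]
    rfl
  have e2 : contr g X (tens T g) = Matrix.of fun m l => ∑ j, (X j l * T * g⁻¹) m j := by
    unfold contr
    simp only [rz_tens hg, hg.inv_mul, mul_tens]
    ext m l
    simp only [Matrix.sum_apply, tens, Matrix.of_apply, Matrix.one_apply, mul_assoc]
    simp
  have e3 : contr g X (kn g T) = contr g X (tens 1 (g * T))
      - contr g X (fun j k => tens 1 (g * T) k j)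
      + (contr g X (tens T g) - contr g X (fun j k => tens T g k j)) := by
    have : kn g T = fun j k => (tens 1 (g * T) j k - tens 1 (g * T) k j)
        + (tens T g j k - tens T g k j) := rfl
    unfold contr
    simp only [this, rz_add (X := fun j k => tens 1 (g * T) j k - tens 1 (g * T) k j),
      rz_sub (X := fun j k => tens 1 (g * T) j k), rz_sub (X := fun j k => tens T g j k),
      mul_add, mul_sub, Finset.sum_add_distrib, Finset.sum_sub_distrib]
  rw [e3, contr_flip (Y := tens 1 (g * T)) hX, contr_flip (Y := tens T g) hX, e1, e2]
  module

theorem contr_kn_kn (hg : NDSymm g) {S : Mat} (hS : S.transpose * g = g * S) :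
    contr g (kn g S) (kn g S)
      = - ((2 * ((n : ℝ) - 4)) • (S * S)) - (4 * S.trace) • S - (2 * (S * S).trace) • 1 := by
  rw [contr_kn hg (hg.kn_curvLike hS), ric_kn hS, ← mul_assoc, hg.inv_mul, one_mul]
  have e : (Matrix.of fun m l => ∑ j, (kn g S j l * S * g⁻¹) m j)
      = (2 : ℝ) • (S * S) - (S * S).trace • 1 - S.trace • S := by
    have e1 : ∀ (A B : Mat) (m l : Fin n), ∑ j, tens A B j l m j = (A * B.transpose) m l := by
      intro A B m l; simp [tens, Matrix.mul_apply]
    have e2 : ∀ (A B : Mat) (m l : Fin n), ∑ j, tens A B l j m j = B.trace * A m l := by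
      intro A B m l; simp [tens, Matrix.trace, Finset.mul_sum, mul_comm]
    have c1 : g * S * S * g⁻¹ = (S * S).transpose := by
      rw [Matrix.transpose_mul, ← hg.conj_inv hS]
      simp only [mul_assoc]
      rw [← mul_assoc g⁻¹ g, hg.inv_mul, one_mul]
    have c2 : g * S * g⁻¹ = S.transpose := hg.conj_inv hS
    ext m l
    simp only [Matrix.of_apply, kn, add_mul, sub_mul, tens_mul, Matrix.add_apply,
      Matrix.sub_apply, Finset.sum_add_distrib, Finset.sum_sub_distrib, c1, c2, e1, e2,
      Matrix.transpose_transpose, Matrix.trace_transpose, one_mul, Matrix.smul_apply, smul_eq_mul]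
    ring
  rw [e, add_mul, smul_mul_assoc, smul_mul_assoc, one_mul]
  module

/-- `X_{jk} Y^{jk}` and `Y_{jk} X^{jk}` are adjoint to each other. -/
theorem contr_swap (hg : NDSymm g) (hX : CurvLike g X) (hY : CurvLike g Y) :
    g * contr g Y X = (contr g X Y).transpose * g := by
  have e1 : ∀ j k, (X j k * rz g Y j k).transpose * g = g * (rz g Y j k * X j k) := by
    intro j k
    rw [Matrix.transpose_mul, mul_assoc, hX.skew, mul_neg, ← mul_assoc, hY.rz_skew, neg_mul,
      neg_neg, mul_assoc]
  have e2 : ∑ j, ∑ k, rz g Y j k * X j k = contr g Y X := by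
    simp only [contr, rz, Finset.sum_mul, Finset.mul_sum, smul_mul_assoc, mul_smul_comm]
    have h3 : ∀ j, ∑ k, ∑ j', ∑ k', (g⁻¹ j j' * g⁻¹ k k') • (Y j' k' * X j k)
        = ∑ j', ∑ k, ∑ k', (g⁻¹ j j' * g⁻¹ k k') • (Y j' k' * X j k) :=
      fun j => Finset.sum_comm
    have h4 : ∀ j j', ∑ k, ∑ k', (g⁻¹ j j' * g⁻¹ k k') • (Y j' k' * X j k)
        = ∑ k', ∑ k, (g⁻¹ j' j * g⁻¹ k' k) • (Y j' k' * X j k) := by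
      intro j j'
      rw [Finset.sum_comm]
      exact Finset.sum_congr rfl fun a _ => Finset.sum_congr rfl fun b _ => by
        rw [hg.inv_apply j j', hg.inv_apply b a]
    simp only [h3, h4]
    rw [Finset.sum_comm]
    exact Finset.sum_congr rfl fun a _ => Finset.sum_comm
  rw [← e2]
  simp only [contr, Matrix.transpose_sum, Finset.sum_mul, Finset.mul_sum, e1]

/-- The contracted square of a curvature tensor with `α_{[i} R_{jk]lm} = 0`. -/
theorem contr_curv_curv (hg : NDSymm g) (hR : CurvLike g R) {α : Fin n → ℝ} (hα : α ≠ 0)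
    (hcyc : ∀ i j k, α i • R j k + α j • R k i + α k • R i j = 0) {Ro : Mat}
    (hRo : Ro.transpose * g = g * Ro) (hric : ric R = g * Ro) {ρ : ℝ}
    (hρ : ∀ j k, R j k * Ro = ρ • R j k) (hv : Matrix.vecMul α Ro = ρ • α)
    (hRo2 : Ro * Ro = ρ • Ro) : contr g R R = - ((2 * ρ) • Ro) := by
  obtain ⟨w, hw⟩ := exists_dual hα
  set Rw : Fin n → Mat := fun k => ∑ i, w i • R i k with hRw
  set a := g⁻¹.mulVec α with ha
  have hga : g.mulVec a = α := by rw [ha, Matrix.mulVec_mulVec, hg.mul_inv, Matrix.one_mulVec]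
  have hRi : ric R * g⁻¹ = Ro.transpose := by rw [hric, hg.conj_inv hRo]
  -- the contraction reduces to one over a single index
  have s1 : contr g R R = (2 : ℝ) • ∑ k, Rw k * ∑ j, α j • rz g R j k := by
    have : ∀ j k, R j k * rz g R j k = Rw k * (α j • rz g R j k) + Rw j * (α k • rz g R k j) := by
      intro j k
      rw [cyc_contract hR hcyc hw j k, hR.rz_anti j k, sub_mul, smul_mul_assoc, smul_mul_assoc,
        smul_neg, mul_neg, mul_smul_comm, mul_smul_comm]
      abel
    unfold contr
    simp only [this, Finset.sum_add_distrib, two_smul]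
    congr 1
    · rw [Finset.sum_comm]; simp only [Finset.mul_sum]
    · simp only [Finset.mul_sum]
  -- By pair symmetry and `vecMul_curv`, contracting the curvature with α leaves only the Ricci
  -- operator.
  have s2 : ∀ k, ∑ j, α j • rz g R j k
      = Matrix.vecMulVec a (Ro.row k) - Matrix.vecMulVec ((Ro * g⁻¹).col k) α := by
    intro k
    have e1 : ∀ k', ∑ j, a j • R j k'
        = Matrix.vecMulVec a ((g * Ro).row k') - Matrix.vecMulVec (Ro.col k') α := by
      intro k'
      apply hg.cancel
      rw [mul_sub, Matrix.mul_vecMulVec, Matrix.mul_vecMulVec, hga]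
      ext p q
      have h1 : (g * ∑ j, a j • R j k') p q = ∑ m, α m * R p q m k' := by
        have h2 : ∀ j, (g * R j k') p q = ∑ m, g j m * R p q m k' := by
          intro j; rw [hR.pair hg, Matrix.mul_apply]
        simp only [Finset.mul_sum, mul_smul_comm, Matrix.sum_apply, Matrix.smul_apply, smul_eq_mul,
          h2]
        rw [Finset.sum_comm]
        refine Finset.sum_congr rfl fun m _ => ?_
        rw [← hga]
        simp only [Matrix.mulVec, dotProduct, Finset.sum_mul]
        exact Finset.sum_congr rfl fun j _ => by rw [hg.symm_apply m j]; ring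
      rw [h1, vecMul_curv hR hcyc, hric]
      have h3 : (g * Ro) q k' = (g * Ro) k' q := by
        conv_lhs => rw [← hRo]
        rw [← Matrix.transpose_apply (g * Ro), Matrix.transpose_mul, hg.symm]
      have h4 : g.mulVec (Ro.col k') p = (g * Ro) p k' := rfl
      rw [Matrix.sub_apply, Matrix.vecMulVec_apply, Matrix.vecMulVec_apply, h4, h3,
        Matrix.row_apply]
      ring
    have e2 : ∑ j, α j • rz g R j k = ∑ k', g⁻¹ k k' • ∑ j, a j • R j k' := by
      simp only [rz, Finset.smul_sum, smul_smul]
      rw [Finset.sum_comm]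
      have h1 : ∀ j', ∑ j, ∑ k', (α j * (g⁻¹ j j' * g⁻¹ k k')) • R j' k'
          = ∑ k', (g⁻¹ k k' * a j') • R j' k' := by
        intro j'
        rw [Finset.sum_comm]
        refine Finset.sum_congr rfl fun k' _ => ?_
        rw [← Finset.sum_smul]
        congr 1
        rw [ha]
        simp only [Matrix.mulVec, dotProduct, Finset.mul_sum]
        exact Finset.sum_congr rfl fun j _ => by rw [hg.inv_apply j j']; ring
      simp only [h1]
      exact Finset.sum_comm
    rw [e2]
    simp only [e1]
    ext p q
    have h1 : Ro k q = ∑ k', g⁻¹ k k' * (g * Ro) k' q := by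
      rw [← Matrix.mul_apply, ← mul_assoc, hg.inv_mul, one_mul]
    have h2 : (Ro * g⁻¹) p k = ∑ k', g⁻¹ k k' * Ro p k' := by
      rw [Matrix.mul_apply]
      exact Finset.sum_congr rfl fun j _ => by rw [hg.inv_apply j k, mul_comm]
    simp only [Matrix.sum_apply, Matrix.smul_apply, Matrix.sub_apply, Matrix.vecMulVec_apply,
      Matrix.row_apply, Matrix.col_apply, smul_eq_mul, h1, h2, Finset.mul_sum, Finset.sum_mul,
      ← Finset.sum_sub_distrib]
    exact Finset.sum_congr rfl fun j _ => by ring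
  have hRwRo : ∀ k, Rw k * Ro = ρ • Rw k := by
    intro k
    simp only [hRw, Finset.sum_mul, smul_mul_assoc, hρ, Finset.smul_sum]
    exact Finset.sum_congr rfl fun i _ => smul_comm _ _ _
  set r := Ro.mulVec w with hr
  have s3 : ∀ k, (Rw k).mulVec a = α k • r - Ro.col k := by
    intro k
    have e1 : ∀ i, (R i k).mulVec a = α k • Ro.col i - α i • Ro.col k := by
      intro i
      have h1 : g.mulVec ((R i k).mulVec a) = g.mulVec (α k • Ro.col i - α i • Ro.col k) := by
        rw [Matrix.mulVec_mulVec, ← neg_neg (g * R i k), ← hR.skew, Matrix.neg_mulVec,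
          ← Matrix.mulVec_mulVec, hga]
        ext m
        have h2 : (R i k).transpose.mulVec α m = ∑ p, α p * R i k p m := by
          simp [Matrix.mulVec, dotProduct, mul_comm]
        have h3 : ∀ i, g.mulVec (Ro.col i) m = (g * Ro) m i := fun _ => rfl
        have h4 : ∀ i, (g * Ro) i m = (g * Ro) m i := by
          intro i
          conv_lhs => rw [← hRo]
          rw [← Matrix.transpose_apply (g * Ro), Matrix.transpose_mul, hg.symm]
        rw [Pi.neg_apply, h2, vecMul_curv hR hcyc, hric, Matrix.mulVec_sub, Matrix.mulVec_smul,
          Matrix.mulVec_smul, Pi.sub_apply, Pi.smul_apply, Pi.smul_apply, h3, h3, h4, h4]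
        simp only [smul_eq_mul]
        ring
      have h5 := congrArg g⁻¹.mulVec h1
      simpa only [Matrix.mulVec_mulVec, hg.inv_mul, ← mul_assoc, Matrix.one_mulVec, one_mul]
        using h5
    have e2 : (Rw k).mulVec a = ∑ i, w i • (R i k).mulVec a := by
      rw [hRw, Matrix.sum_mulVec]
      exact Finset.sum_congr rfl fun i _ => by rw [Matrix.smul_mulVec]
    rw [e2]
    simp only [e1, smul_sub, Finset.sum_sub_distrib, smul_smul, ← Finset.sum_smul, hw, one_smul]
    congr 1
    ext m
    simp only [Finset.sum_apply, Pi.smul_apply, smul_eq_mul, hr, Matrix.mulVec, dotProduct,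
      Finset.mul_sum, Matrix.col_apply]
    exact Finset.sum_congr rfl fun i _ => by ring
  have s4 : ∀ m, ∑ k, (Rw k * g⁻¹) m k = r m := by
    intro m
    simp only [hRw, Finset.sum_mul, smul_mul_assoc, Matrix.sum_apply, Matrix.smul_apply,
      smul_eq_mul]
    rw [Finset.sum_comm]
    simp only [← Finset.mul_sum, hR.sum_mul_inv' hg, hRi, hr, Matrix.mulVec, dotProduct,
      Matrix.transpose_apply]
    exact Finset.sum_congr rfl fun i _ => mul_comm _ _
  rw [s1]
  simp only [s2, mul_sub, Matrix.mul_vecMulVec, s3]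
  have s5 : ∀ k, (Rw k).mulVec ((Ro * g⁻¹).col k) = ρ • (Rw k * g⁻¹).col k := by
    intro k
    have : (Rw k).mulVec ((Ro * g⁻¹).col k) = (Rw k * (Ro * g⁻¹)).col k := rfl
    rw [this, ← mul_assoc, hRwRo, smul_mul_assoc]
    rfl
  simp only [s5, Finset.sum_sub_distrib]
  have s6 : ∑ k, Matrix.vecMulVec (α k • r - Ro.col k) (Ro.row k)
      = ρ • Matrix.vecMulVec r α - Ro * Ro := by
    ext p q
    have := congrFun hv q
    simp only [Matrix.vecMul, dotProduct, Pi.smul_apply, smul_eq_mul] at this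
    simp only [Matrix.sum_apply, Matrix.vecMulVec_apply, Pi.sub_apply, Pi.smul_apply, smul_eq_mul,
      Matrix.row_apply, Matrix.col_apply, Matrix.sub_apply, Matrix.smul_apply, Matrix.mul_apply,
      sub_mul, Finset.sum_sub_distrib]
    congr 1
    rw [← mul_assoc, mul_comm ρ, mul_assoc, ← this, Finset.mul_sum]
    exact Finset.sum_congr rfl fun i _ => by ring
  have s7 : ∑ k, Matrix.vecMulVec (ρ • (Rw k * g⁻¹).col k) α = ρ • Matrix.vecMulVec r α := by
    ext p q
    simp only [Matrix.sum_apply, Matrix.vecMulVec_apply, Pi.smul_apply, smul_eq_mul,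
      Matrix.col_apply, Matrix.smul_apply, mul_assoc]
    rw [← Finset.mul_sum, ← Finset.sum_mul, s4]
  -- The terms r ⊗ α, which depend on the choice of w, cancel; -2Ro² remains.
  rw [s6, s7, hRo2]
  module

/-- The spectral consequences of `α_{[i} R_{jk]lm} = 0`. -/
theorem spectral_of_cyclic (hg : NDSymm g) (hR : CurvLike g R) {α : Fin n → ℝ} (hα : α ≠ 0)
    (hcyc : ∀ i j k, α i • R j k + α j • R k i + α k • R i j = 0) {Ro H : Mat}
    (hRo : Ro.transpose * g = g * Ro) (hric : ric R = g * Ro) (hcRo : ∀ j k, R j k * Ro = Ro * R j k)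
    (hH : H.transpose * g = g * H) (hcH : ∀ j k, R j k * H = H * R j k) {l : ℝ}
    (hHa : H.mulVec (g⁻¹.mulVec α) = l • g⁻¹.mulVec α) (hH0 : ∀ c : ℝ, H ≠ c • 1)
    {s t c : ℝ} (hc : c ≠ 0)
    (hC : contr g (fun j k => - R j k + kn g (s • Ro + t • 1) j k)
      (fun j k => - R j k + kn g (s • Ro + t • 1) j k) = - (c • H)) :
    (∃ l' : ℝ, (H - l • 1) * (H - l' • 1) = 0) ∧ ∃ x y : ℝ, Ro = x • H + y • 1 := by
  set S := s • Ro + t • (1 : Mat) with hS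
  have hSs : S.transpose * g = g * S := by
    rw [hS, Matrix.transpose_add, Matrix.transpose_smul, Matrix.transpose_smul,
      Matrix.transpose_one, add_mul, mul_add, smul_mul_assoc, hRo, smul_mul_assoc, one_mul,
      mul_smul_comm, mul_smul_comm, mul_one]
  set ρ := Ro.trace / 2 with hρ
  have hv : Matrix.vecMul α Ro = ρ • α := vecMul_ricci hg hR hcyc hRo hric
  have hRoa : Ro.mulVec (g⁻¹.mulVec α) = ρ • g⁻¹.mulVec α := by
    rw [Matrix.mulVec_mulVec, hg.mul_inv_selfAdj hRo, ← Matrix.mulVec_mulVec,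
      Matrix.mulVec_transpose, hv, Matrix.mulVec_smul]
  have hRR : ∀ j k, R j k * Ro = ρ • R j k := fun j k =>
    hR.mul_selfAdj hg hRo (mul_curv_of_commute hg hR hα hcyc hRo hcRo hRoa j k)
  have hRH : ∀ j k, R j k * H = l • R j k := fun j k =>
    hR.mul_selfAdj hg hH (mul_curv_of_commute hg hR hα hcyc hH hcH hHa j k)
  -- The Ricci contraction of RA = κR.
  have hricmul : ∀ (A : Mat) (κ : ℝ), (∀ j k, R j k * A = κ • R j k) → Ro * A = κ • Ro := by
    intro A κ hA
    apply hg.cancel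
    rw [← mul_assoc, ← hric, mul_smul_comm, ← hric]
    ext k q
    have : (ric R * A) k q = ∑ m, (R m k * A) m q := by
      simp only [Matrix.mul_apply, ric, Matrix.of_apply, Finset.sum_mul]
      exact Finset.sum_comm
    rw [this]
    simp only [hA, Matrix.smul_apply, smul_eq_mul, ← Finset.mul_sum]
    rfl
  have hRo2 : Ro * Ro = ρ • Ro := hricmul _ _ hRR
  have hRoH : Ro * H = l • Ro := hricmul _ _ hRH
  have hHRo : H * Ro = l • Ro := by
    apply hg.cancel
    have h1 := congrArg Matrix.transpose (congrArg (fun M => g * M) hRoH)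
    simp only [Matrix.transpose_mul, Matrix.transpose_smul, hg.symm, mul_smul_comm] at h1
    rw [mul_assoc, hRo, ← mul_assoc, hH, mul_assoc] at h1
    rw [h1, mul_smul_comm]
  set σ := s * ρ + t with hσ
  have hRS : ∀ j k, R j k * S = σ • R j k := by
    intro j k
    rw [hS, mul_add, mul_smul_comm, mul_smul_comm, hRR, mul_one, hσ]; module
  have hRoS : Ro * S = σ • Ro := hricmul _ _ hRS
  have k1 : contr g R (kn g S) = - ((4 * σ) • Ro) := by
    rw [contr_kn hg hR, hric, ← mul_assoc, hg.inv_mul, one_mul, hRoS]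
    have : (Matrix.of fun m q => ∑ j, (R j q * S * g⁻¹) m j) = - (σ • Ro) := by
      ext m q
      simp only [Matrix.of_apply, hRS, smul_mul_assoc, Matrix.smul_apply, smul_eq_mul,
        ← Finset.mul_sum, hR.sum_mul_inv hg, hric, hg.conj_inv hRo, Matrix.neg_apply]
      simp
    rw [this]; module
  have k2 : contr g (kn g S) R = - ((4 * σ) • Ro) := by
    apply hg.cancel
    rw [contr_swap hg hR (hg.kn_curvLike hSs), k1, Matrix.transpose_neg, Matrix.transpose_smul,
      neg_mul, smul_mul_assoc, hRo, mul_neg, mul_smul_comm]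
  have k3 := contr_curv_curv hg hR hα hcyc hRo hric hRR hv hRo2
  have k4 := contr_kn_kn hg hSs
  have hSS : S * S = (s * s * ρ + 2 * s * t) • Ro + (t * t) • 1 := by
    rw [hS]
    simp only [add_mul, mul_add, smul_mul_assoc, mul_smul_comm, one_mul, mul_one, hRo2]
    module
  rw [contr_neg_add_neg_add, k1, k2, k3, k4] at hC
  -- Expand the square of -R + kn(S). The mixed terms and R² are multiples of Ro, and kn(S)² is
  -- quadratic in S, which Ro² = ρRo makes affine in Ro.
  obtain ⟨x, y, hxy⟩ : ∃ x y : ℝ, H = x • Ro + y • 1 := by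
    have h1 : c • H = (2 * ρ - 8 * σ + 2 * ((n : ℝ) - 4) * (s * s * ρ + 2 * s * t)
        + 4 * S.trace * s) • Ro + (2 * ((n : ℝ) - 4) * (t * t) + 4 * S.trace * t
        + 2 * (S * S).trace) • 1 := by
      generalize (S * S).trace = q at hC ⊢
      generalize S.trace = q' at hC ⊢
      rw [hSS, hS] at hC
      rw [← neg_inj, ← hC]
      module
    have h2 : H = c⁻¹ • (c • H) := by rw [smul_smul, inv_mul_cancel₀ hc, one_smul]
    exact ⟨_, _, by rw [h2, h1, smul_add, smul_smul, smul_smul]⟩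
  have hx : x ≠ 0 := by
    intro h0
    exact hH0 y (by rw [hxy, h0, zero_smul, zero_add])
  have hRo' : Ro = x⁻¹ • H + (- (x⁻¹ * y)) • 1 := by
    rw [hxy, smul_add, smul_smul, inv_mul_cancel₀ hx]; module
  -- The second root is y: H - y is a multiple of Ro, which H - l annihilates.
  refine ⟨⟨y, ?_⟩, _, _, hRo'⟩
  have h1 : (H - l • 1) * Ro = 0 := by rw [sub_mul, hHRo, smul_mul_assoc, one_mul, sub_self]
  have h2 : H - y • 1 = x • Ro := by rw [hxy]; abel
  rw [h2, mul_smul_comm, h1, smul_zero]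

end SquaredCurvature
end ConfRec
end

noncomputable section
namespace ConfRec

/-! ### Covariant derivatives of operator-valued forms; the Weyl operators. -/

section CovariantDerivative

variable {n : ℕ}

local notation "Mat" => Matrix (Fin n) (Fin n) ℝ

/-- The covariant derivative `∇_i A` of a field of operators. -/
def nab (g : E n → Matrix (Fin n) (Fin n) ℝ) (i : Fin n) (A : E n → Matrix (Fin n) (Fin n) ℝ)
    (x : E n) : Matrix (Fin n) (Fin n) ℝ :=
  mpd i A x + (gam g i x * A x - A x * gam g i x)

/-- The covariant derivative `∇_i Ω_{jk}` of a field of operators with two covariant indices. -/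
def nabForm (g : E n → Matrix (Fin n) (Fin n) ℝ) (i : Fin n)
    (Ω : Fin n → Fin n → E n → Matrix (Fin n) (Fin n) ℝ) (j k : Fin n) (x : E n) :
    Matrix (Fin n) (Fin n) ℝ :=
  nab g i (Ω j k) x - ∑ p, gam g i x p j • Ω p k x - ∑ p, gam g i x p k • Ω j p x

/-- The Schouten operator. -/
def schouten (g : E n → Matrix (Fin n) (Fin n) ℝ) (x : E n) : Matrix (Fin n) (Fin n) ℝ :=
  (1 / ((n : ℝ) - 2)) • ricciOp g x
    + (- (scal g x / (2 * ((n : ℝ) - 1) * ((n : ℝ) - 2)))) • 1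

/-- The Weyl tensor as a family of matrices. -/
def weylMat (g : E n → Matrix (Fin n) (Fin n) ℝ) (j k : Fin n) (x : E n) :
    Matrix (Fin n) (Fin n) ℝ :=
  - curv g j k x + kn (g x) (schouten g x) j k

variable {U : Set (E n)} {g : E n → Matrix (Fin n) (Fin n) ℝ} {x : E n}
  {A B : E n → Matrix (Fin n) (Fin n) ℝ}

theorem kn_add (G S T : Mat) (j k : Fin n) : kn G (S + T) j k = kn G S j k + kn G T j k := by
  ext m l; simp [kn, tens, mul_add]; ring

theorem kn_smul (G T : Mat) (c : ℝ) (j k : Fin n) : kn G (c • T) j k = c • kn G T j k := by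
  ext m l; simp [kn, tens]; ring

theorem ricci_eq_ric : ricci g x = ric (fun i j => curv g i j x) := by
  ext k l; rw [ricci_eq]; rfl

theorem nabForm_flip {Ω : Fin n → Fin n → E n → Mat} (i j k : Fin n) :
    nabForm g i (fun j k => Ω k j) j k x = nabForm g i Ω k j x := by
  simp only [nabForm]; abel

theorem smooth_tens (hA : MSm U A) (hB : MSm U B) (j k : Fin n) :
    MSm U (fun y => tens (A y) (B y) j k) := fun m l => (hA m j).mul (hB k l)

namespace LocalMetric

variable (h : LocalMetric U g)
include h

theorem ndsymm (hx : x ∈ U) : NDSymm (g x) := ⟨h.symm x hx, h.unit x hx⟩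

theorem curvLike (hx : x ∈ U) : CurvLike (g x) (fun i j => curv g i j x) :=
  ⟨fun _ _ => curv_antisymm _ _, h.curv_skew hx, h.curv_bianchi_one hx⟩

theorem mul_ricciOp (hx : x ∈ U) : g x * ricciOp g x = ricci g x := by
  rw [ricciOp, ← mul_assoc, h.mul_inv hx, one_mul]

theorem ric_eq (hx : x ∈ U) : ric (fun i j => curv g i j x) = g x * ricciOp g x := by
  rw [h.mul_ricciOp hx, ricci_eq_ric]

theorem ricci_symm (hx : x ∈ U) : (ricci g x).transpose = ricci g x := by
  rw [ricci_eq_ric, (h.curvLike hx).ric_symm (h.ndsymm hx)]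

theorem ricciOp_selfAdj (hx : x ∈ U) : (ricciOp g x).transpose * g x = g x * ricciOp g x := by
  rw [h.mul_ricciOp hx]
  conv_rhs => rw [← h.ricci_symm hx, ← h.mul_ricciOp hx, Matrix.transpose_mul, h.symm x hx]

theorem scal_eq (hx : x ∈ U) : scal g x = (ricciOp g x).trace := by
  simp only [scal, ricciOp, Matrix.trace, Matrix.diag, Matrix.mul_apply]
  refine Finset.sum_congr rfl fun i _ => Finset.sum_congr rfl fun j _ => ?_
  congr 1
  conv_lhs => rw [← h.ricci_symm hx]
  rfl

theorem schouten_selfAdj (hx : x ∈ U) : (schouten g x).transpose * g x = g x * schouten g x := by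
  simp only [schouten, Matrix.transpose_add, Matrix.transpose_smul, Matrix.transpose_one, add_mul,
    mul_add, smul_mul_assoc, mul_smul_comm, one_mul, mul_one, h.ricciOp_selfAdj hx]

theorem weylMixed_eq (hx : x ∈ U) (j k l m : Fin n) :
    weylMixed g j k l m x = weylMat g j k x m l := by
  have e1 : ∀ k l, (g x * schouten g x) k l = (1 / ((n : ℝ) - 2)) * ricci g x k l
      - scal g x / (2 * ((n : ℝ) - 1) * ((n : ℝ) - 2)) * g x k l := by
    intro k l
    rw [schouten, mul_add, mul_smul_comm, mul_smul_comm, h.mul_ricciOp hx, mul_one]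
    simp only [Matrix.add_apply, Matrix.smul_apply, smul_eq_mul]
    ring
  have e2 : ∀ a b : Fin n, (1 : Mat) a b = (1 : Mat) b a := by
    intro a b; simp [Matrix.one_apply, eq_comm]
  have e3 : scal g x / (((n : ℝ) - 1) * ((n : ℝ) - 2))
      = 2 * (scal g x / (2 * ((n : ℝ) - 1) * ((n : ℝ) - 2))) := by
    rw [mul_assoc, mul_div_assoc', mul_div_mul_left _ _ two_ne_zero]
  simp only [weylMixed, weylMat, riemann_eq, kn, tens, Matrix.add_apply, Matrix.sub_apply,
    Matrix.neg_apply, Matrix.of_apply, e1]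
  rw [e3, e2 m j, e2 m k]
  simp only [schouten, Matrix.add_apply, Matrix.smul_apply, smul_eq_mul]
  rw [e2 m j, e2 m k]
  ring

theorem weyl_eq (hx : x ∈ U) (j k l m : Fin n) :
    weyl g j k l m x = (g x * weylMat g j k x) m l := by
  simp only [weyl, h.weylMixed_eq hx, Matrix.mul_apply]
  exact Finset.sum_congr rfl fun p _ => by rw [h.symm_apply hx m p, mul_comm]

theorem weylMat_curvLike (hx : x ∈ U) : CurvLike (g x) (fun i j => weylMat g i j x) :=
  (h.curvLike hx).neg_add ((h.ndsymm hx).kn_curvLike (h.schouten_selfAdj hx))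

theorem schouten_trace (hn : 5 ≤ n) (hx : x ∈ U) :
    (schouten g x).trace = scal g x / (2 * ((n : ℝ) - 1)) := by
  have hn' : (5 : ℝ) ≤ n := by exact_mod_cast hn
  rw [schouten, Matrix.trace_add, Matrix.trace_smul, Matrix.trace_smul, Matrix.trace_one,
    ← h.scal_eq hx, Fintype.card_fin, smul_eq_mul, smul_eq_mul]
  have h1 : (n : ℝ) - 1 ≠ 0 := by linarith
  have h2 : (n : ℝ) - 2 ≠ 0 := by linarith
  field_simp
  ring

/-- The coefficients of the Schouten operator are those for which (n-2)S + tr S is the Ricci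
operator. -/
theorem ric_weylMat (hn : 5 ≤ n) (hx : x ∈ U) : ric (fun i j => weylMat g i j x) = 0 := by
  have hn' : (5 : ℝ) ≤ n := by exact_mod_cast hn
  have h1 : (n : ℝ) - 1 ≠ 0 := by linarith
  have h2 : (n : ℝ) - 2 ≠ 0 := by linarith
  have e : ric (fun i j => weylMat g i j x)
      = - ric (fun i j => curv g i j x) + ric (kn (g x) (schouten g x)) := by
    ext k l
    simp [ric, weylMat, Finset.sum_add_distrib]
  rw [e, h.ric_eq hx, ric_kn (h.schouten_selfAdj hx), h.schouten_trace hn hx, ← mul_neg, ← mul_add]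
  convert mul_zero (g x)
  rw [schouten, smul_add, smul_smul, smul_smul, mul_one_div_cancel h2]
  have : ((n : ℝ) - 2) * -(scal g x / (2 * ((n : ℝ) - 1) * ((n : ℝ) - 2)))
      = - (scal g x / (2 * ((n : ℝ) - 1))) := by field_simp
  rw [this]
  module

/-! Smoothness -/

theorem smooth_ricci : MSm U (ricci g) := by
  intro k l
  simp only [ricci_eq]
  exact Sm.sum fun m _ => h.smooth_curv m k m l

theorem smooth_ricciOp : MSm U (ricciOp g) := h.smooth_inv.mul h.smooth_ricci

theorem smooth_scal : Sm U (scal g) := by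
  unfold scal
  exact Sm.sum fun i _ => Sm.sum fun j _ => (h.smooth_inv i j).mul (h.smooth_ricci i j)

theorem smooth_schouten : MSm U (schouten g) :=
  (MSm.smul contDiffOn_const h.smooth_ricciOp).add
    (MSm.smul (h.smooth_scal.div_const _).neg (MSm.const 1))

theorem smooth_kn {T : E n → Mat} (hT : MSm U T) (j k : Fin n) :
    MSm U (fun y => kn (g y) (T y) j k) := by
  intro m l
  simp only [kn, tens, Matrix.add_apply, Matrix.sub_apply, Matrix.of_apply]
  have h1 := h.smooth.mul hT
  exact ((contDiffOn_const.mul (h1 k l)).sub (contDiffOn_const.mul (h1 j l))).add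
    (((hT m j).mul (h.smooth k l)).sub ((hT m k).mul (h.smooth j l)))

theorem smooth_weylMat (j k : Fin n) : MSm U (weylMat g j k) :=
  (h.smooth_curv j k).neg.add (h.smooth_kn h.smooth_schouten j k)

/-! Rules for the covariant derivative -/

theorem nab_mul (hx : x ∈ U) (hA : MSm U A) (hB : MSm U B) (i : Fin n) :
    nab g i (fun y => A y * B y) x = nab g i A x * B x + A x * nab g i B x := by
  unfold nab
  rw [mpd_mul h.isOpen hx i hA hB]
  noncomm_ring

theorem nab_add (hx : x ∈ U) (hA : MSm U A) (hB : MSm U B) (i : Fin n) :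
    nab g i (fun y => A y + B y) x = nab g i A x + nab g i B x := by
  unfold nab
  rw [mpd_add h.isOpen hx i hA hB]
  noncomm_ring

theorem nab_sub (hx : x ∈ U) (hA : MSm U A) (hB : MSm U B) (i : Fin n) :
    nab g i (fun y => A y - B y) x = nab g i A x - nab g i B x := by
  unfold nab
  rw [mpd_sub h.isOpen hx i hA hB]
  noncomm_ring

theorem nab_smul (hx : x ∈ U) {f : E n → ℝ} (hf : Sm U f) (hA : MSm U A) (i : Fin n) :
    nab g i (fun y => f y • A y) x = pd i f x • A x + f x • nab g i A x := by
  unfold nab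
  rw [mpd_smul h.isOpen hx i hf hA, smul_mul_assoc, mul_smul_comm]
  module

/-- The connection enters the covariant derivative of an operator through a commutator, which has
trace zero. -/
theorem pd_trace_eq (hx : x ∈ U) (hA : MSm U A) (i : Fin n) :
    pd i (fun y => (A y).trace) x = (nab g i A x).trace := by
  rw [pd_trace h.isOpen hx i hA, nab, Matrix.trace_add, Matrix.trace_sub,
    Matrix.trace_mul_comm (A x), sub_self, add_zero]

theorem nab_congr (hx : x ∈ U) (hAB : Set.EqOn A B U) (i : Fin n) :
    nab g i A x = nab g i B x := by
  unfold nab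
  rw [mpd_congr h.isOpen hAB hx, hAB hx]

/-- The metric is parallel, so taking adjoints commutes with covariant differentiation. -/
theorem nab_selfAdj (hx : x ∈ U) (hA : MSm U A)
    (hs : ∀ y ∈ U, (A y).transpose * g y = g y * A y) (i : Fin n) :
    (nab g i A x).transpose * g x = g x * nab g i A x := by
  have h1 : mpd i (fun y => (A y).transpose * g y) x = mpd i (fun y => g y * A y) x :=
    mpd_congr h.isOpen (fun y hy => hs y hy) hx i
  rw [mpd_mul h.isOpen hx i hA.transpose h.smooth, mpd_mul h.isOpen hx i h.smooth hA,
    mpd_transpose, h.mpd_metric hx] at h1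
  have h2 := hs x hx
  set Γ := gam g i x with hΓ
  have e1 : (nab g i A x).transpose * g x = (mpd i A x).transpose * g x
      + (A x).transpose * (Γ.transpose * g x) - Γ.transpose * ((A x).transpose * g x) := by
    simp only [nab, Matrix.transpose_add, Matrix.transpose_sub, Matrix.transpose_mul]
    noncomm_ring
  have e2 : (mpd i A x).transpose * g x = (Γ.transpose * g x + g x * Γ) * A x
      + g x * mpd i A x - (A x).transpose * (Γ.transpose * g x + g x * Γ) := by
    rw [← h1]; abel
  rw [e1, e2, h2, mul_add, ← mul_assoc (A x).transpose (g x), h2]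
  simp only [nab]
  noncomm_ring

end LocalMetric

theorem nab_const_one (i : Fin n) : nab g i (fun _ => 1) x = 0 := by
  unfold nab
  rw [mpd_const, mul_one, one_mul, sub_self, add_zero]

namespace LocalMetric

variable (h : LocalMetric U g)
include h

/-- Covariant derivative of `A e_j ⊗ B_k`. -/
theorem nabForm_tens (hx : x ∈ U) (hA : MSm U A) (hB : MSm U B) (i j k : Fin n) :
    nabForm g i (fun j k y => tens (A y) (B y) j k) j k x
      = tens (nab g i A x) (B x) j k
        + tens (A x) (mpd i B x - (gam g i x).transpose * B x - B x * gam g i x) j k := by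
  have e1 : mpd i (fun y => tens (A y) (B y) j k) x
      = tens (mpd i A x) (B x) j k + tens (A x) (mpd i B x) j k := by
    ext m l
    simp only [mpd_apply, tens, Matrix.of_apply, Matrix.add_apply]
    exact pd_mul i (hA.diffAt h.isOpen hx m j) (hB.diffAt h.isOpen hx k l)
  have e2 : ∑ p, gam g i x p j • tens (A x) (B x) p k = tens (A x * gam g i x) (B x) j k := by
    ext m l
    simp only [Matrix.sum_apply, tens, Matrix.smul_apply, Matrix.of_apply, Matrix.mul_apply,
      Finset.sum_mul, smul_eq_mul]
    exact Finset.sum_congr rfl fun p _ => by ring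
  have e3 : ∑ p, gam g i x p k • tens (A x) (B x) j p
      = tens (A x) ((gam g i x).transpose * B x) j k := by
    ext m l
    simp only [Matrix.sum_apply, tens, Matrix.smul_apply, Matrix.of_apply, Matrix.mul_apply,
      Finset.mul_sum, smul_eq_mul, Matrix.transpose_apply]
    exact Finset.sum_congr rfl fun p _ => by ring
  rw [nabForm, e2, e3]
  simp only [nab]
  rw [e1, mul_tens, tens_mul]
  ext m l
  simp only [tens, Matrix.add_apply, Matrix.sub_apply, Matrix.of_apply]
  ring

theorem nabForm_add (hx : x ∈ U) {Ω Ω' : Fin n → Fin n → E n → Mat} (hΩ : ∀ j k, MSm U (Ω j k))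
    (hΩ' : ∀ j k, MSm U (Ω' j k)) (i j k : Fin n) :
    nabForm g i (fun j k y => Ω j k y + Ω' j k y) j k x
      = nabForm g i Ω j k x + nabForm g i Ω' j k x := by
  simp only [nabForm, h.nab_add hx (hΩ j k) (hΩ' j k), smul_add, Finset.sum_add_distrib]
  abel

theorem nabForm_sub (hx : x ∈ U) {Ω Ω' : Fin n → Fin n → E n → Mat} (hΩ : ∀ j k, MSm U (Ω j k))
    (hΩ' : ∀ j k, MSm U (Ω' j k)) (i j k : Fin n) :
    nabForm g i (fun j k y => Ω j k y - Ω' j k y) j k x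
      = nabForm g i Ω j k x - nabForm g i Ω' j k x := by
  simp only [nabForm, h.nab_sub hx (hΩ j k) (hΩ' j k), smul_sub, Finset.sum_sub_distrib]
  abel

/-- Apart from T, `kn` involves only the identity and the metric, both parallel; the derivative
falls on T alone. -/
theorem nabForm_kn (hx : x ∈ U) {T : E n → Mat} (hT : MSm U T) (i j k : Fin n) :
    nabForm g i (fun j k y => kn (g y) (T y) j k) j k x = kn (g x) (nab g i T x) j k := by
  have s1 := smooth_tens (MSm.const (U := U) 1) (h.smooth.mul hT)
  have s2 := smooth_tens hT h.smooth
  have e1 : ∀ j k, nabForm g i (fun j k y => tens 1 (g y * T y) j k) j k x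
      = tens 1 (g x * nab g i T x) j k := by
    intro j k
    rw [h.nabForm_tens hx (MSm.const 1) (h.smooth.mul hT), nab_const_one,
      mpd_mul h.isOpen hx i h.smooth hT, h.mpd_metric hx]
    have : ((gam g i x).transpose * g x + g x * gam g i x) * T x + g x * mpd i T x
        - (gam g i x).transpose * (g x * T x) - g x * T x * gam g i x
        = g x * nab g i T x := by
      simp only [nab]; noncomm_ring
    rw [this]
    ext m l; simp [tens]
  have e2 : ∀ j k, nabForm g i (fun j k y => tens (T y) (g y) j k) j k x
      = tens (nab g i T x) (g x) j k := by
    intro j k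
    rw [h.nabForm_tens hx hT h.smooth, h.mpd_metric hx]
    ext m l; simp [tens]
  have e3 : (fun j k y => kn (g y) (T y) j k) = fun j k y =>
      ((tens 1 (g y * T y) j k - tens 1 (g y * T y) k j)
        + (tens (T y) (g y) j k - tens (T y) (g y) k j)) := rfl
  rw [e3, h.nabForm_add hx (fun j k => (s1 j k).sub (s1 k j)) (fun j k => (s2 j k).sub (s2 k j)),
    h.nabForm_sub hx s1 (fun j k => s1 k j), h.nabForm_sub hx s2 (fun j k => s2 k j),
    nabForm_flip (Ω := fun j k y => tens 1 (g y * T y) j k),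
    nabForm_flip (Ω := fun j k y => tens (T y) (g y) j k), e1, e1, e2, e2]
  rfl

/-- The connection terms acting on the form indices cancel in the cyclic sum, because Γ is symmetric
and the curvature skew; `curv_bianchi_two` is what is left. -/
theorem bianchi_two (hx : x ∈ U) (i j k : Fin n) :
    nabForm g i (curv g) j k x + nabForm g j (curv g) k i x + nabForm g k (curv g) i j x = 0 := by
  rw [← h.curv_bianchi_two hx i j k]
  have e : ∀ a b c : Fin n, ∑ p, gam g a x p b • curv g p c x
      = - ∑ p, gam g b x p a • curv g c p x := by
    intro a b c
    rw [← Finset.sum_neg_distrib]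
    refine Finset.sum_congr rfl fun p _ => ?_
    rw [h.gam_symm hx p a b, curv_antisymm c p, smul_neg]
  simp only [nabForm, nab]
  rw [e i j k, e j k i, e k i j]
  abel

/-- If `∇A = βA` and `A` commutes with the curvature, it commutes with its covariant derivative. -/
theorem nabForm_curv_commute (hx : x ∈ U) (hA : MSm U A)
    (hc : ∀ y ∈ U, ∀ j k, curv g j k y * A y = A y * curv g j k y) {β : ℝ} (i j k : Fin n)
    (hrec : nab g i A x = β • A x) :
    nabForm g i (curv g) j k x * A x = A x * nabForm g i (curv g) j k x := by
  have h1 : nab g i (fun y => curv g j k y * A y) x = nab g i (fun y => A y * curv g j k y) x :=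
    h.nab_congr hx (fun y hy => hc y hy j k) i
  rw [h.nab_mul hx (h.smooth_curv j k) hA, h.nab_mul hx hA (h.smooth_curv j k), hrec,
    mul_smul_comm, smul_mul_assoc, hc x hx, add_comm, add_left_cancel_iff] at h1
  simp only [nabForm, sub_mul, mul_sub, Finset.sum_mul, Finset.mul_sum, smul_mul_assoc,
    mul_smul_comm, hc x hx, h1]

end LocalMetric

end CovariantDerivative
end ConfRec
end

noncomputable section
namespace ConfRec

/-! ### Recurrent Weyl tensor: α is closed and h is parallel. -/

section Recurrent

variable {n : ℕ}

local notation "Mat" => Matrix (Fin n) (Fin n) ℝ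

/-- A metric on the open set `U` with recurrent, nowhere null Weyl tensor. -/
structure LocalRecurrent (U : Set (E n)) (g : E n → Matrix (Fin n) (Fin n) ℝ)
    (α : Fin n → E n → ℝ) : Prop extends LocalMetric U g where
  dim : 5 ≤ n
  recur : ∀ x ∈ U, ∀ i j k l m, covDerivWeyl g i j k l m x = α i x * weyl g j k l m x
  sq_ne : ∀ x ∈ U, weylSq g x ≠ 0

variable {U : Set (E n)} {g : E n → Matrix (Fin n) (Fin n) ℝ} {x : E n} {α : Fin n → E n → ℝ}

theorem hOp_eq : hOp g = fun y => (1 / weylSq g y) • ((g y)⁻¹ * weylContr g y) := by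
  ext1 y
  rw [hOp, hTensor, mul_smul_comm]

namespace LocalMetric

variable (h : LocalMetric U g)
include h

/-- The two operator indices are contracted as a trace of a matrix product; the sign comes from
transposing a skew operator. This form is convenient for differentiation and for changes of
coordinates. -/
theorem weylContr_apply (hx : x ∈ U) (i j : Fin n) : weylContr g x i j
    = - ∑ k, ∑ a, (g x)⁻¹ k a * (weylMat g i a x * weylMat g j k x).trace := by
  have e : ∀ k a, ∑ l, ∑ m, ∑ b, ∑ c, (g x)⁻¹ l b * (g x)⁻¹ m c
      * weyl g i a b c x * weyl g j k l m x = - (weylMat g i a x * weylMat g j k x).trace := by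
    intro k a
    set X := g x * weylMat g i a x with hX
    set Y := g x * weylMat g j k x with hY
    have e1 : (weylMat g i a x * weylMat g j k x).trace
        = - ((g x)⁻¹ * X * (g x)⁻¹ * Y.transpose).trace := by
      have : Y.transpose = - Y := by
        rw [hY, Matrix.transpose_mul, h.symm x hx, (h.weylMat_curvLike hx).skew]
      rw [this, mul_neg, Matrix.trace_neg, neg_neg, hX, hY, ← mul_assoc (g x)⁻¹, h.inv_mul hx,
        one_mul, mul_assoc, ← mul_assoc (g x)⁻¹, h.inv_mul hx, one_mul]
    rw [e1, neg_neg]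
    simp only [h.weyl_eq hx, ← hX, ← hY, Matrix.trace, Matrix.diag, Matrix.transpose_apply,
      Matrix.mul_apply (N := Y.transpose), Matrix.mul_apply (N := (g x)⁻¹),
      Matrix.mul_apply (N := X), Finset.sum_mul]
    rw [Finset.sum_comm]
    refine Finset.sum_congr rfl fun m _ => Finset.sum_congr rfl fun l _ =>
      Finset.sum_congr rfl fun b _ => Finset.sum_congr rfl fun c _ => ?_
    rw [(h.ndsymm hx).inv_apply l b]; ring
  have e2 : ∀ k, ∑ l, ∑ m, weylRaised g i k l m x * weyl g j k l m x
      = ∑ a, (g x)⁻¹ k a * ∑ l, ∑ m, ∑ b, ∑ c, (g x)⁻¹ l b * (g x)⁻¹ m c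
      * weyl g i a b c x * weyl g j k l m x := by
    intro k
    simp only [weylRaised, Finset.sum_mul, Finset.mul_sum]
    have : ∀ l, ∑ m, ∑ a, ∑ b, ∑ c, (g x)⁻¹ k a * (g x)⁻¹ l b * (g x)⁻¹ m c * weyl g i a b c x
        * weyl g j k l m x = ∑ a, ∑ m, ∑ b, ∑ c, (g x)⁻¹ k a * ((g x)⁻¹ l b * (g x)⁻¹ m c
        * weyl g i a b c x * weyl g j k l m x) := by
      intro l
      rw [Finset.sum_comm]
      exact Finset.sum_congr rfl fun a _ => Finset.sum_congr rfl fun b _ =>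
        Finset.sum_congr rfl fun c _ => Finset.sum_congr rfl fun d _ => by ring
    simp only [this]
    exact Finset.sum_comm
  simp only [weylContr, e2, e, mul_neg, Finset.sum_neg_distrib]

/-- `contr_apply` exchanges contraction over one form index and the operator indices for contraction
over both form indices; `contr_swap` supplies the symmetry needed to match the free indices. -/
theorem weylContr_eq (hx : x ∈ U) : weylContr g x
    = - (g x * contr (g x) (fun i j => weylMat g i j x) (fun i j => weylMat g i j x)) := by
  set C : Fin n → Fin n → Mat := fun i j => weylMat g i j x with hC
  have hCl : CurvLike (g x) C := h.weylMat_curvLike hx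
  have hg := h.ndsymm hx
  have hs : (g x * contr (g x) C C).transpose = g x * contr (g x) C C := by
    rw [Matrix.transpose_mul, h.symm x hx, contr_swap hg hCl hCl]
  ext i j
  rw [h.weylContr_apply hx, ← hs, Matrix.neg_apply, Matrix.transpose_apply, neg_inj,
    Matrix.mul_apply]
  have e : ∀ q, contr (g x) C C q i
      = ∑ j', (g x)⁻¹ q j' * ∑ k, ∑ a, (g x)⁻¹ k a * (C i k * C j' a).trace := by
    intro q
    rw [hCl.contr_apply hg]
    simp only [rz, Finset.mul_sum, mul_smul_comm, Matrix.trace_sum, Matrix.trace_smul, smul_eq_mul,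
      mul_assoc]
    rw [Finset.sum_comm]
  simp only [e]
  have e2 : ∀ v : Fin n → ℝ, ∑ q, g x j q * ∑ j', (g x)⁻¹ q j' * v j' = v j := by
    intro v
    have := congrFun (congrArg (fun M : Mat => M.mulVec v) hg.mul_inv) j
    simp only [← Matrix.mulVec_mulVec, Matrix.one_mulVec] at this
    exact this
  rw [e2 fun j' => ∑ k, ∑ a, (g x)⁻¹ k a * (C i k * C j' a).trace, Finset.sum_comm]
  exact Finset.sum_congr rfl fun a _ => Finset.sum_congr rfl fun k _ => by
    rw [hg.inv_apply]

theorem weylContr_symm (hx : x ∈ U) : (weylContr g x).transpose = weylContr g x := by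
  have hCl := h.weylMat_curvLike hx
  rw [h.weylContr_eq hx, Matrix.transpose_neg, Matrix.transpose_mul, h.symm x hx,
    contr_swap (h.ndsymm hx) hCl hCl]

theorem weylSq_eq (hx : x ∈ U) : weylSq g x = ((g x)⁻¹ * weylContr g x).trace := by
  have hs : ∀ i j, weylContr g x i j = weylContr g x j i := fun i j => by
    rw [← Matrix.transpose_apply (weylContr g x), h.weylContr_symm hx]
  generalize hW : weylContr g x = W at hs
  unfold weylSq
  rw [hW]
  simp only [Matrix.trace, Matrix.diag, Matrix.mul_apply, hs]

theorem smooth_weylContr : MSm U (weylContr g) := by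
  intro i j
  refine ContDiffOn.congr (f := fun y => - ∑ k, ∑ a, (g y)⁻¹ k a
    * (weylMat g i a y * weylMat g j k y).trace) ?_ fun y hy => h.weylContr_apply hy i j
  exact (Sm.sum fun k _ => Sm.sum fun a _ => (h.smooth_inv k a).mul
    ((h.smooth_weylMat i a).mul (h.smooth_weylMat j k)).trace).neg

theorem smooth_weylSq : Sm U (weylSq g) :=
  (h.smooth_inv.mul h.smooth_weylContr).trace.congr fun _ hy => h.weylSq_eq hy

theorem mul_hOp (hx : x ∈ U) : g x * hOp g x = hTensor g x := by
  rw [hOp, ← mul_assoc, h.mul_inv hx, one_mul]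

theorem hOp_selfAdj (hx : x ∈ U) : (hOp g x).transpose * g x = g x * hOp g x := by
  have h1 : (hTensor g x).transpose = hTensor g x := by
    rw [hTensor, Matrix.transpose_smul, h.weylContr_symm hx]
  rw [h.mul_hOp hx]
  conv_rhs => rw [← h1, ← h.mul_hOp hx, Matrix.transpose_mul, h.symm x hx]

theorem contr_weylMat (hx : x ∈ U) (hq : weylSq g x ≠ 0) :
    contr (g x) (fun i j => weylMat g i j x) (fun i j => weylMat g i j x)
      = - (weylSq g x • hOp g x) := by
  rw [hOp_eq, smul_smul, mul_one_div_cancel hq, one_smul, h.weylContr_eq hx, mul_neg, neg_neg,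
    ← mul_assoc, h.inv_mul hx, one_mul]

end LocalMetric

namespace LocalRecurrent

variable (h : LocalRecurrent U g α)
include h

theorem nabForm_weylMat (hx : x ∈ U) (i j k : Fin n) :
    nabForm g i (weylMat g) j k x = α i x • weylMat g j k x := by
  have hL := h.toLocalMetric
  apply hL.cancel hx
  have e1 : ∀ l m, pd i (weyl g j k l m) x = mpd i (fun y => g y * weylMat g j k y) x m l := by
    intro l m
    exact pd_congr_of_eqOn hL.isOpen (fun y hy => hL.weyl_eq hy j k l m) hx i
  ext m l
  have h1 := h.recur x hx i j k l m
  rw [covDerivWeyl, e1, mpd_mul hL.isOpen hx i hL.smooth (hL.smooth_weylMat j k),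
    hL.mpd_metric hx] at h1
  simp only [hL.weyl_eq hx, Finset.sum_add_distrib] at h1
  have e2 : ∑ p, christoffel g p i j x * (g x * weylMat g p k x) m l
      = (g x * ∑ p, gam g i x p j • weylMat g p k x) m l := by
    simp only [Finset.mul_sum, mul_smul_comm, Matrix.sum_apply, Matrix.smul_apply, smul_eq_mul]
    rfl
  have e3 : ∑ p, christoffel g p i k x * (g x * weylMat g j p x) m l
      = (g x * ∑ p, gam g i x p k • weylMat g j p x) m l := by
    simp only [Finset.mul_sum, mul_smul_comm, Matrix.sum_apply, Matrix.smul_apply, smul_eq_mul]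
    rfl
  have e4 : ∑ p, christoffel g p i l x * (g x * weylMat g j k x) m p
      = (g x * weylMat g j k x * gam g i x) m l := by
    rw [Matrix.mul_apply]
    exact Finset.sum_congr rfl fun p _ => mul_comm _ _
  have e5 : ∑ p, christoffel g p i m x * (g x * weylMat g j k x) p l
      = ((gam g i x).transpose * (g x * weylMat g j k x)) m l := by
    rw [Matrix.mul_apply]
    rfl
  rw [e2, e3, e4, e5] at h1
  rw [mul_smul_comm, Matrix.smul_apply, smul_eq_mul, ← h1]
  simp only [← Matrix.sub_apply, ← Matrix.add_apply]
  refine congrFun (congrFun ?_ m) l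
  simp only [nabForm, nab]
  noncomm_ring

/-- Since R = kn(S) - C, recurrence of C expresses ∇R through C and ∇S. This is the form in which
the Bianchi identity is contracted with C. -/
theorem nabForm_curv (hx : x ∈ U) (i j k : Fin n) :
    nabForm g i (curv g) j k x = - (α i x • weylMat g j k x)
      + kn (g x) (nab g i (schouten g) x) j k := by
  have hL := h.toLocalMetric
  have e : curv g = fun j k y => kn (g y) (schouten g y) j k - weylMat g j k y := by
    funext j k y; rw [weylMat]; abel
  rw [e, hL.nabForm_sub hx (hL.smooth_kn hL.smooth_schouten) hL.smooth_weylMat,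
    hL.nabForm_kn hx hL.smooth_schouten, ← h.nabForm_weylMat hx i j k]
  abel

/-- Each of the two factors C contributes α. The connection terms on contracted indices cancel
against each other and against the derivative of g⁻¹; those on i and j remain. -/
theorem mpd_weylContr (hx : x ∈ U) (p : Fin n) : mpd p (weylContr g) x
    = (2 * α p x) • weylContr g x + (gam g p x).transpose * weylContr g x
      + weylContr g x * gam g p x := by
  have hL := h.toLocalMetric
  set Γ := gam g p x with hΓ
  set N : Fin n → Fin n → E n → Mat := fun i j y =>
    Matrix.of fun a k => (weylMat g i a y * weylMat g j k y).trace with hN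
  have hNs : ∀ i j, MSm U (N i j) := fun i j a k =>
    ((hL.smooth_weylMat i a).mul (hL.smooth_weylMat j k)).trace
  have eW : ∀ y ∈ U, ∀ i j, weylContr g y i j = - ((g y)⁻¹ * N i j y).trace := by
    intro y hy i j
    rw [hL.weylContr_apply hy]
    simp only [Matrix.trace, Matrix.diag, Matrix.mul_apply, hN, Matrix.of_apply]
  have dC : ∀ j k, mpd p (weylMat g j k) x = α p x • weylMat g j k x
      + (weylMat g j k x * Γ - Γ * weylMat g j k x)
      + ∑ q, Γ q j • weylMat g q k x + ∑ q, Γ q k • weylMat g j q x := by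
    intro j k
    rw [← h.nabForm_weylMat hx p j k]
    simp only [nabForm, nab]
    abel
  have dN : ∀ i j, mpd p (N i j) x = (2 * α p x) • N i j x + ∑ q, Γ q i • N q j x
      + ∑ q, Γ q j • N i q x + Γ.transpose * N i j x + N i j x * Γ := by
    intro i j
    ext a k
    have e1 : mpd p (N i j) x a k
        = (mpd p (fun y => weylMat g i a y * weylMat g j k y) x).trace :=
      pd_trace hL.isOpen hx p ((hL.smooth_weylMat i a).mul (hL.smooth_weylMat j k))
    have e2 : ∀ X Y : Mat, ((X * Γ - Γ * X) * Y).trace + (X * (Y * Γ - Γ * Y)).trace = 0 := by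
      intro X Y
      rw [sub_mul, mul_sub, Matrix.trace_sub, Matrix.trace_sub, ← mul_assoc X Y Γ,
        Matrix.trace_mul_comm (X * Y) Γ, mul_assoc Γ, mul_assoc X]
      ring
    have e3 := e2 (weylMat g i a x) (weylMat g j k x)
    rw [e1, mpd_mul hL.isOpen hx p (hL.smooth_weylMat i a) (hL.smooth_weylMat j k), dC, dC]
    simp only [add_mul, mul_add, smul_mul_assoc, mul_smul_comm, Finset.sum_mul, Finset.mul_sum,
      Matrix.trace_add, Matrix.trace_smul, Matrix.trace_sum, Matrix.add_apply, Matrix.smul_apply,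
      Matrix.sum_apply, smul_eq_mul]
    rw [Matrix.mul_apply, Matrix.mul_apply]
    simp only [hN, Matrix.of_apply, Matrix.transpose_apply]
    have e4 : ∑ q, (weylMat g i a x * weylMat g j q x).trace * Γ q k
        = ∑ q, Γ q k * (weylMat g i a x * weylMat g j q x).trace :=
      Finset.sum_congr rfl fun q _ => mul_comm _ _
    rw [e4]
    linear_combination e3
  ext i j
  have e1 : mpd p (weylContr g) x i j
      = - (mpd p (fun y => (g y)⁻¹ * N i j y) x).trace := by
    have : mpd p (weylContr g) x i j = pd p (fun y => - ((g y)⁻¹ * N i j y).trace) x :=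
      pd_congr_of_eqOn hL.isOpen (fun y hy => eW y hy i j) hx p
    rw [this, pd_neg, pd_trace hL.isOpen hx p (hL.smooth_inv.mul (hNs i j))]
  have e2 : (-(Γ * (g x)⁻¹) * N i j x - (g x)⁻¹ * Γ.transpose * N i j x
      + ((g x)⁻¹ * (Γ.transpose * N i j x) + (g x)⁻¹ * (N i j x * Γ))).trace = 0 := by
    rw [mul_assoc (g x)⁻¹, ← mul_assoc (g x)⁻¹ (N i j x), neg_mul, Matrix.trace_add,
      Matrix.trace_sub, Matrix.trace_add, Matrix.trace_neg, Matrix.trace_mul_comm _ Γ, mul_assoc]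
    ring
  rw [e1, mpd_mul hL.isOpen hx p hL.smooth_inv (hNs i j), hL.mpd_metric_inv hx, dN]
  have e3 : (- (Γ * (g x)⁻¹) - (g x)⁻¹ * Γ.transpose) * N i j x + (g x)⁻¹ * ((2 * α p x) • N i j x
      + ∑ q, Γ q i • N q j x + ∑ q, Γ q j • N i q x + Γ.transpose * N i j x + N i j x * Γ)
      = (2 * α p x) • ((g x)⁻¹ * N i j x) + ∑ q, Γ q i • ((g x)⁻¹ * N q j x)
        + ∑ q, Γ q j • ((g x)⁻¹ * N i q x) + (-(Γ * (g x)⁻¹) * N i j x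
        - (g x)⁻¹ * Γ.transpose * N i j x
      + ((g x)⁻¹ * (Γ.transpose * N i j x) + (g x)⁻¹ * (N i j x * Γ))) := by
    simp only [mul_add, sub_mul, mul_smul_comm, Finset.mul_sum]
    abel
  rw [e3, Matrix.trace_add, e2, add_zero]
  simp only [Matrix.trace_add, Matrix.trace_smul, Matrix.trace_sum, Matrix.add_apply,
    Matrix.smul_apply, smul_eq_mul, Matrix.mul_apply (N := weylContr g x),
    Matrix.mul_apply (N := Γ), eW x hx, Matrix.transpose_apply, mul_neg, neg_mul,
    Finset.sum_neg_distrib]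
  have e4 : ∑ q, ((g x)⁻¹ * N i q x).trace * Γ q j = ∑ q, Γ q j * ((g x)⁻¹ * N i q x).trace :=
      Finset.sum_congr rfl fun q _ => mul_comm _ _
  rw [e4]
  ring

theorem nab_inv_weylContr (hx : x ∈ U) (p : Fin n) :
    nab g p (fun y => (g y)⁻¹ * weylContr g y) x
      = (2 * α p x) • ((g x)⁻¹ * weylContr g x) := by
  have hL := h.toLocalMetric
  rw [nab, mpd_mul hL.isOpen hx p hL.smooth_inv hL.smooth_weylContr, hL.mpd_metric_inv hx,
    h.mpd_weylContr hx, mul_add, mul_add, mul_smul_comm]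
  noncomm_ring

theorem pd_weylSq (hx : x ∈ U) (p : Fin n) : pd p (weylSq g) x = 2 * α p x * weylSq g x := by
  have hL := h.toLocalMetric
  rw [pd_congr_of_eqOn hL.isOpen (fun y hy => hL.weylSq_eq hy) hx,
    hL.pd_trace_eq hx (hL.smooth_inv.mul hL.smooth_weylContr), h.nab_inv_weylContr hx,
    Matrix.trace_smul, hL.weylSq_eq hx, smul_eq_mul]

/-- By `pd_weylSq`, α is half the logarithmic differential of C², and C² has no zero. -/
theorem smooth_recur (i : Fin n) : Sm U (α i) := by
  have hL := h.toLocalMetric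
  refine ContDiffOn.congr (f := fun y => pd i (weylSq g) y / (2 * weylSq g y)) ?_ fun y hy => ?_
  · exact (hL.smooth_weylSq.pd hL.isOpen i).div (contDiffOn_const.mul hL.smooth_weylSq)
      fun y hy => mul_ne_zero two_ne_zero (h.sq_ne y hy)
  · rw [h.pd_weylSq hy]
    have := h.sq_ne y hy
    field_simp

/-- The second derivatives of C² are symmetric; after the symmetric term 4α_iα_jC² is removed, this
is the closedness of α. -/
theorem recur_closed (hx : x ∈ U) (i j : Fin n) : pd i (α j) x = pd j (α i) x := by
  have hL := h.toLocalMetric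
  have key : ∀ i j, pd i (pd j (weylSq g)) x
      = 2 * weylSq g x * pd i (α j) x + 4 * α i x * α j x * weylSq g x := by
    intro i j
    have d1 := (h.smooth_recur j).diffAt hL.isOpen hx
    have d2 := hL.smooth_weylSq.diffAt hL.isOpen hx
    rw [pd_congr_of_eqOn hL.isOpen (fun y hy => h.pd_weylSq hy j) hx,
      pd_mul i (d1.const_mul 2) d2, pd_const_mul i 2 d1, h.pd_weylSq hx]
    ring
  have h1 := pd_comm hL.isOpen hL.smooth_weylSq hx i j
  rw [key, key] at h1
  have h2 : weylSq g x * (pd i (α j) x - pd j (α i) x) = 0 := by linear_combination h1 / 2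
  exact sub_eq_zero.1 ((mul_eq_zero.1 h2).resolve_left (h.sq_ne x hx))

theorem smooth_inv_weylSq : Sm U (fun y => 1 / weylSq g y) :=
  contDiffOn_const.div h.smooth_weylSq h.sq_ne

theorem smooth_hOp : MSm U (hOp g) := by
  rw [hOp_eq]
  exact MSm.smul h.smooth_inv_weylSq (h.smooth_inv.mul h.smooth_weylContr)

/-- The operator `h` is parallel. -/
theorem nab_hOp (hx : x ∈ U) (i : Fin n) : nab g i (hOp g) x = 0 := by
  have hL := h.toLocalMetric
  have hq := h.sq_ne x hx
  -- Dividing by C² contributes -2α, which cancels the 2α from the square of C.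
  have e1 : pd i (fun y => 1 / weylSq g y) x = - (2 * α i x) * (1 / weylSq g x) := by
    have h1 : pd i (fun y => (1 / weylSq g y) * weylSq g y) x = 0 := by
      rw [pd_congr_of_eqOn (f₂ := fun _ => 1) hL.isOpen
        (fun y hy => one_div_mul_cancel (h.sq_ne y hy)) hx, pd_const]
    rw [pd_mul i (h.smooth_inv_weylSq.diffAt hL.isOpen hx) (hL.smooth_weylSq.diffAt hL.isOpen hx),
      h.pd_weylSq hx] at h1
    field_simp at h1 ⊢
    linear_combination h1
  rw [hOp_eq, hL.nab_smul hx h.smooth_inv_weylSq (hL.smooth_inv.mul hL.smooth_weylContr), e1,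
    h.nab_inv_weylContr hx]
  module

theorem trace_hOp (hx : x ∈ U) : (hOp g x).trace = 1 := by
  rw [hOp_eq, Matrix.trace_smul, ← h.weylSq_eq hx, smul_eq_mul, one_div_mul_cancel (h.sq_ne x hx)]

end LocalRecurrent

end Recurrent
end ConfRec
end

noncomputable section
namespace ConfRec

/-! ### The defect D of recurrence of S, the operator K, and a point where h splits. -/

section LocalSpectral

variable {n : ℕ}

local notation "Mat" => Matrix (Fin n) (Fin n) ℝ

/-- The traceless part of the operator `h`. -/
def hTl (g : E n → Matrix (Fin n) (Fin n) ℝ) (x : E n) : Matrix (Fin n) (Fin n) ℝ :=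
  hOp g x - (1 / (n : ℝ)) • 1

/-- The traceless recurrent operator `(n S + tr S) h₀ - tr (S h₀)`, where `S` is the Schouten
operator and `h₀` the traceless part of `h`. -/
def kOp (g : E n → Matrix (Fin n) (Fin n) ℝ) (x : E n) : Matrix (Fin n) (Fin n) ℝ :=
  ((n : ℝ) • schouten g x + (schouten g x).trace • 1) * hTl g x
    - (schouten g x * hTl g x).trace • 1

/-- The difference `∇_i S - α_i S` for the Schouten operator `S`. -/
def dOp (g : E n → Matrix (Fin n) (Fin n) ℝ) (α : Fin n → E n → ℝ) (i : Fin n) (x : E n) :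
    Matrix (Fin n) (Fin n) ℝ :=
  nab g i (schouten g) x + (- α i x) • schouten g x

/-- The eigenvalue `(n-3)/(2(n-2))` of `h`. -/
def lam (n : ℕ) : ℝ := ((n : ℝ) - 3) / (2 * ((n : ℝ) - 2))

/-- n(n-3) = 2(n-2) is (n-1)(n-4) = 0, which n ≥ 5 excludes. -/
theorem mul_lam_ne_one (hn : 5 ≤ n) : (n : ℝ) * lam n ≠ 1 := by
  have hn' : (5 : ℝ) ≤ n := by exact_mod_cast hn
  unfold lam
  have h2 : (n : ℝ) - 2 ≠ 0 := by linarith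
  intro h
  field_simp at h
  nlinarith

variable {U V : Set (E n)} {g : E n → Matrix (Fin n) (Fin n) ℝ} {x : E n} {α : Fin n → E n → ℝ}

namespace LocalRecurrent

theorem mono (h : LocalRecurrent U g α) (hV : IsOpen V) (hVU : V ⊆ U) : LocalRecurrent V g α where
  isOpen := hV
  smooth := fun k l => (h.smooth k l).mono hVU
  symm := fun x hx => h.symm x (hVU hx)
  unit := fun x hx => h.unit x (hVU hx)
  dim := h.dim
  recur := fun x hx => h.recur x (hVU hx)
  sq_ne := fun x hx => h.sq_ne x (hVU hx)

variable (h : LocalRecurrent U g α)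
include h

theorem smooth_hTl : MSm U (hTl g) := h.smooth_hOp.sub (MSm.const _)

theorem nab_hTl (hx : x ∈ U) (i : Fin n) : nab g i (hTl g) x = 0 := by
  have : nab g i (fun _ => (1 / (n : ℝ)) • (1 : Mat)) x = 0 := by
    unfold nab
    rw [mpd_const, mul_smul_comm, smul_mul_assoc, mul_one, one_mul, sub_self, add_zero]
  unfold hTl
  rw [h.nab_sub hx h.smooth_hOp (MSm.const _), h.nab_hOp hx, this, sub_zero]

theorem trace_hTl (hx : x ∈ U) : (hTl g x).trace = 0 := by
  have hn' : (5 : ℝ) ≤ n := by exact_mod_cast h.dim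
  have hn0 : (n : ℝ) ≠ 0 := by linarith
  rw [hTl, Matrix.trace_sub, h.trace_hOp hx, Matrix.trace_smul, Matrix.trace_one, Fintype.card_fin,
    smul_eq_mul, one_div_mul_cancel hn0, sub_self]

theorem hTl_selfAdj (hx : x ∈ U) : (hTl g x).transpose * g x = g x * hTl g x := by
  simp only [hTl, Matrix.transpose_sub, Matrix.transpose_smul, Matrix.transpose_one, sub_mul,
    mul_sub, smul_mul_assoc, mul_smul_comm, one_mul, mul_one, h.hOp_selfAdj hx]

theorem curv_hOp (hx : x ∈ U) (j k : Fin n) : curv g j k x * hOp g x = hOp g x * curv g j k x := by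
  refine h.curv_commute hx h.smooth_hOp (β := fun _ _ => 0) (fun _ => contDiffOn_const)
    (fun i j => by rw [pd_const, pd_const]) (fun y hy i => ?_) j k
  rw [zero_smul]
  exact h.nab_hOp hy i

theorem commute_of_curv {A : Mat} (hx : x ∈ U) (hA : A.transpose * g x = g x * A)
    (hc : ∀ j k, curv g j k x * A = A * curv g j k x) : ricciOp g x * A = A * ricciOp g x := by
  have h1 := (h.curvLike hx).ric_mul_symm (h.ndsymm hx) hA hc
  rw [h.ric_eq hx, Matrix.transpose_mul, Matrix.transpose_mul, h.symm x hx, h.ricciOp_selfAdj hx,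
    ← mul_assoc, hA, mul_assoc, mul_assoc] at h1
  exact (h.cancel hx h1).symm

theorem schouten_hTl (hx : x ∈ U) : schouten g x * hTl g x = hTl g x * schouten g x := by
  have h1 := h.commute_of_curv hx (h.hOp_selfAdj hx) (h.curv_hOp hx)
  simp only [schouten, hTl, add_mul, mul_add, sub_mul, mul_sub, smul_mul_assoc, mul_smul_comm,
    one_mul, mul_one, h1]
  module

theorem dOp_selfAdj (hx : x ∈ U) (i : Fin n) :
    (dOp g α i x).transpose * g x = g x * dOp g α i x := by
  simp only [dOp, Matrix.transpose_add, Matrix.transpose_smul, add_mul, mul_add, smul_mul_assoc,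
    mul_smul_comm, h.schouten_selfAdj hx,
    h.nab_selfAdj hx h.smooth_schouten (fun y hy => h.schouten_selfAdj hy)]

/-- Insert C = -R + kn(S): the curvature fails to be recurrent exactly by a `kn` term. -/
theorem nabForm_curv_eq (hx : x ∈ U) (i j k : Fin n) : nabForm g i (curv g) j k x
    = α i x • curv g j k x + kn (g x) (dOp g α i x) j k := by
  rw [h.nabForm_curv hx, weylMat, dOp, kn_add, kn_smul]
  module

/-- Recurrent operators commute with `X ∧ D_i Y + D_i X ∧ Y`. -/
theorem kn_dOp_commute {A : E n → Mat} (hx : x ∈ U) (hA : MSm U A) {β : Fin n → E n → ℝ}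
    (hβ : ∀ i, Sm U (β i)) (hcl : ∀ y ∈ U, ∀ i j, pd i (β j) y = pd j (β i) y)
    (hrec : ∀ y ∈ U, ∀ i, nab g i A y = β i y • A y) (i j k : Fin n) :
    kn (g x) (dOp g α i x) j k * A x = A x * kn (g x) (dOp g α i x) j k := by
  have hc : ∀ y ∈ U, ∀ j k, curv g j k y * A y = A y * curv g j k y := fun y hy j k =>
    h.curv_commute hy hA hβ (hcl y hy) hrec j k
  have h1 := h.nabForm_curv_commute hx hA hc i j k (hrec x hx i)
  rw [h.nabForm_curv_eq hx, add_mul, mul_add, smul_mul_assoc, mul_smul_comm, hc x hx,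
    add_left_cancel_iff] at h1
  exact h1

theorem kn_dOp_hOp (hx : x ∈ U) (i j k : Fin n) :
    kn (g x) (dOp g α i x) j k * hOp g x = hOp g x * kn (g x) (dOp g α i x) j k :=
  h.kn_dOp_commute hx h.smooth_hOp (β := fun _ _ => 0) (fun _ => contDiffOn_const)
    (fun y _ i j => by rw [pd_const, pd_const])
    (fun y hy i => by rw [zero_smul]; exact h.nab_hOp hy i) i j k

/-- Apply `vecMul_contr_eq` with T = ∇S and divide by C², using tr h = 1. Raising the index of α
turns the row eigenvector into a column eigenvector, as h is self-adjoint. -/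
theorem hOp_mulVec_recur (hx : x ∈ U) :
    (hOp g x).mulVec ((g x)⁻¹.mulVec fun i => α i x)
      = lam n • (g x)⁻¹.mulVec fun i => α i x := by
  have hB : ∀ i j k, (- (α i x • weylMat g j k x) + kn (g x) (nab g i (schouten g) x) j k)
      + (- (α j x • weylMat g k i x) + kn (g x) (nab g j (schouten g) x) k i)
      + (- (α k x • weylMat g i j x) + kn (g x) (nab g k (schouten g) x) i j) = 0 := by
    intro i j k
    rw [← h.bianchi_two hx i j k, h.nabForm_curv hx, h.nabForm_curv hx, h.nabForm_curv hx]
  have h1 := vecMul_contr_eq h.dim (h.ndsymm hx) (h.weylMat_curvLike hx) (h.ric_weylMat h.dim hx)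
    (T := fun i => nab g i (schouten g) x) (α := fun i => α i x)
    (fun i => h.nab_selfAdj hx h.smooth_schouten (fun y hy => h.schouten_selfAdj hy) i) hB
  have hq := h.sq_ne x hx
  rw [h.contr_weylMat hx hq, Matrix.vecMul_neg, Matrix.vecMul_smul, Matrix.trace_neg,
    Matrix.trace_smul, h.trace_hOp hx, smul_eq_mul, mul_one] at h1
  have h2 : Matrix.vecMul (fun i => α i x) (hOp g x) = lam n • fun i => α i x := by
    have h3 : weylSq g x • (Matrix.vecMul (fun i => α i x) (hOp g x) - lam n • fun i => α i x)
        = 0 := by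
      rw [smul_sub, sub_eq_zero, ← neg_inj, h1, lam, smul_smul, ← neg_smul]
      congr 1; ring
    exact sub_eq_zero.1 ((smul_eq_zero.1 h3).resolve_left hq)
  rw [Matrix.mulVec_mulVec, (h.ndsymm hx).mul_inv_selfAdj (h.hOp_selfAdj hx),
    ← Matrix.mulVec_mulVec, Matrix.mulVec_transpose, h2, Matrix.mulVec_smul]

theorem smooth_kOp : MSm U (kOp g) := by
  have hS := h.smooth_schouten
  exact (((MSm.smul contDiffOn_const hS).add (MSm.smul hS.trace (MSm.const 1))).mul
    h.smooth_hTl).sub (MSm.smul (hS.mul h.smooth_hTl).trace (MSm.const 1))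

theorem trace_kOp (hx : x ∈ U) : (kOp g x).trace = 0 := by
  rw [kOp, Matrix.trace_sub, add_mul, Matrix.trace_add, smul_mul_assoc, smul_mul_assoc, one_mul,
    Matrix.trace_smul, Matrix.trace_smul, Matrix.trace_smul, h.trace_hTl hx, Matrix.trace_one,
    Fintype.card_fin, smul_eq_mul, smul_eq_mul, smul_eq_mul]
  ring

theorem kOp_selfAdj (hx : x ∈ U) : (kOp g x).transpose * g x = g x * kOp g x := by
  have e : (schouten g x * hTl g x).transpose * g x = g x * (schouten g x * hTl g x) := by
    rw [Matrix.transpose_mul, mul_assoc, h.schouten_selfAdj hx, ← mul_assoc, h.hTl_selfAdj hx,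
      mul_assoc, h.schouten_hTl hx]
  simp only [kOp, add_mul, smul_mul_assoc, one_mul, Matrix.transpose_sub, Matrix.transpose_add,
    Matrix.transpose_smul, Matrix.transpose_one, sub_mul, mul_add, mul_sub, mul_smul_comm, mul_one,
    e, h.hTl_selfAdj hx]

/-- `K` is recurrent. -/
theorem nab_kOp (hx : x ∈ U) (i : Fin n) : nab g i (kOp g) x = α i x • kOp g x := by
  have hn' : (5 : ℝ) ≤ n := by exact_mod_cast h.dim
  have hn0 : (n : ℝ) ≠ 0 := by linarith
  have hS := h.smooth_schouten
  have hT := h.smooth_hTl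
  set S := schouten g with hSd
  set T := hTl g with hTd
  have sm1 : MSm U (fun y => (n : ℝ) • S y) := MSm.smul contDiffOn_const hS
  have sm2 : MSm U (fun y => (S y).trace • (1 : Mat)) := MSm.smul hS.trace (MSm.const 1)
  have e1 : nab g i (kOp g) x = ((n : ℝ) • nab g i S x + (nab g i S x).trace • 1) * T x
      - (nab g i S x * T x).trace • 1 := by
    have e : kOp g = fun y => ((n : ℝ) • S y + (S y).trace • 1) * T y
        - (S y * T y).trace • 1 := rfl
    rw [e, h.nab_sub hx ((sm1.add sm2).mul hT) (MSm.smul (hS.mul hT).trace (MSm.const 1)),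
      h.nab_mul hx (sm1.add sm2) hT, h.nab_hTl hx, mul_zero, add_zero, h.nab_add hx sm1 sm2,
      h.nab_smul hx contDiffOn_const hS, h.nab_smul hx hS.trace (MSm.const 1), nab_const_one,
      h.nab_smul hx (hS.mul hT).trace (MSm.const 1), nab_const_one, h.pd_trace_eq hx hS,
      h.pd_trace_eq hx (hS.mul hT), h.nab_mul hx hS hT, h.nab_hTl hx, mul_zero, add_zero,
      pd_const, zero_smul, zero_add, smul_zero, add_zero, smul_zero, add_zero]
  have hD := h.dOp_selfAdj hx i
  have c1 := kn_commute_trace (h.ndsymm hx) hD (h.hOp_selfAdj hx) (h.kn_dOp_hOp hx i)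
  have c2 := kn_commute (by have := h.dim; omega) (h.ndsymm hx) hD (h.hOp_selfAdj hx)
    (h.kn_dOp_hOp hx i)
  have e2 : nab g i S x = α i x • S x + dOp g α i x := by rw [dOp]; module
  set D := dOp g α i x with hDd
  -- The traced commutation of h with kn(D): when ∇S is replaced by αS + D in ∇K, the contribution
  -- of D vanishes.
  have e3 : ((n : ℝ) • D + D.trace • 1) * T x - (D * T x).trace • 1 = 0 := by
    rw [← c2, h.trace_hOp hx, one_smul] at c1
    rw [← c1, hTd, hTl, mul_sub D, Matrix.trace_sub, mul_smul_comm, mul_one, Matrix.trace_smul,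
      mul_sub, add_mul, mul_smul_comm, mul_one, smul_mul_assoc, smul_mul_assoc, one_mul, smul_add,
      smul_smul, one_div_mul_cancel hn0, smul_eq_mul]
    module
  rw [e1, e2]
  have e4 : ((n : ℝ) • (α i x • S x + D) + (α i x • S x + D).trace • 1) * T x
      - ((α i x • S x + D) * T x).trace • 1
      = α i x • kOp g x + (((n : ℝ) • D + D.trace • 1) * T x - (D * T x).trace • 1) := by
    simp only [kOp, ← hSd, ← hTd, Matrix.trace_add, Matrix.trace_smul, add_mul, smul_add,
      smul_mul_assoc, one_mul, smul_eq_mul, smul_sub, smul_smul]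
    module
  rw [e4, e3, add_zero]

theorem kn_dOp_kOp (hx : x ∈ U) (i j k : Fin n) :
    kn (g x) (dOp g α i x) j k * kOp g x = kOp g x * kn (g x) (dOp g α i x) j k :=
  h.kn_dOp_commute hx h.smooth_kOp h.smooth_recur (fun _ hy => h.recur_closed hy)
    (fun _ hy => h.nab_kOp hy) i j k

/-- Where the recurrence vector does not vanish identically, there is a point at which `h` has
two eigenvalues and `K` is a multiple of the traceless part of `h`. -/
theorem exists_spectral (hx : x ∈ U) (hα : (fun i => α i x) ≠ 0)
    (hH : ∀ y ∈ U, hTl g y ≠ 0) :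
    ∃ y ∈ U, (fun i => α i y) ≠ 0 ∧
      (∃ l' : ℝ, (hOp g y - lam n • 1) * (hOp g y - l' • 1) = 0) ∧
      ∃ s : ℝ, kOp g y = s • hTl g y := by
  have hinv : ∀ y ∈ U, (fun i => α i y) ≠ 0 → (g y)⁻¹.mulVec (fun i => α i y) ≠ 0 := by
    intro y hy h0 h1
    apply h0
    rw [← Matrix.one_mulVec (fun i => α i y), ← h.mul_inv hy, ← Matrix.mulVec_mulVec, h1,
      Matrix.mulVec_zero]
  -- Either some D_i is nonzero where α is, or the Schouten operator is recurrent on the whole open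
  -- set where α ≠ 0.
  by_cases hD : ∃ y ∈ U, (fun i => α i y) ≠ 0 ∧ ∃ i, dOp g α i y ≠ 0
  · obtain ⟨y, hy, hαy, i, hi⟩ := hD
    refine ⟨y, hy, hαy, ?_⟩
    exact spectral_of_kn_commute h.dim (h.ndsymm hy) (mul_lam_ne_one h.dim) (h.hOp_selfAdj hy)
      (h.kOp_selfAdj hy) (h.dOp_selfAdj hy i) (hinv y hy hαy) (h.hOp_mulVec_recur hy)
      (h.trace_hOp hy) (h.trace_kOp hy) (hH y hy) (h.kn_dOp_hOp hy i) (h.kn_dOp_kOp hy i) hi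
  · push Not at hD
    refine ⟨x, hx, hα, ?_⟩
    have hn' : (5 : ℝ) ≤ n := by exact_mod_cast h.dim
    have h2 : (n : ℝ) - 2 ≠ 0 := by linarith
    -- Commutation of S with the curvature needs recurrence of S on a neighbourhood, hence the
    -- restriction to this open set.
    set V := {y ∈ U | (fun i => α i y) ≠ 0} with hVd
    have hV : IsOpen V := by
      have hc : ContinuousOn (fun y => fun i => α i y) U :=
        continuousOn_pi.2 fun i => (h.smooth_recur i).continuousOn
      exact hc.isOpen_inter_preimage h.isOpen isOpen_compl_singleton
    have hVr : LocalRecurrent V g α := h.mono hV fun y hy => hy.1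
    have hxV : x ∈ V := ⟨hx, hα⟩
    have hS : ∀ y ∈ V, ∀ i, nab g i (schouten g) y = α i y • schouten g y := by
      intro y hy i
      have h3 := hD y hy.1 hy.2 i
      rw [dOp, neg_smul, ← sub_eq_add_neg, sub_eq_zero] at h3
      exact h3
    have hcS : ∀ j k, curv g j k x * schouten g x = schouten g x * curv g j k x :=
      hVr.curv_commute hxV hVr.smooth_schouten hVr.smooth_recur (hVr.recur_closed hxV) hS
    have hcR : ∀ j k, curv g j k x * ricciOp g x = ricciOp g x * curv g j k x := by
      intro j k
      have h3 := hcS j k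
      simp only [schouten, mul_add, add_mul, mul_smul_comm, smul_mul_assoc, mul_one, one_mul,
        add_left_inj] at h3
      exact smul_right_injective _ (one_div_ne_zero h2) h3
    have hcyc : ∀ i j k, α i x • curv g j k x + α j x • curv g k i x + α k x • curv g i j x = 0 := by
      intro i j k
      have e0 : ∀ j k, kn (g x) 0 j k = 0 := by
        intro j k; ext m l; simp [kn, tens]
      have e : ∀ i j k, nabForm g i (curv g) j k x = α i x • curv g j k x := by
        intro i j k
        rw [h.nabForm_curv_eq hx, hD x hx hα i, e0, add_zero]
      rw [← e, ← e, ← e]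
      exact h.bianchi_two hx i j k
    have hH0 : ∀ c : ℝ, hOp g x ≠ c • 1 := by
      intro c hc
      apply hH x hx
      have h3 := h.trace_hOp hx
      rw [hc, Matrix.trace_smul, Matrix.trace_one, Fintype.card_fin, smul_eq_mul] at h3
      rw [hTl, hc, ← sub_smul]
      have : c - 1 / (n : ℝ) = 0 := by
        have hn0 : (n : ℝ) ≠ 0 := by linarith
        field_simp
        linarith
      rw [this, zero_smul]
    obtain ⟨⟨l', hl'⟩, a, b, hab⟩ := spectral_of_cyclic (h.ndsymm hx) (h.curvLike hx) hα hcyc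
      (h.ricciOp_selfAdj hx) (h.ric_eq hx) hcR (h.hOp_selfAdj hx) (h.curv_hOp hx)
      (h.hOp_mulVec_recur hx) hH0 (h.sq_ne x hx) (h.contr_weylMat hx (h.sq_ne x hx))
    refine ⟨⟨l', hl'⟩, ?_⟩
    -- The quadratic relation of h, rewritten for h - 1/n. As S is affine in h₀, it makes the
    -- product defining K a combination of h₀ and the identity; the identity part cancels because K
    -- is traceless.
    obtain ⟨u, v, huv⟩ : ∃ u v : ℝ, hTl g x * hTl g x = u • hTl g x + v • 1 := by
      refine ⟨lam n + l' - 2 / n, (lam n + l') / n - lam n * l' - 1 / n / n, ?_⟩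
      have e : hOp g x = hTl g x + (1 / (n : ℝ)) • 1 := by rw [hTl]; abel
      rw [e] at hl'
      simp only [add_mul, mul_add, sub_mul, mul_sub, smul_mul_assoc, mul_smul_comm, one_mul,
        mul_one] at hl'
      rw [← sub_eq_zero, ← hl']
      module
    obtain ⟨c, d, hcd⟩ : ∃ c d : ℝ, schouten g x = c • hTl g x + d • 1 := by
      have e : hOp g x = hTl g x + (1 / (n : ℝ)) • 1 := by rw [hTl]; abel
      refine ⟨(1 / ((n : ℝ) - 2)) * a, (1 / ((n : ℝ) - 2)) * (a / n + b)
        - scal g x / (2 * ((n : ℝ) - 1) * ((n : ℝ) - 2)), ?_⟩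
      rw [schouten, hab, e]
      module
    have ht : (schouten g x * hTl g x).trace = c * (v * n) := by
      rw [hcd, add_mul, smul_mul_assoc, smul_mul_assoc, one_mul, huv]
      simp only [Matrix.trace_add, Matrix.trace_smul, h.trace_hTl hx, Matrix.trace_one,
        Fintype.card_fin, smul_eq_mul]
      ring
    refine ⟨n * c * u + n * d + (schouten g x).trace, ?_⟩
    rw [kOp, ht, add_mul, smul_mul_assoc, smul_mul_assoc, one_mul]
    nth_rw 1 [hcd]
    rw [add_mul, smul_mul_assoc, smul_mul_assoc, one_mul, huv]
    module

end LocalRecurrent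

end LocalSpectral
end ConfRec
end

noncomputable section
namespace ConfRec

/-! ### Zeros of parallel and recurrent operators are interior. -/

section Propagation

variable {n : ℕ}

local notation "Mat" => Matrix (Fin n) (Fin n) ℝ

variable {U : Set (E n)} {g : E n → Matrix (Fin n) (Fin n) ℝ} {x : E n} {α : Fin n → E n → ℝ}

/-- A function with values in `ℝ^{n × n}` whose partial derivatives are bounded by a multiple of
the function itself vanishes near each of its zeros. -/
theorem eventually_eq_zero_of_mpd_le {A : E n → Mat} {c : E n → ℝ} (hU : IsOpen U)
    (hA : MSm U A) (hc : ContinuousOn c U)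
    (hb : ∀ y ∈ U, ∀ r : ℝ, (∀ k l, |A y k l| ≤ r) → ∀ i k l, |mpd i A y k l| ≤ c y * r)
    (hx : x ∈ U) (h0 : A x = 0) : ∀ᶠ y in nhds x, A y = 0 := by
  obtain ⟨r, hr, hrU⟩ := Metric.nhds_basis_closedBall.mem_iff.1 (hU.mem_nhds hx)
  obtain ⟨C, hC⟩ := (isCompact_closedBall x r).exists_bound_of_continuousOn (hc.mono hrU)
  filter_upwards [Metric.closedBall_mem_nhds x hr] with y hy
  set v := y - x with hv
  have hin : ∀ t ∈ Set.Icc (0 : ℝ) 1, x + t • v ∈ Metric.closedBall x r := by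
    intro t ht
    rw [mem_closedBall_iff_norm, add_sub_cancel_left, norm_smul, Real.norm_of_nonneg ht.1]
    rw [mem_closedBall_iff_norm] at hy
    exact (mul_le_of_le_one_left (norm_nonneg _) ht.2).trans hy
  let f : ℝ → Fin n → Fin n → ℝ := fun t k l => A (x + t • v) k l
  let f' : ℝ → Fin n → Fin n → ℝ := fun t k l => ∑ i, v i * mpd i A (x + t • v) k l
  have hd : ∀ t ∈ Set.Icc (0 : ℝ) 1, HasDerivAt f (f' t) t := by
    intro t ht
    rw [hasDerivAt_pi]; intro k
    rw [hasDerivAt_pi]; intro l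
    have h1 : HasDerivAt (fun t : ℝ => x + t • v) v t := by
      simpa using ((hasDerivAt_id t).smul_const v).const_add x
    have h2 := (hA.diffAt hU (hrU (hin t ht)) k l).hasFDerivAt.comp_hasDerivAt t h1
    rw [fderiv_apply_eq_sum] at h2
    exact h2
  -- Grönwall's inequality along the segment from x to y.
  have key := eq_zero_of_abs_deriv_le_mul_abs_self_of_eq_zero_right (f := f) (f' := f')
    (K := (∑ i, |v i|) * C) (a := 0) (b := 1)
    (fun t ht => (hd t ht).continuousAt.continuousWithinAt)
    (fun t ht => (hd t ⟨ht.1, ht.2.le⟩).hasDerivWithinAt)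
    (by ext k l; simp [f, h0]) (by
      intro t ht
      have hin' := hin t ⟨ht.1, ht.2.le⟩
      have hle : ∀ k l, |A (x + t • v) k l| ≤ ‖f t‖ := fun k l =>
        (norm_le_pi_norm (f t k) l).trans (norm_le_pi_norm (f t) k)
      have hcC := (le_abs_self _).trans (hC _ hin')
      have hC0 : 0 ≤ C := (norm_nonneg _).trans (hC _ hin')
      have h1 : ∀ k l, ‖f' t k l‖ ≤ (∑ i, |v i|) * C * ‖f t‖ := by
        intro k l
        refine (Finset.abs_sum_le_sum_abs _ _).trans ?_
        rw [mul_assoc, Finset.sum_mul]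
        refine Finset.sum_le_sum fun i _ => ?_
        rw [abs_mul]
        exact mul_le_mul_of_nonneg_left ((hb _ (hrU hin') _ hle i k l).trans
          (mul_le_mul_of_nonneg_right hcC (norm_nonneg _))) (abs_nonneg _)
      have hnn : 0 ≤ (∑ i, |v i|) * C * ‖f t‖ :=
        mul_nonneg (mul_nonneg (Finset.sum_nonneg fun _ _ => abs_nonneg _) hC0) (norm_nonneg _)
      exact (pi_norm_le_iff_of_nonneg hnn).2 fun k => (pi_norm_le_iff_of_nonneg hnn).2 (h1 k))
    1 ⟨zero_le_one, le_rfl⟩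
  ext k l
  have := congrFun (congrFun key k) l
  simpa [f, hv] using this

/-- The equation ∇A = βA is the linear system ∂A = βA - ΓA + AΓ, with continuous coefficients. Its
derivatives are therefore bounded by a multiple of A. -/
theorem LocalMetric.eventually_eq_zero (h : LocalMetric U g) {A : E n → Mat} (hA : MSm U A)
    {β : Fin n → E n → ℝ} (hβ : ∀ i, Sm U (β i))
    (hrec : ∀ y ∈ U, ∀ i, nab g i A y = β i y • A y) (hx : x ∈ U) (h0 : A x = 0) :
    ∀ᶠ y in nhds x, A y = 0 := by
  refine eventually_eq_zero_of_mpd_le (c := fun y => ∑ i, (|β i y| + 2 * ∑ k, ∑ p, |gam g i y k p|))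
    h.isOpen hA ?_ ?_ hx h0
  · refine continuousOn_finsetSum _ fun i _ => ((hβ i).continuousOn.abs).add
      (continuousOn_const.mul (continuousOn_finsetSum _ fun k _ =>
        continuousOn_finsetSum _ fun p _ => (h.smooth_gam i k p).continuousOn.abs))
  · intro y hy r hr i k l
    have hr0 : 0 ≤ r := (abs_nonneg _).trans (hr k l)
    have e : mpd i A y = β i y • A y - gam g i y * A y + A y * gam g i y := by
      rw [← hrec y hy i, nab]; abel
    have row : ∀ k, ∑ p, |gam g i y k p| ≤ ∑ k, ∑ p, |gam g i y k p| := fun k =>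
      Finset.single_le_sum (f := fun k => ∑ p, |gam g i y k p|)
        (fun k _ => Finset.sum_nonneg fun _ _ => abs_nonneg _) (Finset.mem_univ k)
    have col : ∑ p, |gam g i y p l| ≤ ∑ k, ∑ p, |gam g i y k p| :=
      Finset.sum_le_sum fun k _ => Finset.single_le_sum (f := fun p => |gam g i y k p|)
        (fun _ _ => abs_nonneg _) (Finset.mem_univ l)
    have b1 : |(gam g i y * A y) k l| ≤ (∑ k, ∑ p, |gam g i y k p|) * r := by
      rw [Matrix.mul_apply]
      refine (Finset.abs_sum_le_sum_abs _ _).trans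
        (le_trans ?_ (mul_le_mul_of_nonneg_right (row k) hr0))
      rw [Finset.sum_mul]
      refine Finset.sum_le_sum fun p _ => ?_
      rw [abs_mul]
      exact mul_le_mul_of_nonneg_left (hr p l) (abs_nonneg _)
    have b2 : |(A y * gam g i y) k l| ≤ (∑ k, ∑ p, |gam g i y k p|) * r := by
      rw [Matrix.mul_apply]
      refine (Finset.abs_sum_le_sum_abs _ _).trans
        (le_trans ?_ (mul_le_mul_of_nonneg_right col hr0))
      rw [Finset.sum_mul]
      refine Finset.sum_le_sum fun p _ => ?_
      rw [abs_mul, mul_comm]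
      exact mul_le_mul_of_nonneg_left (hr k p) (abs_nonneg _)
    have b3 : |β i y * A y k l| ≤ |β i y| * r := by
      rw [abs_mul]; exact mul_le_mul_of_nonneg_left (hr k l) (abs_nonneg _)
    have b4 : |β i y| + 2 * ∑ k, ∑ p, |gam g i y k p|
        ≤ ∑ i, (|β i y| + 2 * ∑ k, ∑ p, |gam g i y k p|) :=
      Finset.single_le_sum (f := fun i => |β i y| + 2 * ∑ k, ∑ p, |gam g i y k p|)
        (fun i _ => add_nonneg (abs_nonneg _) (mul_nonneg zero_le_two
          (Finset.sum_nonneg fun _ _ => Finset.sum_nonneg fun _ _ => abs_nonneg _)))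
        (Finset.mem_univ i)
    refine le_trans ?_ (mul_le_mul_of_nonneg_right b4 hr0)
    rw [e, Matrix.add_apply, Matrix.sub_apply, Matrix.smul_apply, smul_eq_mul]
    refine (abs_add_le _ _).trans ((add_le_add (abs_sub _ _) le_rfl).trans ?_)
    linarith

/-- The part of `K` orthogonal to the traceless part of `h`. -/
def kPerp (g : E n → Matrix (Fin n) (Fin n) ℝ) (x : E n) : Matrix (Fin n) (Fin n) ℝ :=
  (hTl g x * hTl g x).trace • kOp g x - (kOp g x * hTl g x).trace • hTl g x

namespace LocalRecurrent

variable (h : LocalRecurrent U g α)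
include h

theorem eventually_hTl_eq_zero (hx : x ∈ U) (h0 : hTl g x = 0) : ∀ᶠ y in nhds x, hTl g y = 0 :=
  h.toLocalMetric.eventually_eq_zero h.smooth_hTl (β := fun _ _ => 0) (fun _ => contDiffOn_const)
    (fun y hy i => by rw [zero_smul]; exact h.nab_hTl hy i) hx h0

theorem eventually_quadratic (l l' : ℝ) (hx : x ∈ U)
    (h0 : (hOp g x - l • 1) * (hOp g x - l' • 1) = 0) :
    ∀ᶠ y in nhds x, (hOp g y - l • 1) * (hOp g y - l' • 1) = 0 := by
  have sm : ∀ l : ℝ, MSm U (fun y => hOp g y - l • (1 : Mat)) := fun l =>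
    h.smooth_hOp.sub (MSm.const _)
  have hz : ∀ l : ℝ, ∀ y ∈ U, ∀ i, nab g i (fun y => hOp g y - l • (1 : Mat)) y = 0 := by
    intro l y hy i
    have : nab g i (fun _ => l • (1 : Mat)) y = 0 := by
      unfold nab
      rw [mpd_const, mul_smul_comm, smul_mul_assoc, mul_one, one_mul, sub_self, add_zero]
    rw [h.nab_sub hy h.smooth_hOp (MSm.const _), h.nab_hOp hy, this, sub_zero]
  refine h.toLocalMetric.eventually_eq_zero ((sm l).mul (sm l')) (β := fun _ _ => 0)
    (fun _ => contDiffOn_const) (fun y hy i => ?_) hx h0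
  rw [h.nab_mul hy (sm l) (sm l'), hz l y hy, hz l' y hy, zero_smul, zero_mul, mul_zero, add_zero]

theorem smooth_kPerp : MSm U (kPerp g) :=
  (MSm.smul (h.smooth_hTl.mul h.smooth_hTl).trace h.smooth_kOp).sub
    (MSm.smul (h.smooth_kOp.mul h.smooth_hTl).trace h.smooth_hTl)

/-- As h₀ is parallel and K recurrent, tr(h₀²) is locally constant and tr(Kh₀) scales with α; so the
orthogonal part of K is recurrent with covector α. -/
theorem eventually_kPerp_eq_zero (hx : x ∈ U) (h0 : kPerp g x = 0) :
    ∀ᶠ y in nhds x, kPerp g y = 0 := by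
  have hT := h.smooth_hTl
  have hK := h.smooth_kOp
  refine h.toLocalMetric.eventually_eq_zero h.smooth_kPerp h.smooth_recur (fun y hy i => ?_) hx h0
  unfold kPerp
  rw [h.nab_sub hy (MSm.smul (hT.mul hT).trace hK) (MSm.smul (hK.mul hT).trace hT),
    h.nab_smul hy (hT.mul hT).trace hK, h.nab_smul hy (hK.mul hT).trace hT, h.nab_hTl hy,
    h.nab_kOp hy, h.pd_trace_eq hy (hT.mul hT), h.pd_trace_eq hy (hK.mul hT), h.nab_mul hy hT hT,
    h.nab_mul hy hK hT, h.nab_hTl hy, h.nab_kOp hy]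
  simp only [zero_mul, mul_zero, add_zero, Matrix.trace_zero, zero_smul, zero_add, smul_zero,
    smul_mul_assoc, Matrix.trace_smul, smul_eq_mul]
  module

end LocalRecurrent

end Propagation
end ConfRec
end

noncomputable section
namespace ConfRec

/-! ### Spectrum of a combination of complementary projectors. -/

section Idempotent

variable {n : ℕ}

local notation "Mat" => Matrix (Fin n) (Fin n) ℝ

variable {P A : Matrix (Fin n) (Fin n) ℝ} {a b : ℝ}

theorem isIdempotentElem_toLin' (hP : P * P = P) : IsIdempotentElem (Matrix.toLin' P) := by
  unfold IsIdempotentElem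
  rw [Module.End.mul_eq_comp, ← Matrix.toLin'_mul, hP]

theorem trace_eq_rank_of_idem (hP : P * P = P) : P.trace = P.rank := by
  have h2 := (LinearMap.IsIdempotentElem.isProj_range _ (isIdempotentElem_toLin' hP)).trace
  rw [Matrix.trace_toLin'_eq] at h2
  rw [h2, Matrix.rank, Matrix.toLin'_apply']

theorem charpoly_smul_id {V : Type*} [AddCommGroup V] [Module ℝ V] [Module.Finite ℝ V] (a : ℝ) :
    (a • (1 : Module.End ℝ V)).charpoly
      = (Polynomial.X - Polynomial.C a) ^ Module.finrank ℝ V := by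
  have h := LinearMap.charpoly_sub_smul (0 : Module.End ℝ V) (-a)
  rw [zero_sub, neg_smul, neg_neg] at h
  rw [h, LinearMap.charpoly_zero]
  simp [sub_eq_add_neg]

/-- In the decomposition into range and kernel of P the operator is a direct sum of two scalar
operators. -/
theorem charpoly_two_eigenvalues (hP : P * P = P) (a b : ℝ) :
    (a • P + b • (1 - P)).charpoly
      = (Polynomial.X - Polynomial.C a) ^ P.rank
        * (Polynomial.X - Polynomial.C b) ^ (n - P.rank) := by
  set f := Matrix.toLin' P with hf
  have hi := LinearMap.IsIdempotentElem.isProj_range f (isIdempotentElem_toLin' hP)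
  have hfe : Matrix.toLin' (a • P + b • (1 - P)) = a • f + b • (1 - f) := by
    rw [map_add, map_smul, map_smul, map_sub, Matrix.toLin'_one]; rfl
  rw [← Matrix.charpoly_toLin', hfe]
  set e := (LinearMap.range f).prodEquivOfIsCompl (LinearMap.ker f) hi.isCompl with he
  have h1 : a • f + b • (1 - f) = e.conj (LinearMap.prodMap (a • 1) (b • 1)) := by
    have h0 : f = e.conj (LinearMap.prodMap 1 0) := hi.eq_conj_prodMap
    have hone : (1 : Module.End ℝ (Fin n → ℝ)) = e.conj 1 := (LinearEquiv.conj_id e).symm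
    have h2 : (LinearMap.prodMap (a • 1) (b • 1) : Module.End ℝ (f.range × f.ker))
        = (a - b) • LinearMap.prodMap 1 0 + b • 1 := by
      ext <;> (simp; try ring)
    rw [h2, map_add, map_smul, map_smul, ← h0, ← hone]
    module
  have hr : P.rank = Module.finrank ℝ (LinearMap.range f) := by
    rw [Matrix.rank, hf, Matrix.toLin'_apply']
  have hk : n - P.rank = Module.finrank ℝ (LinearMap.ker f) := by
    have := LinearMap.finrank_range_add_finrank_ker f
    rw [Module.finrank_fin_fun] at this
    omega
  rw [h1, LinearEquiv.charpoly_conj, LinearMap.charpoly_prodMap, charpoly_smul_id,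
    charpoly_smul_id, hk, hr]

theorem eigenspace_eq_range (hP : P * P = P) (hA : A = a • P + b • (1 - P)) (hab : a ≠ b) :
    Module.End.eigenspace (Matrix.toLin' A) a = LinearMap.range (Matrix.toLin' P) := by
  ext v
  rw [Module.End.mem_eigenspace_iff, LinearMap.mem_range]
  simp only [Matrix.toLin'_apply]
  constructor
  · intro h
    refine ⟨v, ?_⟩
    have h1 : (a - b) • (P.mulVec v - v) = 0 := by
      rw [hA, Matrix.add_mulVec, Matrix.smul_mulVec, Matrix.smul_mulVec, Matrix.sub_mulVec,
        Matrix.one_mulVec] at h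
      rw [← sub_eq_zero] at h
      rw [← h]
      module
    exact sub_eq_zero.1 ((smul_eq_zero.1 h1).resolve_left (sub_ne_zero.2 hab))
  · rintro ⟨w, rfl⟩
    rw [Matrix.mulVec_mulVec, hA, add_mul, smul_mul_assoc, smul_mul_assoc, sub_mul, one_mul, hP,
      sub_self, smul_zero, add_zero, Matrix.smul_mulVec]

/-- The numbers a and b may coincide, so eigenvectors are taken directly from the images of P and of
1 - P, both nonzero. -/
theorem hasEigenvalue_iff_of_idem (hP : P * P = P) (hA : A = a • P + b • (1 - P)) (h0 : P ≠ 0)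
    (h1 : P ≠ 1) (ν : ℝ) :
    Module.End.HasEigenvalue (Matrix.toLin' A) ν ↔ ν = a ∨ ν = b := by
  have hPA : P * A = a • P := by
    rw [hA, mul_add, mul_smul_comm, mul_smul_comm, mul_sub, hP, mul_one, sub_self, smul_zero,
      add_zero]
  have hAP : A * P = a • P := by
    rw [hA, add_mul, smul_mul_assoc, smul_mul_assoc, sub_mul, hP, one_mul, sub_self, smul_zero,
      add_zero]
  have hAQ : A * (1 - P) = b • (1 - P) := by
    rw [mul_sub, mul_one, hAP, hA]; module
  have ex : ∀ {B : Mat} {c : ℝ}, B ≠ 0 → A * B = c • B →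
      Module.End.HasEigenvalue (Matrix.toLin' A) c := by
    intro B c hB hAB
    obtain ⟨w, hw⟩ : ∃ w, B.mulVec w ≠ 0 := by
      by_contra hcon
      push Not at hcon
      exact hB (Matrix.ext_of_mulVec_single fun i => by rw [hcon, Matrix.zero_mulVec])
    refine Module.End.hasEigenvalue_of_hasEigenvector (x := B.mulVec w)
      ⟨Module.End.mem_eigenspace_iff.2 ?_, hw⟩
    rw [Matrix.toLin'_apply, Matrix.mulVec_mulVec, hAB, Matrix.smul_mulVec]
  constructor
  · intro h
    obtain ⟨v, hv, hv0⟩ := h.exists_hasEigenvector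
    rw [Module.End.mem_eigenspace_iff, Matrix.toLin'_apply] at hv
    have h2 : (ν - a) • P.mulVec v = 0 := by
      rw [sub_smul, ← Matrix.smul_mulVec a, ← hPA, ← Matrix.mulVec_mulVec, hv, Matrix.mulVec_smul,
        sub_self]
    rcases smul_eq_zero.1 h2 with h3 | h3
    · exact Or.inl (sub_eq_zero.1 h3)
    · right
      rw [hA, Matrix.add_mulVec, Matrix.smul_mulVec, Matrix.smul_mulVec, Matrix.sub_mulVec,
        Matrix.one_mulVec, h3, smul_zero, zero_add, sub_zero] at hv
      exact (smul_left_injective ℝ hv0 hv).symm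
  · rintro (rfl | rfl)
    · exact ex h0 hAP
    · exact ex (sub_ne_zero.2 h1.symm) hAQ

end Idempotent

/-! ### Operators of trace one with the eigenvalue (n-3)/(2(n-2)). -/

section TwoEigenvalues

variable {n : ℕ}

local notation "Mat" => Matrix (Fin n) (Fin n) ℝ

/-- The second eigenvalue of an operator of trace one, whose first eigenvalue `(n-3)/(2(n-2))` has
multiplicity `nh`. -/
def lam' (n nh : ℕ) : ℝ := (1 - nh * lam n) / ((n : ℝ) - nh)

/-- The projector onto the eigenspace of the eigenvalue `(n-3)/(2(n-2))`. -/
def projOf (nh : ℕ) (H : Matrix (Fin n) (Fin n) ℝ) : Matrix (Fin n) (Fin n) ℝ :=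
  (2 * ((n : ℝ) - 2) * ((n : ℝ) - nh) / (((n : ℝ) - 1) * ((n : ℝ) - 4))) • H
    + (((nh : ℝ) * ((n : ℝ) - 3) - 2 * ((n : ℝ) - 2)) / (((n : ℝ) - 1) * ((n : ℝ) - 4))) • 1

/-- The first eigenvalue of the traceless part of h, and thus the coefficient of G in μ;
`lam'_sub_inv` plays this role for μ'. -/
theorem lam_sub_inv (hn : 5 ≤ n) :
    lam n - 1 / n = (((n : ℝ) - 1) * ((n : ℝ) - 4)) / (2 * n * ((n : ℝ) - 2)) := by
  have hn' : (5 : ℝ) ≤ n := by exact_mod_cast hn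
  have h2 : (n : ℝ) - 2 ≠ 0 := by linarith
  have h0 : (n : ℝ) ≠ 0 := by linarith
  unfold lam
  field_simp
  ring

theorem lam'_sub_inv {nh : ℕ} (hn : 5 ≤ n) (hnh : nh < n) : lam' n nh - 1 / n
    = - ((((n : ℝ) - 1) * ((n : ℝ) - 4) * nh) / (2 * n * ((n : ℝ) - 2) * ((n : ℝ) - nh))) := by
  have hn' : (5 : ℝ) ≤ n := by exact_mod_cast hn
  have h2 : (n : ℝ) - 2 ≠ 0 := by linarith
  have h0 : (n : ℝ) ≠ 0 := by linarith
  have h3 : (n : ℝ) - nh ≠ 0 := by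
    have : (nh : ℝ) < n := by exact_mod_cast hnh
    linarith
  unfold lam' lam
  field_simp
  ring

theorem lam_sub_lam' {nh : ℕ} (hn : 5 ≤ n) (hnh : nh < n) : lam n - lam' n nh
    = (((n : ℝ) - 1) * ((n : ℝ) - 4)) / (2 * ((n : ℝ) - 2) * ((n : ℝ) - nh)) := by
  have hn' : (5 : ℝ) ≤ n := by exact_mod_cast hn
  have h2 : (n : ℝ) - 2 ≠ 0 := by linarith
  have h3 : (n : ℝ) - nh ≠ 0 := by
    have : (nh : ℝ) < n := by exact_mod_cast hnh
    linarith
  unfold lam' lam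
  field_simp
  ring

theorem lam_sub_lam'_pos {nh : ℕ} (hn : 5 ≤ n) (hnh : nh < n) : 0 < lam n - lam' n nh := by
  have hn' : (5 : ℝ) ≤ n := by exact_mod_cast hn
  have : (nh : ℝ) < n := by exact_mod_cast hnh
  rw [lam_sub_lam' hn hnh]
  apply div_pos <;> apply mul_pos <;> linarith

/-- The Lagrange interpolation polynomial taking the value 1 at the first eigenvalue and 0 at the
second. -/
theorem projOf_eq {nh : ℕ} (hn : 5 ≤ n) (hnh : nh < n) (H : Mat) :
    projOf nh H = (lam n - lam' n nh)⁻¹ • (H - lam' n nh • 1) := by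
  have hn' : (5 : ℝ) ≤ n := by exact_mod_cast hn
  have h2 : (n : ℝ) - 2 ≠ 0 := by linarith
  have h1 : (n : ℝ) - 1 ≠ 0 := by linarith
  have h4 : (n : ℝ) - 4 ≠ 0 := by linarith
  have h3 : (n : ℝ) - nh ≠ 0 := by
    have : (nh : ℝ) < n := by exact_mod_cast hnh
    linarith
  rw [lam_sub_lam' hn hnh, projOf, smul_sub, smul_smul, sub_eq_add_neg (_ • H), ← neg_smul]
  congr 2
  · field_simp
  · unfold lam' lam
    field_simp
    ring

theorem eq_projOf {nh : ℕ} (hn : 5 ≤ n) (hnh : nh < n) (H : Mat) :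
    H = lam n • projOf nh H + lam' n nh • (1 - projOf nh H) := by
  have h := (lam_sub_lam'_pos hn hnh).ne'
  have h1 : (lam n - lam' n nh) • projOf nh H = H - lam' n nh • 1 := by
    rw [projOf_eq hn hnh, smul_smul, mul_inv_cancel₀ h, one_smul]
  have h2 : H = (lam n - lam' n nh) • projOf nh H + lam' n nh • 1 := by rw [h1]; abel
  nth_rw 1 [h2]
  module

variable {H : Matrix (Fin n) (Fin n) ℝ} {nh : ℕ}

theorem projOf_mul_self (hn : 5 ≤ n) (hnh : nh < n)
    (hq : (H - lam n • 1) * (H - lam' n nh • 1) = 0) :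
    projOf nh H * projOf nh H = projOf nh H := by
  have h := (lam_sub_lam'_pos hn hnh).ne'
  have e : H - lam n • 1 = (H - lam' n nh • 1) - (lam n - lam' n nh) • 1 := by module
  rw [e, sub_mul, smul_mul_assoc, one_mul, sub_eq_zero] at hq
  rw [projOf_eq hn hnh, smul_mul_assoc, mul_smul_comm, hq,
    smul_smul (lam n - lam' n nh)⁻¹ (lam n - lam' n nh), inv_mul_cancel₀ h, one_smul]

/-- The rank is the trace, and the second eigenvalue was defined so that tr H = 1 gives this trace
the value `nh`. -/
theorem rank_projOf (hn : 5 ≤ n) (hnh : nh < n) (ht : H.trace = 1)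
    (hq : (H - lam n • 1) * (H - lam' n nh • 1) = 0) : (projOf nh H).rank = nh := by
  have h := trace_eq_rank_of_idem (projOf_mul_self hn hnh hq)
  have h0 := lam_sub_lam'_pos hn hnh
  have h3 : (n : ℝ) - nh ≠ 0 := by
    have : (nh : ℝ) < n := by exact_mod_cast hnh
    linarith
  have h1 : (projOf nh H).trace = nh := by
    rw [projOf_eq hn hnh, Matrix.trace_smul, Matrix.trace_sub, ht, Matrix.trace_smul,
      Matrix.trace_one, Fintype.card_fin, smul_eq_mul, smul_eq_mul]
    have e : 1 = nh * lam n + ((n : ℝ) - nh) * lam' n nh := by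
      unfold lam'
      rw [mul_div_cancel₀ _ h3]; ring
    rw [inv_mul_eq_iff_eq_mul₀ h0.ne', e]
    ring
  rw [h1] at h
  exact_mod_cast h.symm

/-- An operator of trace one with a quadratic annihilator, not a multiple of the identity, is
determined up to conjugation by the multiplicity of an eigenvalue. -/
theorem exists_multiplicity (hn : 5 ≤ n) {l' : ℝ} (ht : H.trace = 1)
    (hq : (H - lam n • 1) * (H - l' • 1) = 0) (h0 : H - (1 / (n : ℝ)) • 1 ≠ 0) :
    ∃ nh : ℕ, 0 < nh ∧ nh < n ∧ l' = lam' n nh := by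
  have hn' : (5 : ℝ) ≤ n := by exact_mod_cast hn
  have hn0 : (n : ℝ) ≠ 0 := by linarith
  -- With a double root, H - λ would be nilpotent, hence traceless, and nλ = 1 would follow.
  have hne : lam n - l' ≠ 0 := by
    intro he
    rw [sub_eq_zero] at he
    rw [← he] at hq
    have h1 : IsNilpotent (H - lam n • 1) := ⟨2, by rw [pow_two, hq]⟩
    have h2 := (Matrix.isNilpotent_trace_of_isNilpotent h1).eq_zero
    rw [Matrix.trace_sub, ht, Matrix.trace_smul, Matrix.trace_one, Fintype.card_fin,
      smul_eq_mul] at h2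
    exact mul_lam_ne_one hn (by linarith)
  set P := (lam n - l')⁻¹ • (H - l' • 1) with hP
  have hPP : P * P = P := by
    have e : H - lam n • 1 = (H - l' • 1) - (lam n - l') • 1 := by module
    rw [e, sub_mul, smul_mul_assoc, one_mul, sub_eq_zero] at hq
    rw [hP, smul_mul_assoc, mul_smul_comm, hq, smul_smul (lam n - l')⁻¹ (lam n - l'),
      inv_mul_cancel₀ hne, one_smul]
  have hH : H = (lam n - l') • P + l' • 1 := by
    rw [hP, smul_smul, mul_inv_cancel₀ hne, one_smul]; abel
  have htr : (lam n - l') * P.rank + l' * n = 1 := by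
    rw [← trace_eq_rank_of_idem hPP, ← ht, hH]
    simp [Matrix.trace_add, Matrix.trace_smul, Matrix.trace_one]
  -- Full rank would again give nλ = 1; rank zero is excluded below, since it would make H the
  -- scalar 1/n.
  have hlt : P.rank < n := by
    refine lt_of_le_of_ne (Matrix.rank_le_height P) fun he => ?_
    rw [he] at htr
    exact mul_lam_ne_one hn (by linarith)
  refine ⟨P.rank, ?_, hlt, ?_⟩
  · rw [Nat.pos_iff_ne_zero]
    intro he
    have hP0 : P = 0 := idem_trace_zero hPP (by rw [trace_eq_rank_of_idem hPP, he, Nat.cast_zero])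
    rw [he, Nat.cast_zero, mul_zero, zero_add] at htr
    apply h0
    rw [hH, hP0, smul_zero, zero_add, ← sub_smul, eq_one_div_of_mul_eq_one_left htr, sub_self,
      zero_smul]
  · have : (P.rank : ℝ) < n := by exact_mod_cast hlt
    rw [lam', eq_div_iff (by linarith)]
    linarith

/-- The traceless part of `H` is nondegenerate. -/
theorem trace_sq_pos (hn : 5 ≤ n) (h0 : 0 < nh) (hnh : nh < n)
    (ht : H.trace = 1) (hq : (H - lam n • 1) * (H - lam' n nh • 1) = 0) :
    0 < ((H - (1 / (n : ℝ)) • 1) * (H - (1 / (n : ℝ)) • 1)).trace := by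
  have hPP := projOf_mul_self hn hnh hq
  set P := projOf nh H with hP
  have hr : P.trace = nh := by rw [trace_eq_rank_of_idem hPP, rank_projOf hn hnh ht hq]
  have hH : H = lam n • P + lam' n nh • (1 - P) := eq_projOf hn hnh H
  have e : (H - (1 / (n : ℝ)) • 1) * (H - (1 / (n : ℝ)) • 1)
      = (lam n - 1 / n) ^ 2 • P + (lam' n nh - 1 / n) ^ 2 • (1 - P) := by
    have e1 : H - (1 / (n : ℝ)) • 1 = (lam n - 1 / n) • P + (lam' n nh - 1 / n) • (1 - P) := by
      nth_rw 1 [hH]; module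
    rw [e1]
    simp only [add_mul, mul_add, smul_mul_assoc, mul_smul_comm, mul_sub, sub_mul, one_mul, mul_one,
      hPP]
    module
  rw [e, Matrix.trace_add, Matrix.trace_smul, Matrix.trace_smul, Matrix.trace_sub,
    Matrix.trace_one, hr, Fintype.card_fin, smul_eq_mul, smul_eq_mul]
  have h1 : (0 : ℝ) < nh := by exact_mod_cast h0
  have h2 : (nh : ℝ) < n := by exact_mod_cast hnh
  have h3 : lam n - 1 / n ≠ 0 := by
    intro h
    apply mul_lam_ne_one hn
    rw [sub_eq_zero.1 h]
    exact mul_one_div_cancel (by linarith)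
  have := mul_pos (pow_pos (abs_pos.2 h3) 2) h1
  rw [sq_abs] at this
  have := mul_nonneg (sq_nonneg (lam' n nh - 1 / n)) (sub_nonneg.2 h2.le)
  linarith

/-- If `(n S + tr S) H₀ - tr (S H₀)` is a multiple of `H₀`, then `S` is a linear combination of
`H₀` and the identity. -/
theorem exists_smul_add_of_kOp (hn : 5 ≤ n) (h0 : 0 < nh) (hnh : nh < n)
    (hq : (H - lam n • 1) * (H - lam' n nh • 1) = 0) {S : Mat} {t t' s : ℝ}
    (hK : ((n : ℝ) • S + t • 1) * (H - (1 / (n : ℝ)) • 1) - t' • 1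
      = s • (H - (1 / (n : ℝ)) • 1)) :
    ∃ p q : ℝ, S = p • (H - (1 / (n : ℝ)) • 1) + q • 1 := by
  have hn' : (5 : ℝ) ≤ n := by exact_mod_cast hn
  have hn0 : (n : ℝ) ≠ 0 := by linarith
  have h1 : (0 : ℝ) < nh := by exact_mod_cast h0
  have h2 : (nh : ℝ) < n := by exact_mod_cast hnh
  set T := H - (1 / (n : ℝ)) • 1 with hT
  set a := lam n - 1 / n with ha
  set b := lam' n nh - 1 / n with hb
  -- The two eigenvalues a and b of the traceless part are nonzero, because n > 4 and `nh` > 0. So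
  -- this relation inverts T, and multiplying `hK` by T - (a + b) isolates S.
  have hTab : T * (T - (a + b) • 1) = -(a * b) • 1 := by
    have e1 : H - lam n • 1 = T - a • 1 := by rw [hT, ha]; module
    have e2 : H - lam' n nh • 1 = T - b • 1 := by rw [hT, hb]; module
    rw [e1, e2] at hq
    simp only [sub_mul, mul_sub, smul_mul_assoc, mul_smul_comm, one_mul, mul_one] at hq
    rw [← sub_eq_zero, ← hq]
    simp only [mul_sub, mul_smul_comm, mul_one]
    module
  have hab : a * b ≠ 0 := by
    rw [ha, hb, lam_sub_inv hn, lam'_sub_inv hn hnh]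
    apply mul_ne_zero
    · apply div_ne_zero <;> apply ne_of_gt <;> repeat' apply mul_pos
      all_goals linarith
    · apply neg_ne_zero.2
      apply div_ne_zero <;> apply ne_of_gt <;> repeat' apply mul_pos
      all_goals linarith
  have h3 := congrArg (fun X => X * (T - (a + b) • 1)) hK
  simp only [sub_mul _ _ (T - (a + b) • 1), mul_assoc, hTab, smul_mul_assoc, one_mul, mul_smul_comm,
    mul_one] at h3
  refine ⟨- t' / (n * (a * b)), s / n - t / n + t' * (a + b) / (n * (a * b)), ?_⟩
  have h4 : (n * (a * b)) • S = (n * (a * b)) • ((- t' / (n * (a * b))) • T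
      + (s / n - t / n + t' * (a + b) / (n * (a * b))) • 1) := by
    rw [← sub_eq_zero] at h3
    have h5 : (n * (a * b)) • ((- t' / (n * (a * b))) • T
      + (s / n - t / n + t' * (a + b) / (n * (a * b))) • 1) = (- t') • T
        + ((a * b) * (s - t) + t' * (a + b)) • (1 : Mat) := by
      rw [smul_add, smul_smul, smul_smul]
      obtain ⟨ha0, hb0⟩ := mul_ne_zero_iff.1 hab
      congr 2
      · field_simp
      · field_simp
    rw [h5, ← sub_eq_zero, ← neg_eq_zero, ← h3]
    module
  exact smul_right_injective _ (mul_ne_zero hn0 hab) h4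

end TwoEigenvalues
end ConfRec
end

noncomputable section
namespace ConfRec

/-! ### Grycak's relation and the Ricci spectrum in one chart. -/

section Pointwise

variable {n : ℕ}

local notation "Mat" => Matrix (Fin n) (Fin n) ℝ

variable {U : Set (E n)} {g : E n → Matrix (Fin n) (Fin n) ℝ} {x : E n} {α : Fin n → E n → ℝ}

/-- The scalar `G` of the relation `Ric - (R/n) g = G (h - g/n)`. -/
def grycak (g : E n → Matrix (Fin n) (Fin n) ℝ) (x : E n) : ℝ :=
  (ricciOp g x * hTl g x).trace / (hTl g x * hTl g x).trace

theorem proj_eq_projOf (nh : ℕ) : proj nh g x = projOf nh (hOp g x) := rfl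

namespace LocalRecurrent

variable (h : LocalRecurrent U g α) {nh : ℕ} (h0 : 0 < nh) (hnh : nh < n)
  (hq : ∀ y ∈ U, (hOp g y - lam n • 1) * (hOp g y - lam' n nh • 1) = 0)
  (hk : ∀ y ∈ U, kPerp g y = 0)
include h

theorem smooth_proj : MSm U (proj nh g) :=
  (MSm.smul contDiffOn_const h.smooth_hOp).add (MSm.const _)

theorem nab_proj (hx : x ∈ U) (i : Fin n) : nab g i (proj nh g) x = 0 := by
  have e : ∀ c : ℝ, nab g i (fun _ => c • (1 : Mat)) x = 0 := by
    intro c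
    unfold nab
    rw [mpd_const, mul_smul_comm, smul_mul_assoc, mul_one, one_mul, sub_self, add_zero]
  unfold proj
  rw [h.nab_add hx (MSm.smul contDiffOn_const h.smooth_hOp) (MSm.const _), e,
    h.nab_smul hx contDiffOn_const h.smooth_hOp, h.nab_hOp hx, pd_const, zero_smul, smul_zero,
    add_zero, add_zero]

include hnh

theorem proj_mulVec_recur (hx : x ∈ U) :
    (proj nh g x).mulVec ((g x)⁻¹.mulVec fun i => α i x) = (g x)⁻¹.mulVec fun i => α i x := by
  rw [proj_eq_projOf, projOf_eq h.dim hnh, Matrix.smul_mulVec, Matrix.sub_mulVec,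
    h.hOp_mulVec_recur hx, Matrix.smul_mulVec, Matrix.one_mulVec, ← sub_smul, smul_smul,
    inv_mul_cancel₀ (lam_sub_lam'_pos h.dim hnh).ne', one_smul]

include hq

theorem proj_mul_self (hx : x ∈ U) : proj nh g x * proj nh g x = proj nh g x :=
  projOf_mul_self h.dim hnh (hq x hx)

theorem rank_proj (hx : x ∈ U) : (proj nh g x).rank = nh :=
  rank_projOf h.dim hnh (h.trace_hOp hx) (hq x hx)

theorem range_proj (hx : x ∈ U) : (Matrix.toLin' (proj nh g x)).range
    = Module.End.eigenspace (Matrix.toLin' (hOp g x)) (lam n) :=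
  (eigenspace_eq_range (projOf_mul_self h.dim hnh (hq x hx)) (eq_projOf h.dim hnh (hOp g x))
    (sub_ne_zero.1 (lam_sub_lam'_pos h.dim hnh).ne')).symm

theorem finrank_eigenspace (hx : x ∈ U) :
    Module.finrank ℝ (Module.End.eigenspace (Matrix.toLin' (hOp g x)) (lam n)) = nh := by
  rw [← h.range_proj hnh hq hx, Matrix.toLin'_apply', ← Matrix.rank, h.rank_proj hnh hq hx]

include h0

theorem trace_hTl_sq_ne_zero (hx : x ∈ U) : (hTl g x * hTl g x).trace ≠ 0 :=
  (trace_sq_pos h.dim h0 hnh (h.trace_hOp hx) (hq x hx)).ne'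

theorem smooth_grycak : Sm U (grycak g) :=
  (h.smooth_ricciOp.mul h.smooth_hTl).trace.div (h.smooth_hTl.mul h.smooth_hTl).trace
    fun _ hx => h.trace_hTl_sq_ne_zero h0 hnh hq hx

include hk

/-- Vanishing of `kPerp` makes K a multiple of h₀, so `exists_smul_add_of_kOp` gives S, and with it
the Ricci operator, as a combination of h₀ and the identity. Traces, alone and against h₀, identify
the coefficients as R/n and G. -/
theorem ricciOp_eq (hx : x ∈ U) :
    ricciOp g x = (scal g x / n) • 1 + grycak g x • hTl g x := by
  have hn' : (5 : ℝ) ≤ n := by exact_mod_cast h.dim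
  have hn0 : (n : ℝ) ≠ 0 := by linarith
  have hn2 : (n : ℝ) - 2 ≠ 0 := by linarith
  have hT := h.trace_hTl_sq_ne_zero h0 hnh hq hx
  have hK : kOp g x = ((kOp g x * hTl g x).trace / (hTl g x * hTl g x).trace) • hTl g x := by
    have h1 := hk x hx
    rw [kPerp, sub_eq_zero] at h1
    rw [div_eq_inv_mul, mul_smul, ← h1, smul_smul, inv_mul_cancel₀ hT, one_smul]
  obtain ⟨p, q, hS⟩ := exists_smul_add_of_kOp h.dim h0 hnh (hq x hx) hK
  rw [← hTl] at hS
  obtain ⟨p', q', hR⟩ : ∃ p' q' : ℝ, ricciOp g x = p' • hTl g x + q' • 1 := by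
    refine ⟨((n : ℝ) - 2) * p, ((n : ℝ) - 2)
      * (q + scal g x / (2 * ((n : ℝ) - 1) * ((n : ℝ) - 2))), ?_⟩
    have h1 : ricciOp g x = ((n : ℝ) - 2) • (schouten g x
        + (scal g x / (2 * ((n : ℝ) - 1) * ((n : ℝ) - 2))) • 1) := by
      rw [schouten, neg_smul, neg_add_cancel_right, smul_smul, mul_one_div_cancel hn2, one_smul]
    rw [h1, hS]
    module
  have hq' : scal g x / n = q' := by
    rw [h.scal_eq hx, hR, Matrix.trace_add, Matrix.trace_smul, h.trace_hTl hx, Matrix.trace_smul,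
      Matrix.trace_one, Fintype.card_fin, smul_zero, zero_add, smul_eq_mul,
      mul_div_cancel_right₀ _ hn0]
  have hp' : grycak g x = p' := by
    rw [grycak, hR, add_mul, smul_mul_assoc, smul_mul_assoc, one_mul, Matrix.trace_add,
      Matrix.trace_smul, Matrix.trace_smul, h.trace_hTl hx, smul_zero, add_zero, smul_eq_mul,
      mul_div_cancel_right₀ _ hT]
  rw [hq', hp', hR, add_comm]

theorem ricciOp_eq_proj (hx : x ∈ U) : ricciOp g x
    = mu n (scal g x) (grycak g x) • proj nh g x
      + mu' n nh (scal g x) (grycak g x) • (1 - proj nh g x) := by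
  have e := eq_projOf h.dim hnh (hOp g x)
  rw [h.ricciOp_eq h0 hnh hq hk hx, mu, mu', ← lam_sub_inv h.dim, hTl, proj_eq_projOf,
    sub_eq_add_neg (scal g x / n), ← mul_neg, ← lam'_sub_inv h.dim hnh]
  nth_rw 1 [e]
  module

theorem ricci_sub_eq (hx : x ∈ U) : ricci g x - (scal g x / n) • g x
    = grycak g x • (hTensor g x - (1 / (n : ℝ)) • g x) := by
  rw [← h.mul_ricciOp hx, ← h.mul_hOp hx, h.ricciOp_eq h0 hnh hq hk hx, hTl]
  simp only [mul_add, mul_sub, mul_smul_comm, mul_one]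
  module

theorem hasEigenvalue_ricciOp_iff (hx : x ∈ U) (ν : ℝ) :
    Module.End.HasEigenvalue (Matrix.toLin' (ricciOp g x)) ν ↔
      ν = mu n (scal g x) (grycak g x) ∨ ν = mu' n nh (scal g x) (grycak g x) := by
  have hr := h.rank_proj hnh hq hx
  refine hasEigenvalue_iff_of_idem (h.proj_mul_self hnh hq hx)
    (h.ricciOp_eq_proj h0 hnh hq hk hx) (fun h1 => ?_) (fun h1 => ?_) ν
  · rw [h1, Matrix.rank_zero] at hr
    omega
  · rw [h1, Matrix.rank_one, Fintype.card_fin] at hr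
    omega

theorem charpoly_ricciOp (hx : x ∈ U) : (ricciOp g x).charpoly
    = (Polynomial.X - Polynomial.C (mu n (scal g x) (grycak g x))) ^ nh
      * (Polynomial.X - Polynomial.C (mu' n nh (scal g x) (grycak g x))) ^ (n - nh) := by
  have e := charpoly_two_eigenvalues (h.proj_mul_self hnh hq hx)
    (mu n (scal g x) (grycak g x)) (mu' n nh (scal g x) (grycak g x))
  rw [← h.ricciOp_eq_proj h0 hnh hq hk hx, h.rank_proj hnh hq hx] at e
  exact e

theorem scal_eq_mu (hx : x ∈ U) : scal g x = nh * mu n (scal g x) (grycak g x)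
    + ((n : ℝ) - nh) * mu' n nh (scal g x) (grycak g x) := by
  have ht : (proj nh g x).trace = nh := by
    rw [trace_eq_rank_of_idem (h.proj_mul_self hnh hq hx), h.rank_proj hnh hq hx]
  nth_rw 1 [h.scal_eq hx, h.ricciOp_eq_proj h0 hnh hq hk hx]
  rw [Matrix.trace_add, Matrix.trace_smul, Matrix.trace_smul, Matrix.trace_sub, Matrix.trace_one,
    ht, Fintype.card_fin, smul_eq_mul, smul_eq_mul]
  ring

theorem ricciOp_mulVec_recur (hx : x ∈ U) :
    (ricciOp g x).mulVec ((g x)⁻¹.mulVec fun i => α i x)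
      = mu n (scal g x) (grycak g x) • (g x)⁻¹.mulVec fun i => α i x := by
  rw [h.ricciOp_eq_proj h0 hnh hq hk hx, Matrix.add_mulVec, Matrix.smul_mulVec, Matrix.smul_mulVec,
    Matrix.sub_mulVec, h.proj_mulVec_recur hnh hx, Matrix.one_mulVec, sub_self, smul_zero,
    add_zero]

end LocalRecurrent

end Pointwise
end ConfRec
end

noncomputable section
namespace ConfRec

/-! ### Behaviour of the algebraic constructions under a Jacobian matrix. -/

section PullbackAlgebra

variable {n : ℕ}

local notation "Mat" => Matrix (Fin n) (Fin n) ℝ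

/-- The transformation of a family of operators with two covariant indices under a change of
coordinates with Jacobian matrix `J`. -/
def pull (J : Matrix (Fin n) (Fin n) ℝ) (R : Fin n → Fin n → Matrix (Fin n) (Fin n) ℝ)
    (j k : Fin n) : Matrix (Fin n) (Fin n) ℝ :=
  J⁻¹ * (∑ a, ∑ b, (J a j * J b k) • R a b) * J

variable {J G T : Matrix (Fin n) (Fin n) ℝ} {R : Fin n → Fin n → Matrix (Fin n) (Fin n) ℝ}

theorem pull_add (R R' : Fin n → Fin n → Mat) (j k : Fin n) :
    pull J (fun a b => R a b + R' a b) j k = pull J R j k + pull J R' j k := by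
  simp only [pull, smul_add, Finset.sum_add_distrib, mul_add, add_mul]

theorem pull_neg (R : Fin n → Fin n → Mat) (j k : Fin n) :
    pull J (fun a b => - R a b) j k = - pull J R j k := by
  simp only [pull, smul_neg, Finset.sum_neg_distrib, mul_neg, neg_mul]

theorem pull_sub (R R' : Fin n → Fin n → Mat) (j k : Fin n) :
    pull J (fun a b => R a b - R' a b) j k = pull J R j k - pull J R' j k := by
  simp only [sub_eq_add_neg, pull_add, pull_neg]

theorem pull_flip (R : Fin n → Fin n → Mat) (j k : Fin n) :
    pull J (fun a b => R b a) j k = pull J R k j := by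
  simp only [pull]
  rw [Finset.sum_comm]
  simp only [mul_comm]

theorem pull_tens (A B : Mat) (j k : Fin n) :
    pull J (tens A B) j k = tens (J⁻¹ * A * J) (J.transpose * B * J) j k := by
  have e : ∑ a, ∑ b, (J a j * J b k) • tens A B a b = tens (A * J) (J.transpose * B) j k := by
    ext m l
    simp only [Matrix.sum_apply, Matrix.smul_apply, tens, Matrix.of_apply, smul_eq_mul,
      Matrix.mul_apply, Matrix.transpose_apply, Finset.sum_mul_sum]
    exact Finset.sum_congr rfl fun a _ => Finset.sum_congr rfl fun b _ => by ring
  rw [pull, e, mul_tens, tens_mul, ← mul_assoc]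

theorem pull_kn (hJ : IsUnit J.det) (j k : Fin n) :
    pull J (kn G T) j k = kn (J.transpose * G * J) (J⁻¹ * T * J) j k := by
  have h1 : J * J⁻¹ = 1 := Matrix.mul_nonsing_inv _ hJ
  have h2 : J⁻¹ * J = 1 := Matrix.nonsing_inv_mul _ hJ
  have e : kn G T = fun a b => (tens 1 (G * T) a b - tens 1 (G * T) b a)
      + (tens T G a b - tens T G b a) := rfl
  have e2 : J.transpose * G * J * (J⁻¹ * T * J) = J.transpose * (G * T) * J := by
    rw [mul_assoc _ J, ← mul_assoc J, ← mul_assoc J, h1, one_mul]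
    noncomm_ring
  rw [e, pull_add, pull_sub, pull_sub, pull_flip (tens 1 (G * T)), pull_flip (tens T G)]
  simp only [pull_tens, kn, mul_one, h2, e2]

theorem ric_pull (hJ : IsUnit J.det) : ric (pull J R) = J.transpose * ric R * J := by
  have h1 : J * J⁻¹ = 1 := Matrix.mul_nonsing_inv _ hJ
  ext k l
  have e : ∀ m, pull J R m k m l = ∑ a, J a m * ((J⁻¹ * (∑ b, J b k • R a b) * J) m l) := by
    intro m
    have : ∑ a, ∑ b, (J a m * J b k) • R a b = ∑ a, J a m • ∑ b, J b k • R a b := by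
      simp only [Finset.smul_sum, smul_smul]
    rw [pull, this, Finset.mul_sum, Finset.sum_mul, Matrix.sum_apply]
    exact Finset.sum_congr rfl fun a _ => by
      rw [mul_smul_comm, smul_mul_assoc, Matrix.smul_apply, smul_eq_mul]
  have e2 : ∀ a, ∑ m, J a m * ((J⁻¹ * (∑ b, J b k • R a b) * J) m l)
      = ((∑ b, J b k • R a b) * J) a l := by
    intro a
    rw [← Matrix.mul_apply, ← mul_assoc, ← mul_assoc, h1, one_mul]
  have e3 : ric (pull J R) k l = ∑ a, ((∑ b, J b k • R a b) * J) a l := by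
    rw [ric, Matrix.of_apply, Finset.sum_congr rfl fun m _ => e m, Finset.sum_comm]
    exact Finset.sum_congr rfl fun a _ => e2 a
  rw [e3]
  simp only [Matrix.mul_apply, Matrix.sum_apply, Matrix.smul_apply, Matrix.transpose_apply,
    smul_eq_mul, ric, Matrix.of_apply]
  rw [Finset.sum_comm]
  refine Finset.sum_congr rfl fun q _ => ?_
  rw [← Finset.sum_mul, Finset.sum_comm]
  simp only [Finset.mul_sum]

/-- The conjugation by J disappears under the trace, so only the transformation of the form indices
is seen. -/
theorem trace_pull_mul (hJ : IsUnit J.det) (R R' : Fin n → Fin n → Mat) (i a j k : Fin n) :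
    (pull J R i a * pull J R' j k).trace
      = ∑ p, ∑ q, J p i * J q j * (J.transpose * (Matrix.of fun b c => (R p b * R' q c).trace)
        * J) a k := by
  have h1 : J * J⁻¹ = 1 := Matrix.mul_nonsing_inv _ hJ
  have e : (pull J R i a * pull J R' j k).trace
      = ((∑ p, ∑ b, (J p i * J b a) • R p b) * (∑ q, ∑ c, (J q j * J c k) • R' q c)).trace := by
    set X := ∑ p, ∑ b, (J p i * J b a) • R p b
    set Y := ∑ q, ∑ c, (J q j * J c k) • R' q c
    have : pull J R i a * pull J R' j k = J⁻¹ * (X * Y * J) := by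
      rw [pull, pull, mul_assoc _ J, ← mul_assoc J, ← mul_assoc J, h1, one_mul]
      noncomm_ring
    rw [this, Matrix.trace_mul_comm, mul_assoc, h1, mul_one]
  rw [e]
  simp only [Finset.sum_mul, Finset.mul_sum, smul_mul_assoc, mul_smul_comm, Matrix.trace_sum,
    Matrix.trace_smul, smul_eq_mul, Matrix.mul_apply, Matrix.transpose_apply, Matrix.of_apply]
  refine ((Finset.sum_congr rfl fun q _ => Finset.sum_comm).trans Finset.sum_comm).trans ?_
  exact Finset.sum_congr rfl fun p _ => Finset.sum_congr rfl fun q _ => Finset.sum_congr rfl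
    fun c _ => Finset.sum_congr rfl fun b _ => by ring

end PullbackAlgebra

/-! ### Coordinate invariance of curvature, h, K and G. -/

section CoordinateChange

variable {n : ℕ}

local notation "Mat" => Matrix (Fin n) (Fin n) ℝ

/-- The Jacobian matrix of `F`. -/
def jac (F : E n → E n) (x : E n) : Matrix (Fin n) (Fin n) ℝ :=
  Matrix.of fun a i => pd i (fun y => F y a) x

/-- The map `F` is a local isometry from the metric `g` on `U` to the metric `g'` on `V`. -/
structure LocalIsometry (U V : Set (E n)) (F : E n → E n) (g g' : E n → Matrix (Fin n) (Fin n) ℝ) :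
    Prop where
  source : LocalMetric U g
  target : LocalMetric V g'
  mapsTo : Set.MapsTo F U V
  smooth : ContDiffOn ℝ ∞ F U
  metric : ∀ x ∈ U, g x = (jac F x).transpose * g' (F x) * jac F x

namespace LocalIsometry

variable {U V : Set (E n)} {F : E n → E n} {g g' : E n → Matrix (Fin n) (Fin n) ℝ} {x : E n}
  (h : LocalIsometry U V F g g')
include h

theorem smooth_apply (a : Fin n) : Sm U (fun y => F y a) :=
  (EuclideanSpace.proj a : E n →L[ℝ] ℝ).contDiff.comp_contDiffOn h.smooth

theorem smooth_jac : MSm U (jac F) := fun a i => (h.smooth_apply a).pd h.source.isOpen i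

theorem smooth_comp {A : E n → Mat} (hA : MSm V A) : MSm U (fun y => A (F y)) :=
  fun k l => (hA k l).comp h.smooth h.mapsTo

/-- The determinant of the pulled back metric has det J as a factor, and it is a unit. -/
theorem unit_jac (hx : x ∈ U) : IsUnit (jac F x).det := by
  have h1 := h.source.unit x hx
  rw [h.metric x hx, Matrix.det_mul] at h1
  exact isUnit_of_mul_isUnit_right h1

theorem mul_inv (hx : x ∈ U) : jac F x * (jac F x)⁻¹ = 1 :=
  Matrix.mul_nonsing_inv _ (h.unit_jac hx)

theorem inv_mul (hx : x ∈ U) : (jac F x)⁻¹ * jac F x = 1 :=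
  Matrix.nonsing_inv_mul _ (h.unit_jac hx)

theorem pd_comp {f : E n → ℝ} (hf : Sm V f) (hx : x ∈ U) (i : Fin n) :
    pd i (fun y => f (F y)) x = ∑ a, jac F x a i * pd a f (F x) := by
  have h1 : DifferentiableAt ℝ F x :=
    (h.smooth.contDiffAt (h.source.isOpen.mem_nhds hx)).differentiableAt (by simp)
  have h2 := hf.diffAt h.target.isOpen (h.mapsTo hx)
  have h3 : pd i (fun y => f (F y)) x
      = fderiv ℝ f (F x) (fderiv ℝ F x (EuclideanSpace.single i 1)) := by
    rw [pd, show (fun y => f (F y)) = f ∘ F from rfl, fderiv_comp x h2 h1]; rfl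
  rw [h3, fderiv_apply_eq_sum]
  refine Finset.sum_congr rfl fun a _ => ?_
  congr 1
  have h4 := ((EuclideanSpace.proj a : E n →L[ℝ] ℝ).hasFDerivAt.comp x
    h1.hasFDerivAt).fderiv
  rw [jac, Matrix.of_apply, pd, show (fun y => F y a)
    = (EuclideanSpace.proj a : E n →L[ℝ] ℝ) ∘ F from rfl, h4]
  rfl

theorem mpd_comp {A : E n → Mat} (hA : MSm V A) (hx : x ∈ U) (i : Fin n) :
    mpd i (fun y => A (F y)) x = ∑ a, jac F x a i • mpd a A (F x) := by
  ext k l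
  rw [mpd_apply, h.pd_comp (hA k l) hx, Matrix.sum_apply]
  rfl

theorem pd_jac_comm (hx : x ∈ U) (i j a : Fin n) :
    pd i (fun y => jac F y a j) x = pd j (fun y => jac F y a i) x :=
  pd_comm h.source.isOpen (h.smooth_apply a) hx i j

theorem mpd_jac_comm (hx : x ∈ U) (i j : Fin n) :
    mpd i (mpd j (jac F)) x = mpd j (mpd i (jac F)) x :=
  mpd_comm h.source.isOpen hx i h.smooth_jac j

/-- The transformation law of the Christoffel symbols. -/
theorem jac_mul_gam (hx : x ∈ U) (i : Fin n) :
    jac F x * gam g i x = (∑ a, jac F x a i • gam g' a (F x)) * jac F x + mpd i (jac F) x := by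
  set J := jac F x with hJ
  set A : Fin n → Mat := fun i => ∑ a, J a i • gam g' a (F x) with hA
  have hJK : J * J⁻¹ = 1 := h.mul_inv hx
  have hKJ : (J⁻¹).transpose * J.transpose = 1 := by
    rw [← Matrix.transpose_mul, hJK, Matrix.transpose_one]
  -- The transformed matrices are symmetric in the lower indices and make the metric parallel, so
  -- uniqueness of the Levi-Civita connection avoids any computation with Christoffel symbols.
  have e := h.source.gam_unique hx (fun i => J⁻¹ * (A i * J + mpd i (jac F) x)) (fun m i k => by
      have e1 : (A i * J + mpd i (jac F) x).col k = (A k * J + mpd k (jac F) x).col i := by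
        ext p
        simp only [Matrix.col_apply, Matrix.add_apply, mpd_apply, h.pd_jac_comm hx i k p]
        congr 1
        simp only [hA, Finset.sum_mul, Matrix.sum_apply, Matrix.smul_apply,
          Matrix.mul_apply, smul_eq_mul]
        rw [Finset.sum_comm]
        exact Finset.sum_congr rfl fun a _ => Finset.sum_congr rfl fun b _ => by
          rw [h.target.gam_symm (h.mapsTo hx) p b a]; ring
      rw [Matrix.mul_apply, Matrix.mul_apply]
      exact Finset.sum_congr rfl fun p _ => congrArg _ (congrFun e1 p))
    (fun i => by
      have e2 : ∑ a, J a i • mpd a g' (F x)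
          = (A i).transpose * g' (F x) + g' (F x) * A i := by
        simp only [hA, h.target.mpd_metric (h.mapsTo hx), Matrix.transpose_sum,
          Matrix.transpose_smul, Finset.sum_mul, Finset.mul_sum, smul_mul_assoc, mul_smul_comm,
          smul_add, Finset.sum_add_distrib]
      rw [mpd_congr h.source.isOpen h.metric hx,
        mpd_mul h.source.isOpen hx _ (h.smooth_jac.transpose.mul (h.smooth_comp h.target.smooth))
          h.smooth_jac,
        mpd_mul h.source.isOpen hx _ h.smooth_jac.transpose (h.smooth_comp h.target.smooth),
        mpd_transpose, h.mpd_comp h.target.smooth hx, e2, h.metric x hx, ← hJ]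
      simp only [Matrix.transpose_mul, Matrix.transpose_add]
      have e3 : J.transpose * g' (F x) * J * (J⁻¹ * (A i * J + mpd i (jac F) x))
          = J.transpose * g' (F x) * (A i * J + mpd i (jac F) x) := by
        rw [mul_assoc _ J, ← mul_assoc J, hJK, one_mul]
      have e4 : (J.transpose * (A i).transpose + (mpd i (jac F) x).transpose) * (J⁻¹).transpose
          * (J.transpose * g' (F x) * J)
          = (J.transpose * (A i).transpose + (mpd i (jac F) x).transpose) * (g' (F x) * J) := by
        rw [mul_assoc _ (J⁻¹).transpose, mul_assoc J.transpose, ← mul_assoc (J⁻¹).transpose, hKJ,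
          one_mul]
      rw [e3, e4]
      noncomm_ring) i
  rw [e, ← mul_assoc, hJK, one_mul]

/-- The transformation law of the curvature. -/
theorem curv_eq (hx : x ∈ U) (i j : Fin n) :
    curv g i j x = pull (jac F x) (fun a b => curv g' a b (F x)) i j := by
  have hU := h.source.isOpen
  have sJ := h.smooth_jac
  have sA : ∀ i, MSm U (fun y => ∑ a, jac F y a i • gam g' a (F y)) := fun i =>
    MSm.sum fun a _ => MSm.smul (sJ a i) (h.smooth_comp (h.target.smooth_gam a))
  -- The transformation law of Γ, differentiated. In the skew part in i and j the second derivatives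
  -- of the Jacobian matrix cancel, and the curvature transforms as a tensor.
  have key : ∀ i j, mpd j (jac F) x * gam g i x + jac F x * mpd j (gam g i) x
      = mpd j (fun y => ∑ a, jac F y a i • gam g' a (F y)) x * jac F x
        + (∑ a, jac F x a i • gam g' a (F x)) * mpd j (jac F) x + mpd j (mpd i (jac F)) x := by
    intro i j
    rw [← mpd_mul hU hx _ sJ (h.source.smooth_gam i), ← mpd_mul hU hx _ (sA i) sJ,
      ← mpd_add hU hx _ ((sA i).mul sJ) (sJ.mpd hU i)]
    exact mpd_congr hU (fun y hy => h.jac_mul_gam hy i) hx j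
  have dA : ∀ i j, mpd j (fun y => ∑ a, jac F y a i • gam g' a (F y)) x
      = ∑ a, pd j (fun y => jac F y a i) x • gam g' a (F x)
        + ∑ a, ∑ b, (jac F x a i * jac F x b j) • mpd b (gam g' a) (F x) := by
    intro i j
    rw [mpd_sum hU hx j (fun a _ => MSm.smul (sJ a i) (h.smooth_comp (h.target.smooth_gam a))),
      ← Finset.sum_add_distrib]
    refine Finset.sum_congr rfl fun a _ => ?_
    rw [mpd_smul hU hx j (sJ a i) (h.smooth_comp (h.target.smooth_gam a)),
      h.mpd_comp (h.target.smooth_gam a) hx, Finset.smul_sum]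
    simp only [smul_smul]
  set J := jac F x with hJ
  set A : Fin n → Mat := fun i => ∑ a, J a i • gam g' a (F x) with hA
  have hC : ∑ a, ∑ b, (J a i * J b j) • curv g' a b (F x)
      = (mpd i (fun y => ∑ a, jac F y a j • gam g' a (F y)) x
        - mpd j (fun y => ∑ a, jac F y a i • gam g' a (F y)) x) + (A i * A j - A j * A i) := by
    have e1 : ∀ i j, A i * A j = ∑ a, ∑ b, (J a i * J b j) • (gam g' a (F x) * gam g' b (F x)) := by
      intro i j
      simp only [hA, Finset.sum_mul_sum, smul_mul_assoc, mul_smul_comm, smul_smul]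
      simp only [mul_comm]
    have e2 : A j * A i
        = ∑ a, ∑ b, (J a i * J b j) • (gam g' b (F x) * gam g' a (F x)) := by
      rw [e1, Finset.sum_comm]; simp only [mul_comm (J _ j)]
    have e3 : ∑ a, ∑ b, (J a j * J b i) • mpd b (gam g' a) (F x)
        = ∑ a, ∑ b, (J a i * J b j) • mpd a (gam g' b) (F x) := by
      rw [Finset.sum_comm]; simp only [mul_comm (J _ j)]
    have e4 : ∑ a, pd i (fun y => jac F y a j) x • gam g' a (F x)
        = ∑ a, pd j (fun y => jac F y a i) x • gam g' a (F x) :=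
      Finset.sum_congr rfl fun a _ => by rw [h.pd_jac_comm hx]
    rw [dA, dA, e3, e4, e1 i j, e2]
    simp only [curv, smul_add, smul_sub, Finset.sum_add_distrib, Finset.sum_sub_distrib]
    abel
  have gi := h.jac_mul_gam hx i
  have gj := h.jac_mul_gam hx j
  rw [← hJ] at gi gj
  change J * gam g i x = A i * J + mpd i (jac F) x at gi
  change J * gam g j x = A j * J + mpd j (jac F) x at gj
  have hcm := h.mpd_jac_comm hx i j
  have ki := key j i
  have kj := key i j
  set Di := mpd i (jac F) x
  set Dj := mpd j (jac F) x
  have k1 : J * mpd i (gam g j) x = mpd i (fun y => ∑ a, jac F y a j • gam g' a (F y)) x * J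
      + A j * Di + mpd i (mpd j (jac F)) x - Di * gam g j x := by
    rw [← ki]; abel
  have k2 : J * mpd j (gam g i) x = mpd j (fun y => ∑ a, jac F y a i • gam g' a (F y)) x * J
      + A i * Dj + mpd j (mpd i (jac F)) x - Dj * gam g i x := by
    rw [← kj]; abel
  have main : J * curv g i j x = (∑ a, ∑ b, (J a i * J b j) • curv g' a b (F x)) * J := by
    rw [hC, curv, mul_add, mul_sub, mul_sub, k1, k2, hcm, ← mul_assoc J, ← mul_assoc J, gi, gj]
    have e5 : A i * Dj = A i * (J * gam g j x) - A i * (A j * J) := by rw [gj]; noncomm_ring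
    have e6 : A j * Di = A j * (J * gam g i x) - A j * (A i * J) := by rw [gi]; noncomm_ring
    rw [e5, e6]
    noncomm_ring
  rw [pull, mul_assoc, ← main, ← mul_assoc, hJ, h.inv_mul hx, one_mul]

theorem metric_inv (hx : x ∈ U) :
    (g x)⁻¹ = (jac F x)⁻¹ * (g' (F x))⁻¹ * (jac F x)⁻¹.transpose := by
  rw [h.metric x hx, Matrix.mul_inv_rev, Matrix.mul_inv_rev, Matrix.transpose_nonsing_inv,
    mul_assoc]

theorem raise_eq (hx : x ∈ U) {A A' : Mat}
    (hA : A = (jac F x).transpose * A' * jac F x) :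
    (g x)⁻¹ * A = (jac F x)⁻¹ * ((g' (F x))⁻¹ * A') * jac F x := by
  have h1 : (jac F x)⁻¹.transpose * (jac F x).transpose = 1 := by
    rw [← Matrix.transpose_mul, h.mul_inv hx, Matrix.transpose_one]
  rw [h.metric_inv hx, hA, mul_assoc _ (jac F x)⁻¹.transpose, mul_assoc (jac F x).transpose,
    ← mul_assoc (jac F x)⁻¹.transpose, h1, one_mul]
  noncomm_ring

theorem trace_conj (hx : x ∈ U) (A : Mat) : ((jac F x)⁻¹ * A * jac F x).trace = A.trace := by
  rw [mul_assoc, Matrix.trace_mul_comm, mul_assoc, h.mul_inv hx, mul_one]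

theorem conj_mul (hx : x ∈ U) (A B : Mat) : (jac F x)⁻¹ * A * jac F x
    * ((jac F x)⁻¹ * B * jac F x) = (jac F x)⁻¹ * (A * B) * jac F x := by
  rw [mul_assoc _ (jac F x), ← mul_assoc (jac F x), ← mul_assoc (jac F x), h.mul_inv hx, one_mul]
  noncomm_ring

theorem conj_smul_one (hx : x ∈ U) (c : ℝ) :
    (jac F x)⁻¹ * (c • 1) * jac F x = c • 1 := by
  rw [mul_smul_comm, mul_one, smul_mul_assoc, h.inv_mul hx]

theorem ricciOp_eq (hx : x ∈ U) :
    ricciOp g x = (jac F x)⁻¹ * ricciOp g' (F x) * jac F x := by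
  refine h.raise_eq hx ?_
  rw [ricci_eq_ric, ricci_eq_ric, ← ric_pull (h.unit_jac hx)]
  congr 1
  ext i j : 2
  exact h.curv_eq hx i j

theorem scal_eq (hx : x ∈ U) : scal g x = scal g' (F x) := by
  rw [h.source.scal_eq hx, h.target.scal_eq (h.mapsTo hx), h.ricciOp_eq hx, h.trace_conj hx]

theorem schouten_eq (hx : x ∈ U) :
    schouten g x = (jac F x)⁻¹ * schouten g' (F x) * jac F x := by
  rw [schouten, schouten, mul_add, add_mul, h.conj_smul_one hx, h.ricciOp_eq hx, h.scal_eq hx,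
    mul_smul_comm, smul_mul_assoc]

theorem weylMat_eq (hx : x ∈ U) (j k : Fin n) :
    weylMat g j k x = pull (jac F x) (fun a b => weylMat g' a b (F x)) j k := by
  have e : (fun a b => weylMat g' a b (F x))
      = fun a b => - curv g' a b (F x) + kn (g' (F x)) (schouten g' (F x)) a b := rfl
  rw [e, pull_add, pull_neg, ← h.curv_eq hx, weylMat, h.schouten_eq hx, h.metric x hx]
  congr 1
  exact (pull_kn (h.unit_jac hx) j k).symm

/-- In the trace formula for the contraction, the inner indices transform by J and are absorbed by
g⁻¹; the two outer ones give the congruence by J. -/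
theorem weylContr_eq (hx : x ∈ U) :
    weylContr g x = (jac F x).transpose * weylContr g' (F x) * jac F x := by
  set J := jac F x with hJ
  have hJu := h.unit_jac hx
  have e : ∀ X : Mat, ∑ k, ∑ a, (g x)⁻¹ k a * (J.transpose * X * J) a k
      = ∑ k, ∑ a, (g' (F x))⁻¹ k a * X a k := by
    intro X
    have t : ∀ A B : Mat, ∑ k, ∑ a, A k a * B a k = (A * B).trace := by
      intro A B; simp [Matrix.trace, Matrix.mul_apply]
    rw [t, t, h.raise_eq hx rfl, h.trace_conj hx]
  ext i j
  have e2 : ∀ k a, (weylMat g i a x * weylMat g j k x).trace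
      = ∑ p, ∑ q, J p i * J q j * (J.transpose * (Matrix.of fun b c =>
        (weylMat g' p b (F x) * weylMat g' q c (F x)).trace) * J) a k := by
    intro k a
    rw [h.weylMat_eq hx, h.weylMat_eq hx, trace_pull_mul hJu]
  rw [h.source.weylContr_apply hx]
  have e3 : ∑ k, ∑ a, (g x)⁻¹ k a * (weylMat g i a x * weylMat g j k x).trace
      = ∑ p, ∑ q, J p i * J q j * ∑ k, ∑ a, (g x)⁻¹ k a * (J.transpose * (Matrix.of fun b c =>
        (weylMat g' p b (F x) * weylMat g' q c (F x)).trace) * J) a k := by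
    have sw : ∀ f : Fin n → Fin n → Fin n → Fin n → ℝ, ∑ k, ∑ a, ∑ p, ∑ q, f k a p q
        = ∑ p, ∑ q, ∑ k, ∑ a, f k a p q := by
      intro f
      have s1 : ∀ k, ∑ a, ∑ p, ∑ q, f k a p q = ∑ p, ∑ q, ∑ a, f k a p q := fun k => by
        rw [Finset.sum_comm]
        exact Finset.sum_congr rfl fun p _ => Finset.sum_comm
      simp only [s1]
      rw [Finset.sum_comm]
      exact Finset.sum_congr rfl fun p _ => Finset.sum_comm
    simp only [e2, Finset.mul_sum]
    rw [sw]
    exact Finset.sum_congr rfl fun p _ => Finset.sum_congr rfl fun q _ =>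
      Finset.sum_congr rfl fun k _ => Finset.sum_congr rfl fun a _ => by ring
  rw [e3]
  simp only [e, Matrix.of_apply]
  simp only [Matrix.mul_apply, Matrix.transpose_apply,
    h.target.weylContr_apply (h.mapsTo hx), mul_neg, neg_mul, Finset.sum_neg_distrib]
  congr 1
  simp only [Finset.sum_mul]
  rw [Finset.sum_comm]
  exact Finset.sum_congr rfl fun q _ => Finset.sum_congr rfl fun p _ => by ring

theorem weylSq_eq (hx : x ∈ U) : weylSq g x = weylSq g' (F x) := by
  rw [h.source.weylSq_eq hx, h.target.weylSq_eq (h.mapsTo hx), h.raise_eq hx (h.weylContr_eq hx),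
    h.trace_conj hx]

theorem hOp_eq (hx : x ∈ U) : hOp g x = (jac F x)⁻¹ * hOp g' (F x) * jac F x := by
  refine h.raise_eq hx ?_
  rw [hTensor, hTensor, h.weylSq_eq hx, h.weylContr_eq hx, mul_smul_comm, smul_mul_assoc]

theorem hOp_sub_eq (hx : x ∈ U) (c : ℝ) :
    hOp g x - c • 1 = (jac F x)⁻¹ * (hOp g' (F x) - c • 1) * jac F x := by
  rw [mul_sub, sub_mul, h.conj_smul_one hx, h.hOp_eq hx]

theorem hTl_eq (hx : x ∈ U) : hTl g x = (jac F x)⁻¹ * hTl g' (F x) * jac F x :=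
  h.hOp_sub_eq hx _

theorem kOp_eq (hx : x ∈ U) : kOp g x = (jac F x)⁻¹ * kOp g' (F x) * jac F x := by
  have e1 : (schouten g' (F x)).trace = (schouten g x).trace := by
    rw [h.schouten_eq hx, h.trace_conj hx]
  have e2 : (schouten g' (F x) * hTl g' (F x)).trace = (schouten g x * hTl g x).trace := by
    rw [h.schouten_eq hx, h.hTl_eq hx, h.conj_mul hx, h.trace_conj hx]
  have e3 : (jac F x)⁻¹ * ((n : ℝ) • schouten g' (F x) + (schouten g x).trace • 1) * jac F x
      = (n : ℝ) • schouten g x + (schouten g x).trace • 1 := by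
    rw [mul_add, add_mul, h.conj_smul_one hx, mul_smul_comm, smul_mul_assoc, ← h.schouten_eq hx]
  rw [kOp, kOp, e1, e2, mul_sub, sub_mul, h.conj_smul_one hx, ← h.conj_mul hx, e3, ← h.hTl_eq hx]

theorem kPerp_eq (hx : x ∈ U) : kPerp g x = (jac F x)⁻¹ * kPerp g' (F x) * jac F x := by
  rw [kPerp, kPerp, mul_sub, sub_mul, mul_smul_comm, mul_smul_comm, smul_mul_assoc,
    smul_mul_assoc, ← h.kOp_eq hx, ← h.hTl_eq hx]
  have e1 : (hTl g' (F x) * hTl g' (F x)).trace = (hTl g x * hTl g x).trace := by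
    rw [h.hTl_eq hx, h.conj_mul hx, h.trace_conj hx]
  have e2 : (kOp g' (F x) * hTl g' (F x)).trace = (kOp g x * hTl g x).trace := by
    rw [h.kOp_eq hx, h.hTl_eq hx, h.conj_mul hx, h.trace_conj hx]
  rw [e1, e2]

theorem grycak_eq (hx : x ∈ U) : grycak g x = grycak g' (F x) := by
  rw [grycak, grycak, h.ricciOp_eq hx, h.hTl_eq hx, h.conj_mul hx, h.conj_mul hx, h.trace_conj hx,
    h.trace_conj hx]

end LocalIsometry

end CoordinateChange
end ConfRec
end

noncomputable section
namespace ConfRec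

/-! ### Components of the manifold's tensors in charts of the maximal atlas. -/

section Charts

variable {n : ℕ} {M : Type*} [TopologicalSpace M] [ChartedSpace (E n) M]
  {φ ψ : OpenPartialHomeomorph M (E n)} {x : E n}

theorem mdifferentiable_of_mem (hφ : φ ∈ IsManifold.maximalAtlas 𝓘(ℝ, E n) ∞ M) :
    φ.MDifferentiable 𝓘(ℝ, E n) 𝓘(ℝ, E n) :=
  ⟨(contMDiffOn_of_mem_maximalAtlas hφ).mdifferentiableOn (by simp),
    (contMDiffOn_symm_of_mem_maximalAtlas hφ).mdifferentiableOn (by simp)⟩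

variable [IsManifold 𝓘(ℝ, E n) ∞ M]

/-- The coordinate field is the image of a constant section under the tangent map of the inverse
chart. -/
theorem contMDiffOn_coordVec (hφ : φ ∈ IsManifold.maximalAtlas 𝓘(ℝ, E n) ∞ M) (i : Fin n) :
    ContMDiffOn 𝓘(ℝ, E n) (𝓘(ℝ, E n).prod 𝓘(ℝ, E n)) ∞
      (fun x => Bundle.TotalSpace.mk' (E n) (E := fun p : M => TangentSpace 𝓘(ℝ, E n) p)
        (φ.symm x) (coordVec φ x i)) φ.target := by
  have : IsManifold 𝓘(ℝ, E n) 1 M := IsManifold.of_le (n := ∞) (by simp)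
  have h1 := (contMDiffOn_symm_of_mem_maximalAtlas hφ).contMDiffOn_tangentMapWithin
    (m := ∞) (by simp) φ.open_target.uniqueMDiffOn
  have h2 : ContMDiff 𝓘(ℝ, E n) (𝓘(ℝ, E n).prod 𝓘(ℝ, E n)) ∞
      (fun x : E n => (⟨x, (EuclideanSpace.single i (1 : ℝ) : E n)⟩
        : TangentBundle 𝓘(ℝ, E n) (E n))) :=
    contMDiff_vectorSpace_iff_contDiff.2 contDiff_const
  refine (h1.comp h2.contMDiffOn (s := φ.target) fun x hx => hx).congr fun x hx => ?_
  simp only [Function.comp_apply, tangentMapWithin]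
  rw [mfderivWithin_of_mem_nhds (φ.open_target.mem_nhds hx)]
  rfl

theorem smooth_coord (g : PseudoRiemannianMetric n M)
    (hφ : φ ∈ IsManifold.maximalAtlas 𝓘(ℝ, E n) ∞ M) : MSm φ.target (g.coord φ) := by
  intro i j
  have h0 : ContMDiffOn 𝓘(ℝ, E n) (𝓘(ℝ, E n).prod 𝓘(ℝ, ℝ)) ∞
      (fun x => Bundle.TotalSpace.mk' ℝ (E := Bundle.Trivial M ℝ) (φ.symm x)
        (g.val (φ.symm x) (coordVec φ x i) (coordVec φ x j))) φ.target := by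
    apply ContMDiffOn.clm_bundle_apply₂ (F₁ := E n) (F₂ := E n)
    · exact g.contMDiff.comp_contMDiffOn (contMDiffOn_symm_of_mem_maximalAtlas hφ)
    · exact contMDiffOn_coordVec hφ i
    · exact contMDiffOn_coordVec hφ j
  refine contMDiffOn_iff_contDiffOn.1 fun x hx => ?_
  have h1 := h0 x hx
  simp only [Bundle.contMDiffWithinAt_totalSpace] at h1
  exact h1.2

/-- The derivative of the inverse of a chart, as a map on the model space. -/
def chartD (φ : OpenPartialHomeomorph M (E n)) (x : E n) : E n →L[ℝ] E n :=
  mfderiv 𝓘(ℝ, E n) 𝓘(ℝ, E n) φ.symm x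

/-- The metric at `p`, as a bilinear form on the model space. -/
def metricAt (g : PseudoRiemannianMetric n M) (p : M) : E n →L[ℝ] E n →L[ℝ] ℝ := g.val p

theorem coord_eq (g : PseudoRiemannianMetric n M) (i j : Fin n) : g.coord φ x i j
    = metricAt g (φ.symm x) (chartD φ x (EuclideanSpace.single i 1))
      (chartD φ x (EuclideanSpace.single j 1)) := rfl

theorem sum_smul_single (v : E n) :
    v = ∑ i, v i • (EuclideanSpace.single i (1 : ℝ) : E n) := by
  ext k; simp [Pi.single_apply]

theorem coord_apply_sum (g : PseudoRiemannianMetric n M) (v w : E n) :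
    ∑ i, ∑ j, v i * w j * g.coord φ x i j
      = metricAt g (φ.symm x) (chartD φ x v) (chartD φ x w) := by
  conv_rhs => rw [sum_smul_single v, sum_smul_single w]
  simp only [map_sum, map_smul, sum_apply, smul_apply, smul_eq_mul, coord_eq, Finset.mul_sum]
  rw [Finset.sum_comm]
  exact Finset.sum_congr rfl fun i _ => Finset.sum_congr rfl fun j _ => by ring

theorem localMetric_coord (g : PseudoRiemannianMetric n M)
    (hφ : φ ∈ IsManifold.maximalAtlas 𝓘(ℝ, E n) ∞ M) : LocalMetric φ.target (g.coord φ) where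
  isOpen := φ.open_target
  smooth := smooth_coord g hφ
  symm := fun x _ => by ext i j; exact g.symm _ _ _
  unit := fun x hx => by
    rw [isUnit_iff_ne_zero]
    intro h0
    obtain ⟨v, hv0, hv⟩ := Matrix.exists_mulVec_eq_zero_iff.2 h0
    have hd := (mdifferentiable_of_mem hφ).symm
    -- A kernel vector of the Gram matrix is the coordinate vector of a tangent vector orthogonal to
    -- every other, because the chart derivative is surjective.
    have h1 : chartD φ x (WithLp.toLp 2 v) = 0 := by
      refine g.nondegenerate (φ.symm x) _ fun w => ?_
      obtain ⟨w', rfl⟩ := hd.mfderiv_surjective (x := x) hx w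
      obtain ⟨u, rfl⟩ : ∃ u : E n, u = w' := ⟨w', rfl⟩
      refine (g.symm _ _ _).trans ((coord_apply_sum g u (WithLp.toLp 2 v)).symm.trans ?_)
      refine Finset.sum_eq_zero fun i _ => ?_
      have := congrFun hv i
      simp only [Matrix.mulVec, dotProduct, Pi.zero_apply] at this
      rw [← mul_zero (u i), ← this, Finset.mul_sum]
      exact Finset.sum_congr rfl fun j _ => by ring
    have h2 : (WithLp.toLp 2 v : E n) = 0 :=
      hd.mfderiv_injective (x := x) hx (h1.trans (map_zero (chartD φ x)).symm)
    apply hv0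
    ext i
    exact congrArg (fun u : E n => u i) h2

/-- The change of coordinates between two charts is an isometry. -/
theorem localIsometry_coord (g : PseudoRiemannianMetric n M)
    (hφ : φ ∈ IsManifold.maximalAtlas 𝓘(ℝ, E n) ∞ M)
    (hψ : ψ ∈ IsManifold.maximalAtlas 𝓘(ℝ, E n) ∞ M) :
    LocalIsometry (φ.target ∩ φ.symm ⁻¹' ψ.source) ψ.target (fun y => ψ (φ.symm y))
      (g.coord φ) (g.coord ψ) := by
  have hU : IsOpen (φ.target ∩ φ.symm ⁻¹' ψ.source) :=
    φ.symm.isOpen_inter_preimage ψ.open_source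
  have hm := localMetric_coord g hφ
  have hsm : ContDiffOn ℝ ∞ (fun y => ψ (φ.symm y)) (φ.target ∩ φ.symm ⁻¹' ψ.source) := by
    rw [← contMDiffOn_iff_contDiffOn]
    exact (contMDiffOn_of_mem_maximalAtlas hψ).comp
      ((contMDiffOn_symm_of_mem_maximalAtlas hφ).mono Set.inter_subset_left) fun y hy => hy.2
  refine ⟨⟨hU, fun i j => (hm.smooth i j).mono Set.inter_subset_left, fun x hx => hm.symm x hx.1,
    fun x hx => hm.unit x hx.1⟩, localMetric_coord g hψ, fun y hy => ψ.map_source hy.2, hsm, ?_⟩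
  intro x hx
  set F : E n → E n := fun y => ψ (φ.symm y) with hF
  have hFx : ψ.symm (F x) = φ.symm x := ψ.left_inv hx.2
  have hFd : DifferentiableAt ℝ F x :=
    (hsm.contDiffAt (hU.mem_nhds hx)).differentiableAt (by simp)
  have hval : ∀ {p q : M} (_ : p = q) (v w : E n), metricAt g p v w = metricAt g q v w := by
    rintro p q rfl v w; rfl
  -- The chain rule for φ⁻¹ = ψ⁻¹ ∘ F near x.
  have hcv : ∀ i, chartD φ x (EuclideanSpace.single i 1)
      = chartD ψ (F x) (fderiv ℝ F x (EuclideanSpace.single i 1)) := by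
    intro i
    have h1 : φ.symm =ᶠ[nhds x] ψ.symm ∘ F := by
      filter_upwards [hU.mem_nhds hx] with y hy
      exact (ψ.left_inv hy.2).symm
    have h2 : mfderiv 𝓘(ℝ, E n) 𝓘(ℝ, E n) φ.symm x
        = mfderiv 𝓘(ℝ, E n) 𝓘(ℝ, E n) (ψ.symm ∘ F) x := h1.mfderiv_eq
    have h3 := mfderiv_comp (I := 𝓘(ℝ, E n)) (I' := 𝓘(ℝ, E n)) (I'' := 𝓘(ℝ, E n)) x (g := ψ.symm)
      (f := F) ((mdifferentiable_of_mem hψ).mdifferentiableAt_symm (ψ.map_source hx.2))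
      hFd.mdifferentiableAt
    rw [mfderiv_eq_fderiv] at h3
    exact (DFunLike.congr_fun h2 _).trans (DFunLike.congr_fun h3 _)
  have hJ : ∀ a i, fderiv ℝ F x (EuclideanSpace.single i 1) a = jac F x a i := by
    intro a i
    have h4 := ((EuclideanSpace.proj a : E n →L[ℝ] ℝ).hasFDerivAt.comp x hFd.hasFDerivAt).fderiv
    rw [jac, Matrix.of_apply, pd, show (fun y => F y a)
      = (EuclideanSpace.proj a : E n →L[ℝ] ℝ) ∘ F from rfl, h4]
    rfl
  ext i j
  have h5 : g.coord φ x i j = ∑ a, ∑ b, fderiv ℝ F x (EuclideanSpace.single i 1) a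
      * fderiv ℝ F x (EuclideanSpace.single j 1) b * g.coord ψ (F x) a b := by
    rw [coord_apply_sum, coord_eq, hval hFx, hcv, hcv]
  rw [h5]
  simp only [hJ, Matrix.mul_apply, Matrix.transpose_apply, Finset.sum_mul]
  rw [Finset.sum_comm]
  exact Finset.sum_congr rfl fun b _ => Finset.sum_congr rfl fun a _ => by ring

theorem coord_ne_zero (α : CovectorField n M) (hφ : φ ∈ IsManifold.maximalAtlas 𝓘(ℝ, E n) ∞ M)
    (hx : x ∈ φ.target) (h : α.val (φ.symm x) ≠ 0) : α.coord φ x ≠ 0 := by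
  intro h0
  apply h
  refine ContinuousLinearMap.ext fun w => ?_
  obtain ⟨w', rfl⟩ := (mdifferentiable_of_mem hφ).symm.mfderiv_surjective (x := x) hx w
  let a : E n →L[ℝ] ℝ := α.val (φ.symm x)
  have h1 : a (chartD φ x w') = 0 := by
    rw [sum_smul_single (w' : E n), map_sum, map_sum]
    refine Finset.sum_eq_zero fun i _ => ?_
    rw [map_smul, map_smul]
    have h2 : a (chartD φ x (EuclideanSpace.single i 1)) = 0 := congrFun h0 i
    rw [h2, smul_zero]
  exact h1

theorem localRecurrent_coord (hn : 5 ≤ n) {g : PseudoRiemannianMetric n M} {α : CovectorField n M}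
    (hrec : IsConformallyRecurrent g α) (hC : WeylSqNeZero g)
    (hφ : φ ∈ IsManifold.maximalAtlas 𝓘(ℝ, E n) ∞ M) :
    LocalRecurrent φ.target (g.coord φ) (fun i x => α.coord φ x i) where
  toLocalMetric := localMetric_coord g hφ
  dim := hn
  recur := hrec.2 φ hφ
  sq_ne := hC φ hφ

end Charts
end ConfRec
end

noncomputable section
namespace ConfRec

/-! ### Frobenius' theorem by integration along rays. -/

section Frobenius

open Set Metric

variable {V F : Type*} [NormedAddCommGroup V] [NormedSpace ℝ V] [NormedAddCommGroup F]
  [NormedSpace ℝ F]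

/-- A solution on `[0, 1]` of an autonomous differential equation, which stays in a ball. -/
theorem exists_curve [CompleteSpace F] {f : F → F} {x₀ : F} {a K : NNReal}
    (hb : ∀ x ∈ closedBall x₀ a, ‖f x‖ ≤ a) (hl : LipschitzOnWith K f (closedBall x₀ a)) :
    ∃ γ : ℝ → F, γ 0 = x₀ ∧ ∀ t ∈ Icc (0 : ℝ) 1,
      HasDerivWithinAt γ (f (γ t)) (Icc 0 1) t ∧ γ t ∈ closedBall x₀ a := by
  let t₀ : Icc (0 : ℝ) 1 := ⟨0, left_mem_Icc.2 zero_le_one⟩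
  -- The speed bound equals the radius because time runs over an interval of length one; the 0 says
  -- that the initial value is fixed.
  have hf : IsPicardLindelof (fun _ => f) t₀ x₀ a 0 a K :=
    IsPicardLindelof.of_time_independent hb hl (by simp [t₀])
  obtain ⟨α, hα⟩ := ODE.FunSpace.exists_isFixedPt_next hf (mem_closedBall_self le_rfl)
  refine ⟨α.compProj, ?_, fun t ht => ⟨?_, α.compProj_mem_closedBall hf.mul_max_le⟩⟩
  · have : α.compProj (t₀ : ℝ) = x₀ := by
      rw [ODE.FunSpace.compProj_val, ← hα, ODE.FunSpace.next_apply₀]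
    exact this
  · apply ODE.hasDerivWithinAt_picard_Icc t₀.2 hf.continuousOn_uncurry
      α.continuous_compProj.continuousOn (fun _ _ => α.compProj_mem_closedBall hf.mul_max_le)
      x₀ ht |>.congr_of_mem _ ht
    intro t' ht'
    nth_rw 1 [← hα]
    rw [ODE.FunSpace.compProj_of_mem ht', ODE.FunSpace.next_apply]

/-- The estimate behind Frobenius' theorem: if `γ` and `δ` solve `γ' = X(γ) y` and
`δ' = X(δ) (y + v)` with the same initial value, then `δ - γ - t X(γ) v` is of second order
in `v`. -/
theorem norm_curve_sub_le {X : F → V →L[ℝ] F} {x₀ : F} {r A L K : ℝ} (hL : 0 < L) (hK : 0 ≤ K)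
    (hd : ∀ z ∈ closedBall x₀ (2 * r), DifferentiableAt ℝ X z)
    (hint : ∀ z ∈ closedBall x₀ (2 * r), ∀ y v,
      fderiv ℝ X z (X z y) v = fderiv ℝ X z (X z v) y)
    (hA : ∀ z ∈ closedBall x₀ (2 * r), ‖X z‖ ≤ A)
    (hL' : ∀ z ∈ closedBall x₀ (2 * r), ‖fderiv ℝ X z‖ ≤ L)
    (hK' : ∀ z ∈ closedBall x₀ (2 * r), ∀ z' ∈ closedBall x₀ (2 * r),
      ‖X z' - X z - fderiv ℝ X z (z' - z)‖ ≤ K * ‖z' - z‖ ^ 2)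
    {y v : V} (hyv : ‖y + v‖ ≤ 1) (hv : A * ‖v‖ ≤ r) {γ δ : ℝ → F} (hγ0 : γ 0 = x₀) (hδ0 : δ 0 = x₀)
    (hγ : ∀ t ∈ Icc (0 : ℝ) 1, HasDerivWithinAt γ (X (γ t) y) (Icc 0 1) t ∧ γ t ∈ closedBall x₀ r)
    (hδ : ∀ t ∈ Icc (0 : ℝ) 1, HasDerivWithinAt δ (X (δ t) (y + v)) (Icc 0 1) t
      ∧ δ t ∈ closedBall x₀ r) :
    ‖δ 1 - γ 1 - X (γ 1) v‖ ≤ (L * A + K * A ^ 2) / L * (Real.exp L - 1) * ‖v‖ ^ 2 := by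
  have hr : 0 ≤ r := nonempty_closedBall.1 ⟨_, (hγ 0 (left_mem_Icc.2 zero_le_one)).2⟩
  have hsub : closedBall x₀ r ⊆ closedBall x₀ (2 * r) := closedBall_subset_closedBall (by linarith)
  have hγ2 := fun t ht => hsub (hγ t ht).2
  have hA0 : 0 ≤ A := (norm_nonneg _).trans (hA _ (hγ2 0 (left_mem_Icc.2 zero_le_one)))
  have hXv : ∀ t ∈ Icc (0 : ℝ) 1, ‖t • X (γ t) v‖ ≤ A * ‖v‖ := by
    intro t ht
    rw [norm_smul, Real.norm_of_nonneg ht.1]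
    refine (mul_le_of_le_one_left (norm_nonneg _) ht.2).trans ?_
    exact ((X (γ t)).le_opNorm v).trans
      (mul_le_mul_of_nonneg_right (hA _ (hγ2 t ht)) (norm_nonneg _))
  -- A first-order guess for δ. Integrability makes it solve the equation with y + v up to an error
  -- quadratic in v, and Grönwall's inequality compares it with δ.
  set a : ℝ → F := fun t => γ t + t • X (γ t) v with ha
  have ha2 : ∀ t ∈ Icc (0 : ℝ) 1, a t ∈ closedBall x₀ (2 * r) := by
    intro t ht
    rw [mem_closedBall_iff_norm, ha]
    have h1 := (hγ t ht).2
    rw [mem_closedBall_iff_norm] at h1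
    calc ‖γ t + t • X (γ t) v - x₀‖ = ‖(γ t - x₀) + t • X (γ t) v‖ := by congr 1; abel
      _ ≤ r + r := (norm_add_le _ _).trans (add_le_add h1 ((hXv t ht).trans hv))
      _ = 2 * r := by ring
  set a' : ℝ → F := fun t =>
    X (γ t) y + (X (γ t) v + t • fderiv ℝ X (γ t) (X (γ t) y) v) with ha'
  have had : ∀ t ∈ Icc (0 : ℝ) 1, HasDerivWithinAt a (a' t) (Icc 0 1) t := by
    intro t ht
    have h1 := (hγ t ht).1
    have h2 : HasDerivWithinAt (fun t => X (γ t)) (fderiv ℝ X (γ t) (X (γ t) y)) (Icc 0 1) t :=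
      (hd _ (hγ2 t ht)).hasFDerivAt.comp_hasDerivWithinAt t h1
    have h3 : HasDerivWithinAt (fun t => X (γ t) v) (fderiv ℝ X (γ t) (X (γ t) y) v) (Icc 0 1) t :=
      (ContinuousLinearMap.apply ℝ F v).hasFDerivAt.comp_hasDerivWithinAt t h2
    have h4 := h1.add ((hasDerivWithinAt_id t (Icc (0 : ℝ) 1)).smul h3)
    refine h4.congr_deriv ?_
    simp only [ha', id, one_smul]
    abel
  have hIci : ∀ {f : ℝ → F} {f' : F} {t : ℝ}, t ∈ Ico (0 : ℝ) 1 →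
      HasDerivWithinAt f f' (Icc 0 1) t → HasDerivWithinAt f f' (Ici t) t := fun ht h =>
    h.mono_of_mem_nhdsWithin (Icc_mem_nhdsGE_of_mem ht)
  have hlip : LipschitzOnWith (Real.toNNReal L) (fun z => X z (y + v)) (closedBall x₀ (2 * r)) := by
    refine LipschitzOnWith.of_dist_le_mul fun z hz z' hz' => ?_
    rw [Real.coe_toNNReal _ hL.le, dist_eq_norm, dist_eq_norm, ← sub_apply]
    refine ((X z - X z').le_opNorm _).trans ((mul_le_of_le_one_right (norm_nonneg _) hyv).trans ?_)
    exact (convex_closedBall x₀ (2 * r)).norm_image_sub_le_of_norm_fderiv_le hd hL' hz' hz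
  have herr : ∀ t ∈ Ico (0 : ℝ) 1, dist (a' t) (X (a t) (y + v))
      ≤ (L * A + K * A ^ 2) * ‖v‖ ^ 2 := by
    intro t ht
    have ht' : t ∈ Icc (0 : ℝ) 1 := ⟨ht.1, ht.2.le⟩
    set z := γ t with hz
    set R := X (a t) - X z - fderiv ℝ X z (a t - z) with hR
    have haz : a t - z = t • X z v := by simp [ha, hz]
    have e : a' t - X (a t) (y + v)
        = - (fderiv ℝ X z (a t - z) v + R (y + v)) := by
      have e1 : fderiv ℝ X z (a t - z) y = t • fderiv ℝ X z (X z y) v := by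
        rw [haz, map_smul, smul_apply, hint z (hγ2 t ht') y v]
      have e2 : X (a t) (y + v) = R (y + v) + X z (y + v) + fderiv ℝ X z (a t - z) (y + v) := by
        simp only [hR, sub_apply]; abel
      rw [e2, map_add (X z), map_add (fderiv ℝ X z (a t - z)), e1]
      simp only [ha', ← hz]
      abel
    have b0 := hXv t ht'
    rw [← hz, ← haz] at b0
    have b1 : ‖fderiv ℝ X z (a t - z) v‖ ≤ L * A * ‖v‖ ^ 2 := by
      refine (ContinuousLinearMap.le_opNorm _ _).trans ?_
      calc ‖fderiv ℝ X z (a t - z)‖ * ‖v‖ ≤ (L * (A * ‖v‖)) * ‖v‖ := by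
            refine mul_le_mul_of_nonneg_right ?_ (norm_nonneg _)
            exact ((fderiv ℝ X z).le_opNorm _).trans
              (mul_le_mul (hL' z (hγ2 t ht')) b0 (norm_nonneg _) hL.le)
        _ = L * A * ‖v‖ ^ 2 := by ring
    have b2 : ‖R (y + v)‖ ≤ K * A ^ 2 * ‖v‖ ^ 2 := by
      refine (R.le_opNorm _).trans ((mul_le_of_le_one_right (norm_nonneg _) hyv).trans ?_)
      refine (hK' z (hγ2 t ht') (a t) (ha2 t ht')).trans ?_
      calc K * ‖a t - z‖ ^ 2 ≤ K * (A * ‖v‖) ^ 2 := by gcongr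
        _ = K * A ^ 2 * ‖v‖ ^ 2 := by ring
    rw [dist_eq_norm, e, norm_neg]
    refine (norm_add_le _ _).trans ?_
    linarith
  have key := dist_le_of_approx_trajectories_ODE_of_mem (v := fun _ z => X z (y + v))
    (s := fun _ => closedBall x₀ (2 * r)) (K := Real.toNNReal L) (f := δ) (g := a)
    (f' := fun t => X (δ t) (y + v)) (g' := a') (a := 0) (b := 1) (εf := 0)
    (εg := (L * A + K * A ^ 2) * ‖v‖ ^ 2) (δ := 0)
    (fun _ _ => hlip) (fun t ht => (hδ t ht).1.continuousWithinAt)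
    (fun t ht => hIci ht (hδ t ⟨ht.1, ht.2.le⟩).1) (fun t _ => by rw [dist_self])
    (fun t ht => hsub (hδ t ⟨ht.1, ht.2.le⟩).2) (fun t ht => (had t ht).continuousWithinAt)
    (fun t ht => hIci ht (had t ⟨ht.1, ht.2.le⟩)) herr (fun t ht => ha2 t ⟨ht.1, ht.2.le⟩)
    (by simp [ha, hγ0, hδ0]) 1 ⟨zero_le_one, le_rfl⟩
  rw [Real.coe_toNNReal _ hL.le, gronwallBound_of_K_ne_0 hL.ne', dist_eq_norm] at key
  simp only [ha, one_smul, sub_zero, mul_one, zero_mul, zero_add] at key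
  rw [sub_sub]
  refine key.trans (le_of_eq ?_)
  ring

/-- Bounds for a smooth map on a compact convex set. -/
theorem exists_taylor_bounds {G : Type*} [NormedAddCommGroup G] [NormedSpace ℝ G] {W B : Set F}
    (hW : IsOpen W) {X : F → G} (hX : ContDiffOn ℝ ∞ X W) (hcpt : IsCompact B) (hconv : Convex ℝ B)
    (hBW : B ⊆ W) (hne : B.Nonempty) :
    ∃ A L K : ℝ, 0 ≤ A ∧ 0 < L ∧ 0 ≤ K ∧ (∀ z ∈ B, DifferentiableAt ℝ X z) ∧
      (∀ z ∈ B, ‖X z‖ ≤ A) ∧ (∀ z ∈ B, ‖fderiv ℝ X z‖ ≤ L) ∧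
      ∀ z ∈ B, ∀ z' ∈ B, ‖X z' - X z - fderiv ℝ X z (z' - z)‖ ≤ K * ‖z' - z‖ ^ 2 := by
  obtain ⟨x₀, hx₀B⟩ := hne
  have hX1 : ContDiffOn ℝ ∞ (fderiv ℝ X) W := hX.fderiv_of_isOpen hW (by simp)
  have hX2 : ContDiffOn ℝ ∞ (fderiv ℝ (fderiv ℝ X)) W := hX1.fderiv_of_isOpen hW (by simp)
  obtain ⟨A, hA⟩ := hcpt.exists_bound_of_continuousOn (hX.continuousOn.mono hBW)
  obtain ⟨L₀, hL₀⟩ := hcpt.exists_bound_of_continuousOn (hX1.continuousOn.mono hBW)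
  obtain ⟨K, hK⟩ := hcpt.exists_bound_of_continuousOn (f := fderiv ℝ (fderiv ℝ X))
    (hX2.continuousOn.mono hBW)
  have hL00 : 0 ≤ L₀ := (norm_nonneg _).trans (hL₀ _ hx₀B)
  have hK0 : 0 ≤ K := (norm_nonneg _).trans (hK _ hx₀B)
  have hd : ∀ z ∈ B, DifferentiableAt ℝ X z := fun z hz =>
    (hX.contDiffAt (hW.mem_nhds (hBW hz))).differentiableAt (by simp)
  have hd1 : ∀ z ∈ B, DifferentiableAt ℝ (fderiv ℝ X) z := fun z hz =>
    (hX1.contDiffAt (hW.mem_nhds (hBW hz))).differentiableAt (by simp)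
  refine ⟨A, L₀ + 1, K, (norm_nonneg _).trans (hA _ hx₀B), by linarith, hK0, hd, hA,
    fun z hz => (hL₀ z hz).trans (by linarith), fun z hz z' hz' => ?_⟩
  have hseg : segment ℝ z z' ⊆ B := hconv.segment_subset hz hz'
  have h1 := (convex_segment z z').norm_image_sub_le_of_norm_fderiv_le' (𝕜 := ℝ) (f := X)
    (C := K * ‖z' - z‖) (φ := fderiv ℝ X z) (fun w hw => hd w (hseg hw)) (fun w hw => by
      refine (hconv.norm_image_sub_le_of_norm_fderiv_le hd1 hK hz (hseg hw)).trans ?_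
      refine mul_le_mul_of_nonneg_left ?_ hK0
      exact norm_sub_le_of_mem_segment hw)
    (left_mem_segment ℝ z z') (right_mem_segment ℝ z z')
  rw [pow_two, ← mul_assoc]
  exact h1

/-- **Frobenius' theorem** for the system `Du = X(u)`. -/
theorem exists_hasFDerivAt_eq [FiniteDimensional ℝ F] {W : Set F} (hW : IsOpen W)
    {X : F → V →L[ℝ] F} (hX : ContDiffOn ℝ ∞ X W)
    (hint : ∀ z ∈ W, ∀ y v, fderiv ℝ X z (X z y) v = fderiv ℝ X z (X z v) y)
    {x₀ : F} (hx₀ : x₀ ∈ W) :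
    ∃ (ε : ℝ) (u : V → F), 0 < ε ∧ u 0 = x₀ ∧
      ∀ y ∈ ball (0 : V) ε, u y ∈ W ∧ HasFDerivAt u (X (u y)) y := by
  have : CompleteSpace F := FiniteDimensional.complete ℝ F
  have : ProperSpace F := FiniteDimensional.proper ℝ F
  obtain ⟨s, hs, hsW⟩ := nhds_basis_closedBall.mem_iff.1 (hW.mem_nhds hx₀)
  -- The curves stay within r of x₀ and the first-order guess within a further r, so the estimates
  -- are needed on the ball of radius 2r.
  set r := s / 2 with hr
  have hr0 : 0 < r := half_pos hs
  have h2r : 2 * r = s := by rw [hr]; ring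
  rw [← h2r] at hsW
  set B := closedBall x₀ (2 * r) with hB
  have hx₀B : x₀ ∈ B := mem_closedBall_self (by linarith)
  have hconv : Convex ℝ B := convex_closedBall _ _
  obtain ⟨A, L, K, hA0, hL0, hK0, hd, hA, hL, hTay⟩ := exists_taylor_bounds hW hX
    (isCompact_closedBall _ _) hconv hsW ⟨x₀, hx₀B⟩
  -- The bound 1 keeps L a Lipschitz constant of z ↦ X(z)y; the other gives A‖y‖ ≤ r, with A + 1
  -- because A may vanish.
  set ε := min 1 (r / (A + 1)) with hε
  have hε0 : 0 < ε := lt_min one_pos (div_pos hr0 (by linarith))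
  have hAr : ∀ y : V, ‖y‖ < ε → A * ‖y‖ ≤ r := by
    intro y hy
    have h1 : ‖y‖ ≤ r / (A + 1) := hy.le.trans (min_le_right _ _)
    rw [le_div_iff₀ (by linarith)] at h1
    have := norm_nonneg y
    linarith
  have hcurve : ∀ y : V, ∃ γ : ℝ → F, ‖y‖ < ε → γ 0 = x₀ ∧ ∀ t ∈ Icc (0 : ℝ) 1,
      HasDerivWithinAt γ (X (γ t) y) (Icc 0 1) t ∧ γ t ∈ closedBall x₀ (A * ‖y‖) := by
    intro y
    by_cases hy : ‖y‖ < ε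
    swap
    · exact ⟨fun _ => x₀, fun h => absurd h hy⟩
    have hsub : closedBall x₀ (A * ‖y‖) ⊆ B :=
      closedBall_subset_closedBall ((hAr y hy).trans (by linarith))
    obtain ⟨γ, h1, h2⟩ := exists_curve (f := fun z => X z y) (x₀ := x₀)
      (a := ⟨A * ‖y‖, mul_nonneg hA0 (norm_nonneg _)⟩) (K := Real.toNNReal L)
      (fun z hz => ((X z).le_opNorm y).trans
        (mul_le_mul_of_nonneg_right (hA z (hsub hz)) (norm_nonneg _)))
      (LipschitzOnWith.of_dist_le_mul fun z hz z' hz' => by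
        rw [Real.coe_toNNReal _ hL0.le, dist_eq_norm, dist_eq_norm, ← sub_apply]
        refine ((X z - X z').le_opNorm _).trans ((mul_le_of_le_one_right (norm_nonneg _)
          (hy.le.trans (min_le_left _ _))).trans ?_)
        exact hconv.norm_image_sub_le_of_norm_fderiv_le hd hL (hsub hz') (hsub hz))
    exact ⟨γ, fun _ => ⟨h1, h2⟩⟩
  choose γ hγ using hcurve
  have h01 : (1 : ℝ) ∈ Icc (0 : ℝ) 1 := right_mem_Icc.2 zero_le_one
  -- The solution at y is the value at time one of the curve with γ' = X(γ)y, the restriction of u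
  -- to the ray through y.
  refine ⟨ε, fun y => γ y 1, hε0, ?_, fun y hy => ?_⟩
  · have h1 := ((hγ 0 (by rwa [norm_zero])).2 1 h01).2
    rw [norm_zero, mul_zero, closedBall_zero] at h1
    exact h1
  · rw [mem_ball_zero_iff] at hy
    have hyr : ∀ y : V, ‖y‖ < ε → ∀ t ∈ Icc (0 : ℝ) 1,
        HasDerivWithinAt (γ y) (X (γ y t) y) (Icc 0 1) t ∧ γ y t ∈ closedBall x₀ r :=
      fun y hy t ht => ⟨((hγ y hy).2 t ht).1,
        closedBall_subset_closedBall (hAr y hy) ((hγ y hy).2 t ht).2⟩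
    refine ⟨hsW (closedBall_subset_closedBall (by linarith) (hyr y hy 1 h01).2), ?_⟩
    rw [hasFDerivAt_iff_isLittleO_nhds_zero]
    have hO : (fun v => γ (y + v) 1 - γ y 1 - X (γ y 1) v)
        =O[nhds 0] (fun v : V => ‖v‖ ^ 2) := by
      refine Asymptotics.IsBigO.of_bound
        ((L * A + K * A ^ 2) / L * (Real.exp L - 1)) ?_
      have c1 : ∀ᶠ v in nhds (0 : V), ‖y + v‖ < ε := by
        have : Filter.Tendsto (fun v : V => ‖y + v‖) (nhds 0) (nhds ‖y + 0‖) :=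
          (continuous_const.add continuous_id).norm.tendsto 0
        rw [add_zero] at this
        exact this.eventually_lt_const hy
      filter_upwards [c1, ball_mem_nhds (0 : V) hε0] with v hv1 hv2
      rw [mem_ball_zero_iff] at hv2
      rw [Real.norm_of_nonneg (sq_nonneg _)]
      exact norm_curve_sub_le hL0 hK0 hd (fun z hz => hint z (hsW hz)) hA hL hTay
        (hv1.le.trans (min_le_left _ _)) (hAr v hv2) (hγ y hy).1 (hγ _ hv1).1 (hyr y hy)
        (hyr _ hv1)
    refine hO.trans_isLittleO ?_
    exact Asymptotics.isLittleO_norm_pow_id one_lt_two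

/-- A solution of the system `Du = X(u)` with smooth `X` is smooth. -/
theorem contDiffOn_of_hasFDerivAt_eq {W : Set F} {X : F → V →L[ℝ] F} (hX : ContDiffOn ℝ ∞ X W)
    {S : Set V} (hS : IsOpen S) {u : V → F}
    (hu : ∀ y ∈ S, u y ∈ W ∧ HasFDerivAt u (X (u y)) y) : ContDiffOn ℝ ∞ u S := by
  rw [contDiffOn_infty]
  intro k
  -- Bootstrapping: if u is C^k, then Du = X(u) is C^k, so u is C^(k+1).
  induction k with
  | zero =>
    exact contDiffOn_zero.2 fun y hy => (hu y hy).2.continuousAt.continuousWithinAt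
  | succ k ih =>
    have h1 : ContDiffOn ℝ ((k : ℕ∞ω) + 1) u S := by
      rw [contDiffOn_succ_iff_fderiv_of_isOpen hS]
      refine ⟨fun y hy => (hu y hy).2.differentiableAt.differentiableWithinAt, by simp, ?_⟩
      exact ((hX.of_le (by exact_mod_cast le_top)).comp ih fun y hy => (hu y hy).1).congr
        fun y hy => (hu y hy).2.fderiv
    exact_mod_cast h1

end Frobenius
end ConfRec
end

noncomputable section
namespace ConfRec

/-! ### Integrability of the image of a parallel projector. -/

section Distribution

open Set Metric

variable {V F : Type*} [NormedAddCommGroup V] [NormedSpace ℝ V] [FiniteDimensional ℝ V]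
  [NormedAddCommGroup F] [NormedSpace ℝ F] [FiniteDimensional ℝ F]

/-- The image of a field of projectors that is parallel for a symmetric connection is integrable. -/
theorem exists_integral_of_parallel {U : Set F} (hU : IsOpen U) {p : F → F →L[ℝ] F}
    (hp : ContDiffOn ℝ ∞ p U) (hidem : ∀ z ∈ U, ∀ v, p z (p z v) = p z v)
    (hrank : ∀ z ∈ U, Module.finrank ℝ (LinearMap.range (p z : F →ₗ[ℝ] F)) = Module.finrank ℝ V)
    {Γ : F → F → F → F} (hΓ : ∀ z ∈ U, ∀ w v, Γ z w v = Γ z v w)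
    (hpar : ∀ z ∈ U, ∀ w v, fderiv ℝ p z w v = p z (Γ z w v) - Γ z w (p z v))
    {x : F} (hx : x ∈ U) :
    ∃ (ε : ℝ) (u : V → F), 0 < ε ∧ ContDiffOn ℝ ∞ u (ball 0 ε) ∧ u 0 = x ∧
      InjOn u (ball 0 ε) ∧ ∀ y ∈ ball (0 : V) ε, u y ∈ U ∧
        LinearMap.range (fderiv ℝ u y : V →ₗ[ℝ] F) = LinearMap.range (p (u y) : F →ₗ[ℝ] F) := by
  have : CompleteSpace V := FiniteDimensional.complete ℝ V
  let e : V ≃L[ℝ] LinearMap.range (p x : F →ₗ[ℝ] F) :=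
    ContinuousLinearEquiv.ofFinrankEq (hrank x hx).symm
  let ι : V →L[ℝ] F := (Submodule.subtypeL _).comp (e : V →L[ℝ] LinearMap.range (p x : F →ₗ[ℝ] F))
  let π : F →L[ℝ] V := (e.symm : LinearMap.range (p x : F →ₗ[ℝ] F) →L[ℝ] V).comp
    ((p x).codRestrict (LinearMap.range (p x : F →ₗ[ℝ] F)) fun v => ⟨v, rfl⟩)
  have hι : ∀ v, p x (ι v) = ι v := by
    intro v
    obtain ⟨w, hw⟩ := (e v).2
    have : ι v = p x w := hw.symm
    rw [this, hidem x hx]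
  have hπι : ∀ v, π (p x (ι v)) = v := by
    intro v
    apply e.injective
    apply Subtype.ext
    have h1 : ((e (π (p x (ι v))) : LinearMap.range (p x : F →ₗ[ℝ] F)) : F) = p x (p x (ι v)) := by
      change ((e (e.symm _) : LinearMap.range (p x : F →ₗ[ℝ] F)) : F) = _
      rw [e.apply_symm_apply]
      rfl
    rw [h1, hι, hι]
    rfl
  -- The identity at x, hence invertible nearby. Dividing by it gives a frame X of the image of p
  -- normalised by πX = 1.
  let M : F → V →L[ℝ] V := fun z => π.comp ((p z).comp ι)
  have hM : ContDiffOn ℝ ∞ M U := contDiffOn_const.clm_comp (hp.clm_comp contDiffOn_const)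
  let W := U ∩ M ⁻¹' {A | IsUnit A}
  have hW : IsOpen W := hM.continuousOn.isOpen_inter_preimage hU Units.isOpen
  have hMx : M x = 1 := ContinuousLinearMap.ext fun v => hπι v
  have hxW : x ∈ W := ⟨hx, by simp [hMx]⟩
  let N : F → V →L[ℝ] V := fun z => Ring.inverse (M z)
  have hN : ContDiffOn ℝ ∞ N W := by
    intro z hz
    have hz2 := hz.2
    obtain ⟨m, hm⟩ : IsUnit (M z) := hz2
    have h1 : ContDiffAt ℝ ∞ Ring.inverse (M z) := by
      rw [← hm]; exact contDiffAt_ringInverse ℝ m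
    exact h1.comp_contDiffWithinAt z ((hM z hz.1).mono inter_subset_left)
  let X : F → V →L[ℝ] F := fun z => (p z).comp (ι.comp (N z))
  have hX : ContDiffOn ℝ ∞ X W :=
    (hp.mono inter_subset_left).clm_comp (contDiffOn_const.clm_comp hN)
  have hπX : ∀ z ∈ W, ∀ v, π (X z v) = v := by
    intro z hz v
    exact DFunLike.congr_fun (Ring.mul_inverse_cancel (M z) hz.2) v
  have hpX : ∀ z ∈ W, ∀ v, p z (X z v) = X z v := fun z hz v => hidem z hz.1 _
  have hrange : ∀ z ∈ W,
      LinearMap.range (X z : V →ₗ[ℝ] F) = LinearMap.range (p z : F →ₗ[ℝ] F) := by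
    intro z hz
    apply Submodule.eq_of_le_of_finrank_eq
    · rintro _ ⟨v, rfl⟩
      exact ⟨_, hpX z hz v⟩
    · rw [hrank z hz.1]
      refine LinearMap.finrank_range_of_inj fun v w hvw => ?_
      rw [← hπX z hz v, ← hπX z hz w]
      exact congrArg π hvw
  have hXπ : ∀ z ∈ W, ∀ v, X z (π (p z v)) = p z v := by
    intro z hz v
    obtain ⟨w, hw⟩ : p z v ∈ LinearMap.range (X z : V →ₗ[ℝ] F) := by
      rw [hrange z hz]; exact ⟨v, rfl⟩
    have hw' : X z w = p z v := hw
    rw [← hw', hπX z hz]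
  -- The commutator Z of the frame lies in the image of p, since p is parallel and Γ symmetric. The
  -- normalisation πX = 1 gives πZ = 0, and π is injective on that image.
  have hint : ∀ z ∈ W, ∀ y v, fderiv ℝ X z (X z y) v = fderiv ℝ X z (X z v) y := by
    intro z hz y v
    have hXd : HasFDerivAt X (fderiv ℝ X z) z :=
      ((hX.contDiffAt (hW.mem_nhds hz)).differentiableAt (by simp)).hasFDerivAt
    have hpd : HasFDerivAt p (fderiv ℝ p z) z :=
      ((hp.contDiffAt (hU.mem_nhds hz.1)).differentiableAt (by simp)).hasFDerivAt
    have d1 : ∀ w v, fderiv ℝ X z w v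
        = (p z (Γ z w (X z v)) - Γ z w (X z v)) + p z (fderiv ℝ X z w v) := by
      intro w v
      have h1 := hpd.clm_comp hXd
      have h2 : (fun z => (p z).comp (X z)) =ᶠ[nhds z] X := by
        filter_upwards [hW.mem_nhds hz] with z' hz'
        exact ContinuousLinearMap.ext fun v => hpX z' hz' v
      have h3 := (h1.congr_of_eventuallyEq h2.symm).unique hXd
      have h4 := DFunLike.congr_fun (DFunLike.congr_fun h3 w) v
      simp only [add_apply, ContinuousLinearMap.comp_apply, ContinuousLinearMap.compL_apply,
        ContinuousLinearMap.flip_apply] at h4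
      rw [hpar z hz.1, hpX z hz] at h4
      rw [add_comm]
      exact h4.symm
    have d2 : ∀ w v, π (fderiv ℝ X z w v) = 0 := by
      intro w v
      have h1 := (hasFDerivAt_const π z).clm_comp hXd
      have h2 : (fun z => π.comp (X z)) =ᶠ[nhds z] fun _ => ContinuousLinearMap.id ℝ V := by
        filter_upwards [hW.mem_nhds hz] with z' hz'
        exact ContinuousLinearMap.ext fun v => hπX z' hz' v
      have h3 := (h1.congr_of_eventuallyEq h2.symm).unique (hasFDerivAt_const _ z)
      have h4 := DFunLike.congr_fun (DFunLike.congr_fun h3 w) v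
      simpa using h4
    set Z := fderiv ℝ X z (X z y) v - fderiv ℝ X z (X z v) y with hZ
    have z1 : p z Z = Z := by
      have e1 := d1 (X z y) v
      have e2 := d1 (X z v) y
      rw [hΓ z hz.1 (X z v) (X z y)] at e2
      rw [hZ, map_sub]
      rw [← sub_eq_zero]
      nth_rw 2 [e1]
      nth_rw 2 [e2]
      abel
    have z2 : π Z = 0 := by rw [hZ, map_sub, d2, d2, sub_zero]
    have z3 : Z = 0 := by
      rw [← z1, ← hXπ z hz Z, z1, z2, map_zero]
    exact sub_eq_zero.1 z3
  obtain ⟨ε, u, hε, hu0, hu⟩ := exists_hasFDerivAt_eq hW hX hint hxW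
  refine ⟨ε, u, hε, contDiffOn_of_hasFDerivAt_eq hX isOpen_ball hu, hu0, ?_, fun y hy =>
    ⟨(hu y hy).1.1, ?_⟩⟩
  -- The derivative of π ∘ u is the identity, so π ∘ u is a translation and u is injective.
  · have hc : ∀ y ∈ ball (0 : V) ε, HasFDerivAt (fun y => π (u y) - y) (0 : V →L[ℝ] V) y := by
      intro y hy
      have h1 := (π.hasFDerivAt.comp y (hu y hy).2).sub (hasFDerivAt_id y)
      have h2 : π.comp (X (u y)) - ContinuousLinearMap.id ℝ V = 0 := by
        rw [sub_eq_zero]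
        exact ContinuousLinearMap.ext fun v => hπX _ (hu y hy).1 v
      rw [h2] at h1
      exact h1
    intro y hy y' hy' hyy
    have h1 := (convex_ball (0 : V) ε).is_const_of_fderivWithin_eq_zero (𝕜 := ℝ)
      (f := fun y => π (u y) - y) (fun y hy => (hc y hy).differentiableAt.differentiableWithinAt)
      (fun y hy => by rw [fderivWithin_of_isOpen isOpen_ball hy, (hc y hy).fderiv]) hy hy'
    simp only [hyy] at h1
    exact sub_right_injective h1
  · rw [(hu y hy).2.fderiv, hrange _ (hu y hy).1]

variable {n : ℕ} {U : Set (E n)} {g : E n → Matrix (Fin n) (Fin n) ℝ} {x : E n}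

theorem toEuclideanCLM_eq_sum (A : Matrix (Fin n) (Fin n) ℝ) :
    Matrix.toEuclideanCLM (𝕜 := ℝ) A
      = ∑ k, ∑ l, A k l • Matrix.toEuclideanCLM (𝕜 := ℝ) (Matrix.single k l (1 : ℝ)) := by
  conv_lhs => rw [Matrix.matrix_eq_sum_single A]
  simp only [map_sum, ← map_smul, Matrix.smul_single, smul_eq_mul, mul_one]

/-- For a parallel operator ∂P = PΓ - ΓP; contracting with a direction gives the hypothesis of
`exists_integral_of_parallel`, with the Levi-Civita connection as the symmetric Γ. -/
theorem LocalMetric.hasIntegralSubmanifold (h : LocalMetric U g) {d : ℕ}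
    {P : E n → Matrix (Fin n) (Fin n) ℝ} (hP : MSm U P)
    (hpar : ∀ z ∈ U, ∀ i, nab g i P z = 0) (hidem : ∀ z ∈ U, P z * P z = P z)
    (hrank : ∀ z ∈ U, (P z).rank = d) (hx : x ∈ U) : HasIntegralSubmanifold d P U x := by
  let p : E n → E n →L[ℝ] E n := fun z => Matrix.toEuclideanCLM (𝕜 := ℝ) (P z)
  have hpe : p = fun z => ∑ k, ∑ l, P z k l • Matrix.toEuclideanCLM (𝕜 := ℝ)
      (Matrix.single k l (1 : ℝ)) := funext fun z => toEuclideanCLM_eq_sum (P z)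
  have hp : ContDiffOn ℝ ∞ p U := by
    rw [hpe]
    exact ContDiffOn.sum fun k _ => ContDiffOn.sum fun l _ => (hP k l).smul contDiffOn_const
  have hpd : ∀ z ∈ U, ∀ w, fderiv ℝ p z w
      = Matrix.toEuclideanCLM (𝕜 := ℝ) (∑ i, w i • mpd i P z) := by
    intro z hz w
    have h1 : HasFDerivAt p (∑ k, ∑ l, (fderiv ℝ (fun y => P y k l) z).smulRight
        (Matrix.toEuclideanCLM (𝕜 := ℝ) (Matrix.single k l (1 : ℝ)))) z := by
      rw [hpe]
      exact HasFDerivAt.fun_sum fun k _ => HasFDerivAt.fun_sum fun l _ =>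
        (hP.diffAt h.isOpen hz k l).hasFDerivAt.smul_const (F := E n →L[ℝ] E n) _
    rw [h1.fderiv, toEuclideanCLM_eq_sum]
    simp only [sum_apply, ContinuousLinearMap.smulRight_apply]
    refine Finset.sum_congr rfl fun k _ => Finset.sum_congr rfl fun l _ => ?_
    rw [fderiv_apply_eq_sum, Matrix.sum_apply]
    rfl
  let Γ : E n → E n → E n → E n := fun z w v =>
    Matrix.toEuclideanCLM (𝕜 := ℝ) (∑ i, w i • gam g i z) v
  have hΓ : ∀ z ∈ U, ∀ w v, Γ z w v = Γ z v w := by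
    intro z hz w v
    ext m
    simp only [Γ, Matrix.ofLp_toEuclideanCLM, Matrix.mulVec, dotProduct, Matrix.sum_apply,
      Matrix.smul_apply, smul_eq_mul, Finset.sum_mul]
    rw [Finset.sum_comm]
    exact Finset.sum_congr rfl fun i _ => Finset.sum_congr rfl fun k _ => by
      rw [h.gam_symm hz m k i]; ring
  have hpar' : ∀ z ∈ U, ∀ w v, fderiv ℝ p z w v = p z (Γ z w v) - Γ z w (p z v) := by
    intro z hz w v
    have e : ∑ i, w i • mpd i P z
        = P z * (∑ i, w i • gam g i z) - (∑ i, w i • gam g i z) * P z := by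
      have e1 : ∀ i, mpd i P z = P z * gam g i z - gam g i z * P z := by
        intro i
        have := hpar z hz i
        rw [nab] at this
        rw [← sub_eq_zero, ← this]; abel
      simp only [e1, Finset.mul_sum, Finset.sum_mul, mul_smul_comm, smul_mul_assoc, smul_sub,
        Finset.sum_sub_distrib]
    rw [hpd z hz, e, map_sub, map_mul, map_mul]
    rfl
  have hidem' : ∀ z ∈ U, ∀ v, p z (p z v) = p z v := by
    intro z hz v
    have : p z * p z = p z := by simp only [p, ← map_mul, hidem z hz]
    exact DFunLike.congr_fun this v
  have hlin : ∀ z, (p z : E n →ₗ[ℝ] E n) = Matrix.toEuclideanLin (P z) := fun z => rfl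
  have hrank' : ∀ z ∈ U, Module.finrank ℝ (LinearMap.range (p z : E n →ₗ[ℝ] E n))
      = Module.finrank ℝ (E d) := by
    intro z hz
    rw [hlin, finrank_euclideanSpace_fin, ← hrank z hz, Matrix.rank_eq_finrank_range_toLin (P z)
      (EuclideanSpace.basisFun (Fin n) ℝ).toBasis (EuclideanSpace.basisFun (Fin n) ℝ).toBasis,
      Matrix.toEuclideanLin_eq_toLin_orthonormal]
  exact exists_integral_of_parallel h.isOpen hp hidem' hrank' hΓ hpar' hx

end Distribution
end ConfRec
end

noncomputable section
namespace ConfRec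

/-! ### From a single point to the connected manifold. -/

section Global

variable {n : ℕ} {M : Type*} [TopologicalSpace M] [ChartedSpace (E n) M]
  [IsManifold 𝓘(ℝ, E n) ∞ M] {g : PseudoRiemannianMetric n M}

/-- An operator field that vanishes at a point and is locally zero near each of its zeros vanishes
on a connected manifold. -/
theorem forall_coord_eq_zero [ConnectedSpace M]
    (A : (E n → Matrix (Fin n) (Fin n) ℝ) → E n → Matrix (Fin n) (Fin n) ℝ)
    (hconj : ∀ {U V : Set (E n)} {F : E n → E n} {g g' : E n → Matrix (Fin n) (Fin n) ℝ} {x : E n},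
      LocalIsometry U V F g g' → x ∈ U → A g x = (jac F x)⁻¹ * A g' (F x) * jac F x)
    (hsm : ∀ φ ∈ IsManifold.maximalAtlas 𝓘(ℝ, E n) ∞ M, MSm φ.target (A (g.coord φ)))
    (hopen : ∀ φ ∈ IsManifold.maximalAtlas 𝓘(ℝ, E n) ∞ M, ∀ x ∈ φ.target,
      A (g.coord φ) x = 0 → ∀ᶠ y in nhds x, A (g.coord φ) y = 0)
    {φ₀ : OpenPartialHomeomorph M (E n)} (hφ₀ : φ₀ ∈ IsManifold.maximalAtlas 𝓘(ℝ, E n) ∞ M)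
    {x₀ : E n} (hx₀ : x₀ ∈ φ₀.target) (h₀ : A (g.coord φ₀) x₀ = 0) :
    ∀ φ ∈ IsManifold.maximalAtlas 𝓘(ℝ, E n) ∞ M, ∀ x ∈ φ.target, A (g.coord φ) x = 0 := by
  have trans : ∀ φ ∈ IsManifold.maximalAtlas 𝓘(ℝ, E n) ∞ M,
      ∀ ψ ∈ IsManifold.maximalAtlas 𝓘(ℝ, E n) ∞ M, ∀ p, p ∈ φ.source → p ∈ ψ.source →
      A (g.coord ψ) (ψ p) = 0 → A (g.coord φ) (φ p) = 0 := by
    intro φ hφ ψ hψ p hpφ hpψ h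
    have h1 := hconj (localIsometry_coord g hφ hψ) (x := φ p)
      ⟨φ.map_source hpφ, by rw [Set.mem_preimage, φ.left_inv hpφ]; exact hpψ⟩
    simp only [φ.left_inv hpφ, h, mul_zero, zero_mul] at h1
    exact h1
  -- Vanishing does not depend on the chart, since A changes by conjugation. S is closed by
  -- continuity of the entries and open by `hopen`.
  set S : Set M := {p | A (g.coord (chartAt (E n) p)) (chartAt (E n) p p) = 0} with hS
  have mem_iff : ∀ φ ∈ IsManifold.maximalAtlas 𝓘(ℝ, E n) ∞ M, ∀ p ∈ φ.source,
      (p ∈ S ↔ A (g.coord φ) (φ p) = 0) := fun φ hφ p hp =>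
    ⟨trans φ hφ _ (IsManifold.chart_mem_maximalAtlas p) p hp (mem_chart_source _ p),
      trans _ (IsManifold.chart_mem_maximalAtlas p) φ hφ p (mem_chart_source _ p) hp⟩
  have hclopen : IsClopen S := by
    constructor
    · rw [← isOpen_compl_iff, isOpen_iff_mem_nhds]
      intro p hp
      set φ := chartAt (E n) p
      have hφ : φ ∈ IsManifold.maximalAtlas 𝓘(ℝ, E n) ∞ M := IsManifold.chart_mem_maximalAtlas p
      have hpφ : p ∈ φ.source := mem_chart_source _ p
      obtain ⟨i, j, hij⟩ : ∃ i j, A (g.coord φ) (φ p) i j ≠ 0 := by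
        by_contra hcon
        push Not at hcon
        exact hp (Matrix.ext hcon)
      have hc : ContinuousAt (fun y => A (g.coord φ) y i j) (φ p) :=
        ((hsm φ hφ i j).continuousOn).continuousAt (φ.open_target.mem_nhds (φ.map_source hpφ))
      have hev : ∀ᶠ q in nhds p, A (g.coord φ) (φ q) i j ≠ 0 :=
        (φ.continuousAt hpφ).eventually (hc.eventually_ne hij)
      filter_upwards [hev, φ.open_source.mem_nhds hpφ] with q hq hqφ hqS
      rw [mem_iff φ hφ q hqφ] at hqS
      exact hq (by rw [hqS]; rfl)
    · rw [isOpen_iff_mem_nhds]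
      intro p hp
      set φ := chartAt (E n) p
      have hφ : φ ∈ IsManifold.maximalAtlas 𝓘(ℝ, E n) ∞ M := IsManifold.chart_mem_maximalAtlas p
      have hpφ : p ∈ φ.source := mem_chart_source _ p
      have hev : ∀ᶠ q in nhds p, A (g.coord φ) (φ q) = 0 :=
        (φ.continuousAt hpφ).eventually (hopen φ hφ _ (φ.map_source hpφ) hp)
      filter_upwards [hev, φ.open_source.mem_nhds hpφ] with q hq hqφ
      exact (mem_iff φ hφ q hqφ).2 hq
  have huniv : S = Set.univ := by
    refine hclopen.eq_univ ⟨φ₀.symm x₀, ?_⟩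
    rw [mem_iff φ₀ hφ₀ _ (φ₀.map_target hx₀), φ₀.right_inv hx₀]
    exact h₀
  intro φ hφ x hx
  have h1 := (mem_iff φ hφ _ (φ.map_target hx)).1 (huniv ▸ Set.mem_univ _)
  rwa [φ.right_inv hx] at h1

/-- The function `G` on the manifold. -/
def grycakFun (g : PseudoRiemannianMetric n M) (p : M) : ℝ :=
  grycak (g.coord (chartAt (E n) p)) (chartAt (E n) p p)

theorem grycakFun_apply {φ : OpenPartialHomeomorph M (E n)}
    (hφ : φ ∈ IsManifold.maximalAtlas 𝓘(ℝ, E n) ∞ M) {p : M} (hp : p ∈ φ.source) :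
    grycakFun g p = grycak (g.coord φ) (φ p) := by
  have h1 := (localIsometry_coord g hφ (IsManifold.chart_mem_maximalAtlas p)).grycak_eq (x := φ p)
    ⟨φ.map_source hp, by rw [Set.mem_preimage, φ.left_inv hp]; exact mem_chart_source _ p⟩
  simp only [φ.left_inv hp] at h1
  exact h1.symm

theorem contMDiff_grycakFun
    (hsm : ∀ φ ∈ IsManifold.maximalAtlas 𝓘(ℝ, E n) ∞ M, Sm φ.target (grycak (g.coord φ))) :
    ContMDiff 𝓘(ℝ, E n) 𝓘(ℝ, ℝ) ∞ (grycakFun g) := by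
  intro p
  have hφ := IsManifold.chart_mem_maximalAtlas (I := 𝓘(ℝ, E n)) (n := ∞) p
  have h1 : ContMDiffOn 𝓘(ℝ, E n) 𝓘(ℝ, ℝ) ∞
      (fun q => grycak (g.coord (chartAt (E n) p)) (chartAt (E n) p q))
      (chartAt (E n) p).source :=
    (contMDiffOn_iff_contDiffOn.2 (hsm _ hφ)).comp (contMDiffOn_of_mem_maximalAtlas hφ)
      fun q hq => (chartAt (E n) p).map_source hq
  have h2 : ContMDiffOn 𝓘(ℝ, E n) 𝓘(ℝ, ℝ) ∞ (grycakFun g) (chartAt (E n) p).source :=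
    h1.congr fun q hq => grycakFun_apply hφ hq
  exact h2.contMDiffAt ((chartAt (E n) p).open_source.mem_nhds (mem_chart_source _ p))

/-- The operator `h` of a conformally recurrent manifold has two eigenvalues of constant
multiplicity, and `K` is a multiple of its traceless part. -/
theorem exists_global_spectral (hn : 5 ≤ n) [ConnectedSpace M] {α : CovectorField n M}
    (hrec : IsConformallyRecurrent g α) (hC : WeylSqNeZero g) (hh : ¬ HProportional g) :
    ∃ nh : ℕ, 0 < nh ∧ nh < n ∧ ∀ φ ∈ IsManifold.maximalAtlas 𝓘(ℝ, E n) ∞ M, ∀ x ∈ φ.target,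
      (hOp (g.coord φ) x - lam n • 1) * (hOp (g.coord φ) x - lam' n nh • 1) = 0 ∧
        kPerp (g.coord φ) x = 0 := by
  have hloc := fun φ (hφ : φ ∈ IsManifold.maximalAtlas 𝓘(ℝ, E n) ∞ M) =>
    localRecurrent_coord hn hrec hC hφ
  -- A single zero of the parallel operator h₀ would spread over M and make h equal to g/n
  -- everywhere.
  have hH : ∀ φ ∈ IsManifold.maximalAtlas 𝓘(ℝ, E n) ∞ M, ∀ x ∈ φ.target,
      hTl (g.coord φ) x ≠ 0 := by
    intro φ₀ hφ₀ x₀ hx₀ h₀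
    apply hh
    refine ⟨fun _ => 1 / (n : ℝ), fun φ hφ x hx => ?_⟩
    have h1 := forall_coord_eq_zero hTl (fun h hx => h.hTl_eq hx)
      (fun φ hφ => (hloc φ hφ).smooth_hTl)
      (fun φ hφ x hx => (hloc φ hφ).eventually_hTl_eq_zero hx) hφ₀ hx₀ h₀ φ hφ x hx
    rw [hTl, sub_eq_zero] at h1
    rw [← (hloc φ hφ).mul_hOp hx, h1, mul_smul_comm, mul_one]
  obtain ⟨p, hp⟩ := hrec.1
  have hφ := IsManifold.chart_mem_maximalAtlas (I := 𝓘(ℝ, E n)) (n := ∞) p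
  set φ := chartAt (E n) p
  have hpφ : p ∈ φ.source := mem_chart_source _ p
  have hα : α.coord φ (φ p) ≠ 0 :=
    coord_ne_zero α hφ (φ.map_source hpφ) (by rw [φ.left_inv hpφ]; exact hp)
  obtain ⟨y, hy, -, ⟨l', hl'⟩, s, hs⟩ :=
    (hloc φ hφ).exists_spectral (φ.map_source hpφ) hα (hH φ hφ)
  -- The second eigenvalue found at one point is replaced by its expression in n and `nh`, so the
  -- polynomial propagated over M has constant coefficients.
  obtain ⟨nh, h0, hnh, rfl⟩ :=
    exists_multiplicity hn ((hloc φ hφ).trace_hOp hy) hl' (hH φ hφ y hy)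
  refine ⟨nh, h0, hnh, fun ψ hψ x hx => ⟨?_, ?_⟩⟩
  · refine forall_coord_eq_zero
      (fun g x => (hOp g x - lam n • 1) * (hOp g x - lam' n nh • 1)) (fun h hx => ?_)
      (fun φ hφ => ((hloc φ hφ).smooth_hOp.sub (MSm.const _)).mul
        ((hloc φ hφ).smooth_hOp.sub (MSm.const _)))
      (fun φ hφ x hx => (hloc φ hφ).eventually_quadratic _ _ hx) hφ hy hl' ψ hψ x hx
    simp only [h.hOp_sub_eq hx, h.conj_mul hx]
  · refine forall_coord_eq_zero kPerp (fun h hx => h.kPerp_eq hx)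
      (fun φ hφ => (hloc φ hφ).smooth_kPerp)
      (fun φ hφ x hx => (hloc φ hφ).eventually_kPerp_eq_zero hx) hφ hy ?_ ψ hψ x hx
    rw [kPerp, hs, smul_mul_assoc, Matrix.trace_smul, smul_eq_mul]
    module

end Global
end ConfRec
end

/-! ### The theorem on the manifold. -/

open ConfRec in
theorem mainTheorem2 {n : ℕ} (hn : 5 ≤ n) {M : Type*} [TopologicalSpace M]
    [ChartedSpace (E n) M] [IsManifold 𝓘(ℝ, E n) ∞ M] [T2Space M] [ConnectedSpace M]
    (g : PseudoRiemannianMetric n M) (α : CovectorField n M)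
    (hrec : IsConformallyRecurrent g α) (hC : WeylSqNeZero g) (hh : ¬ HProportional g) :
    ∃ (nh : ℕ) (G : M → ℝ), 0 < nh ∧ nh < n ∧ ContMDiff 𝓘(ℝ, E n) 𝓘(ℝ, ℝ) ∞ G ∧
      ∀ φ ∈ IsManifold.maximalAtlas 𝓘(ℝ, E n) ∞ M, ∀ x ∈ φ.target,
        -- Grycak's relation
        (ricci (g.coord φ) x - (scal (g.coord φ) x / n) • g.coord φ x
          = G (φ.symm x) • (hTensor (g.coord φ) x - (1 / (n : ℝ)) • g.coord φ x)) ∧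
        -- `n_h` is the dimension of the eigenspace of `h` for the eigenvalue `(n-3)/(2(n-2))`,
        -- and `P` is a projector onto that eigenspace
        Module.finrank ℝ (Module.End.eigenspace (Matrix.toLin' (hOp (g.coord φ) x))
          (((n : ℝ) - 3) / (2 * ((n : ℝ) - 2)))) = nh ∧
        proj nh (g.coord φ) x * proj nh (g.coord φ) x = proj nh (g.coord φ) x ∧
        (Matrix.toLin' (proj nh (g.coord φ) x)).range
          = Module.End.eigenspace (Matrix.toLin' (hOp (g.coord φ) x))
              (((n : ℝ) - 3) / (2 * ((n : ℝ) - 2))) ∧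
        (proj nh (g.coord φ) x).rank = nh ∧
        HasIntegralSubmanifold nh (proj nh (g.coord φ)) φ.target x ∧
        -- the spectrum of the Ricci tensor, with multiplicities
        (∀ ν : ℝ, Module.End.HasEigenvalue (Matrix.toLin' (ricciOp (g.coord φ) x)) ν ↔
          ν = mu n (scal (g.coord φ) x) (G (φ.symm x)) ∨
          ν = mu' n nh (scal (g.coord φ) x) (G (φ.symm x))) ∧
        (ricciOp (g.coord φ) x).charpoly
          = (Polynomial.X - Polynomial.C (mu n (scal (g.coord φ) x) (G (φ.symm x)))) ^ nh
            * (Polynomial.X - Polynomial.C (mu' n nh (scal (g.coord φ) x) (G (φ.symm x))))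
                ^ (n - nh) ∧
        -- the spectral decomposition
        (ricciOp (g.coord φ) x
          = mu n (scal (g.coord φ) x) (G (φ.symm x)) • proj nh (g.coord φ) x
            + mu' n nh (scal (g.coord φ) x) (G (φ.symm x)) • (1 - proj nh (g.coord φ) x)) ∧
        (scal (g.coord φ) x
          = nh * mu n (scal (g.coord φ) x) (G (φ.symm x))
            + ((n : ℝ) - nh) * mu' n nh (scal (g.coord φ) x) (G (φ.symm x))) ∧
        -- the recurrence vector
        (proj nh (g.coord φ) x).mulVec (α.coordUp g φ x) = α.coordUp g φ x ∧
        (ricciOp (g.coord φ) x).mulVec (α.coordUp g φ x)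
          = mu n (scal (g.coord φ) x) (G (φ.symm x)) • α.coordUp g φ x := by
  obtain ⟨nh, h0, hnh, hspec⟩ := exists_global_spectral hn hrec hC hh
  have hloc := fun φ (hφ : φ ∈ IsManifold.maximalAtlas 𝓘(ℝ, E n) ∞ M) =>
    localRecurrent_coord hn hrec hC hφ
  have hq := fun φ hφ x hx => (hspec φ hφ x hx).1
  have hk := fun φ hφ x hx => (hspec φ hφ x hx).2
  refine ⟨nh, grycakFun g, h0, hnh, contMDiff_grycakFun fun φ hφ =>
    (hloc φ hφ).smooth_grycak h0 hnh (hq φ hφ), fun φ hφ x hx => ?_⟩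
  -- Invariance of G allows every assertion to be checked in the given chart φ alone.
  have hG : grycakFun g (φ.symm x) = grycak (g.coord φ) x := by
    rw [grycakFun_apply hφ (φ.map_target hx), φ.right_inv hx]
  rw [hG]
  have h := hloc φ hφ
  exact ⟨h.ricci_sub_eq h0 hnh (hq φ hφ) (hk φ hφ) hx, h.finrank_eigenspace hnh (hq φ hφ) hx,
    h.proj_mul_self hnh (hq φ hφ) hx, h.range_proj hnh (hq φ hφ) hx, h.rank_proj hnh (hq φ hφ) hx,
    h.toLocalMetric.hasIntegralSubmanifold h.smooth_proj (fun _ hz => h.nab_proj hz)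
      (fun _ hz => h.proj_mul_self hnh (hq φ hφ) hz) (fun _ hz => h.rank_proj hnh (hq φ hφ) hz) hx,
    h.hasEigenvalue_ricciOp_iff h0 hnh (hq φ hφ) (hk φ hφ) hx,
    h.charpoly_ricciOp h0 hnh (hq φ hφ) (hk φ hφ) hx,
    h.ricciOp_eq_proj h0 hnh (hq φ hφ) (hk φ hφ) hx, h.scal_eq_mu h0 hnh (hq φ hφ) (hk φ hφ) hx,
    h.proj_mulVec_recur hnh hx, h.ricciOp_mulVec_recur h0 hnh (hq φ hφ) (hk φ hφ) hx⟩
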